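/- Conventions. All graphs are finite, simple and have at least one vertex; a \emph{class of graphs} is a set of isomorphism classes of such graphs. $G^c$ is the complement of $G$, $G+H$ is the disjoint union, $K_1$ is the graph with one vertex. For a class $\mathcal F$, $\mathcal F_{conn}$ is the class of connected graphs in $\mathcal F$, and $\mathrm{co}(\mathcal F)$ (the class of \emph{$\mathcal F$-cographs}) is the smallest class of graphs that contains $\mathcal F$ and is closed under sums $G+H$ and complements. A square matrix $u=(u_{ij})_{i,j\in I}$ over a unital complex $*$-algebra is \emph{magic} if $u_{ij}=u_{ij}^*=u_{ij}^2$, $\sum_j u_{ij}=1=\sum_j u_{ji}$ for all $i$, and $u_{ij}u_{ik}=0=u_{ji}u_{ki}$ whenever $j\neq k$. Graphs $G,H$ with the same number of vertices are \emph{quantum isomorphic} if there are a nonzero unital $C^*$-algebra $X$ and a magic matrix $P$ over $X$ (indexed by $V(H)\times V(G)$) with $P\,\mathrm{Adj}(G)=\mathrm{Adj}(H)\,P$. A \emph{quantum permutation group} is a pair $(A,u)$, where $A$ is a unital complex $*$-algebra generated by the entries of a magic matrix $u=(u_{ij})_{i,j\in I}$ with $I$ finite and nonempty, such that there is a unital $*$-morphism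 $\Delta\colon A\to A\otimes A$ (algebraic tensor product) with $\Delta(u_{ij})=\sum_k u_{ik}\otimes u_{kj}$. Two of them are isomorphic if there is a $*$-isomorphism of their algebras that intertwines the comultiplications $\Delta$ (the matrices $u$ need not correspond, nor have the same size). A \emph{family} of quantum permutation groups is a set of isomorphism classes. $S_n^+$ $(n\ge1)$ is given by the universal unital $*$-algebra generated by the entries of an $n\times n$ magic matrix. The \emph{quantum automorphism group} $\mathrm{Qu}(G)$ is given by the universal unital $*$-algebra generated by the entries of a magic matrix $u$ indexed by $V(G)$ with $\mathrm{Adj}(G)u=u\,\mathrm{Adj}(G)$. The \emph{free product} of $(A,u)$ and $(B,v)$ is $(A*B,\mathrm{diag}(u,v))$, with $*$ the unital free product. The \emph{wreath product} $(A,u)\wr S_n^+$ $(n\ge 1)$ has as algebra the quotient of $A^{*n}*\mathcal O(S_n^+)$ by the relations $\nu_i(a)p_{ij}=p_{ij}\nu_i(a)$ ($a\in A$, $1\le i,j\le n$), where $\nu_i$ is the inclusion of the $i$-th copy of $A$ and $p$ is the generating matrix of $S_n^+$; its generating matrix is $w_{(i,k),(j,l)}=\nu_i(u_{kl})p_{ij}$.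 The \emph{Jordan closure} $\mathrm{Jor}(\mathcal Q)$ of a family $\mathcal Q$ is the smallest family that contains $\mathcal Q$ and is closed under free products and under wreath products with $S_n^+$ for all $n\ge1$. For a class $\mathcal F$ put $\mathrm{Qu}(\mathcal F)=\{\mathrm{Qu}(G)\mid G\in\mathcal F\}$. Theorem. Let $\mathcal F$ be a class of graphs such that \begin{enumerate} \item $K_1\in\mathcal F$, \item (QI) any two graphs $G,H\in\mathcal F$ are quantum isomorphic if and only if they are isomorphic, \item $\mathcal F$ is closed under taking complements, \item $\mathcal F$ is closed under taking connected components. \end{enumerate} Then $$\mathrm{Qu}(\mathrm{co}(\mathcal F))=\mathrm{Jor}(\mathrm{Qu}(\mathcal F_{conn}))=\mathrm{Jor}(\mathrm{Qu}(\mathrm{co}(\mathcal F)))$$ as families of quantum permutation groups up to isomorphism. -/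

import Mathlib

open scoped TensorProduct

set_option linter.unusedSectionVars false

noncomputable section

namespace QGraph

/-! ### Universal unital star-algebras given by generators and relations -/

/-- The underlying ring is `Bᵐᵒᵖ`, with the conjugate complex structure. -/
def ConjOp (B : Type) : Type := Bᵐᵒᵖ

instance (B : Type) [Ring B] : Ring (ConjOp B) := inferInstanceAs (Ring Bᵐᵒᵖ)

instance (B : Type) [Ring B] [Algebra ℂ B] : Algebra ℂ (ConjOp B) :=
  RingHom.toAlgebra' ((algebraMap ℂ Bᵐᵒᵖ).comp (starRingEnd ℂ))
    (fun c x => Algebra.commutes (A := Bᵐᵒᵖ) (starRingEnd ℂ c) x)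

theorem ConjOp.algebraMap_eq (B : Type) [Ring B] [Algebra ℂ B] (c : ℂ) :
    (algebraMap ℂ (ConjOp B) c : ConjOp B)
      = (MulOpposite.op (algebraMap ℂ B (starRingEnd ℂ c)) : Bᵐᵒᵖ) := rfl

/-- The algebra `ℂ⟨x, x* : x ∈ X⟩` of noncommutative `*`-polynomials in the variables `X`:
`Sum.inl x` is the variable `x` and `Sum.inr x` is `x*`. -/
def StarPoly (X : Type) : Type := FreeAlgebra ℂ (X ⊕ X)

namespace StarPoly

variable {X : Type}

instance : Ring (StarPoly X) := inferInstanceAs (Ring (FreeAlgebra ℂ (X ⊕ X)))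

instance : Algebra ℂ (StarPoly X) := inferInstanceAs (Algebra ℂ (FreeAlgebra ℂ (X ⊕ X)))

/-- A variable or the adjoint of a variable. -/
def letter (z : X ⊕ X) : StarPoly X := FreeAlgebra.ι ℂ z

/-- A variable. -/
def var (x : X) : StarPoly X := letter (Sum.inl x)

theorem algHom_ext {B : Type} [Semiring B] [Algebra ℂ B] {f g : StarPoly X →ₐ[ℂ] B}
    (h : ∀ z, f (letter z) = g (letter z)) : f = g :=
  FreeAlgebra.hom_ext (funext h)

theorem induction {C : StarPoly X → Prop} (hc : ∀ c : ℂ, C (algebraMap ℂ _ c))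
    (hv : ∀ z, C (letter z)) (hm : ∀ a b, C a → C b → C (a * b))
    (ha : ∀ a b, C a → C b → C (a + b)) (a : StarPoly X) : C a :=
  FreeAlgebra.induction ℂ (X ⊕ X) hc hv hm ha a

/-- The antilinear antiautomorphism exchanging `x` and `x*`. -/
def starHom : StarPoly X →ₐ[ℂ] ConjOp (StarPoly X) :=
  FreeAlgebra.lift ℂ (fun z : X ⊕ X => (MulOpposite.op (letter z.swap) : (StarPoly X)ᵐᵒᵖ))

/-- The star operation. -/
def starFun (a : StarPoly X) : StarPoly X :=
  MulOpposite.unop (show (StarPoly X)ᵐᵒᵖ from starHom a)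

theorem starFun_letter (z : X ⊕ X) : starFun (letter z) = letter z.swap := by
  have : starHom (letter z) = (MulOpposite.op (letter z.swap) : (StarPoly X)ᵐᵒᵖ) :=
    FreeAlgebra.lift_ι_apply _ _
  unfold starFun
  rw [this]
  rfl

theorem starFun_algebraMap (c : ℂ) :
    starFun (algebraMap ℂ (StarPoly X) c) = algebraMap ℂ _ (starRingEnd ℂ c) := by
  unfold starFun
  rw [AlgHom.commutes, ConjOp.algebraMap_eq]
  rfl

theorem starFun_add (a b : StarPoly X) : starFun (a + b) = starFun a + starFun b := by
  unfold starFun; rw [map_add]; rfl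

theorem starFun_mul (a b : StarPoly X) : starFun (a * b) = starFun b * starFun a := by
  unfold starFun; rw [map_mul]; rfl

instance : StarRing (StarPoly X) where
  star := starFun
  star_involutive a := by
    induction a using induction with
    | hc c => rw [starFun_algebraMap, starFun_algebraMap, Complex.conj_conj]
    | hv z => rw [starFun_letter, starFun_letter, Sum.swap_swap]
    | hm a b ha hb => rw [starFun_mul, starFun_mul, ha, hb]
    | ha a b ha hb => rw [starFun_add, starFun_add, ha, hb]
  star_mul := starFun_mul
  star_add := starFun_add

theorem star_letter (z : X ⊕ X) : star (letter z) = letter z.swap := starFun_letter z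

theorem star_algebraMap (c : ℂ) :
    star (algebraMap ℂ (StarPoly X) c) = algebraMap ℂ _ (star c) := starFun_algebraMap c

instance : StarModule ℂ (StarPoly X) where
  star_smul c a := by
    rw [Algebra.smul_def, star_mul, star_algebraMap, Algebra.smul_def, Algebra.commutes]

variable {B : Type} [Ring B] [StarRing B] [Algebra ℂ B] [StarModule ℂ B]

/-- Evaluation of `*`-polynomials at a family of elements of a unital `*`-algebra. -/
def eval (f : X → B) : StarPoly X →⋆ₐ[ℂ] B where
  __ := (FreeAlgebra.lift ℂ (Sum.elim f (fun x => star (f x))) : FreeAlgebra ℂ (X ⊕ X) →ₐ[ℂ] B)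
  map_star' a := by
    let F : StarPoly X →ₐ[ℂ] B := FreeAlgebra.lift ℂ (Sum.elim f (fun x => star (f x)))
    change F (star a) = star (F a)
    have hl : ∀ z, F (letter z) = Sum.elim f (fun x => star (f x)) z :=
      fun z => FreeAlgebra.lift_ι_apply _ _
    induction a using induction with
    | hc c => rw [star_algebraMap, AlgHom.commutes, AlgHom.commutes, algebraMap_star_comm]
    | hv z => rw [star_letter, hl, hl]; cases z <;> simp
    | hm a b ha hb => rw [star_mul, map_mul, map_mul, star_mul, ha, hb]
    | ha a b ha hb => rw [star_add, map_add, map_add, star_add, ha, hb]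

@[simp] theorem eval_var (f : X → B) (x : X) : eval f (var x) = f x :=
  FreeAlgebra.lift_ι_apply (R := ℂ) (Sum.elim f (fun x => star (f x))) (Sum.inl x)

end StarPoly

/-- The smallest star-invariant relation on `*`-polynomials containing `r`. -/
def StarRel {X : Type} (r : StarPoly X → StarPoly X → Prop) (a b : StarPoly X) : Prop :=
  r a b ∨ r (star a) (star b)

/-- The universal unital `*`-algebra generated by `X` with the relations `a = b` for `r a b`. -/
def Universal {X : Type} (r : StarPoly X → StarPoly X → Prop) : Type := RingQuot (StarRel r)

namespace Universal

variable {X : Type} {r : StarPoly X → StarPoly X → Prop}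

instance : Ring (Universal r) := inferInstanceAs (Ring (RingQuot (StarRel r)))

instance : Algebra ℂ (Universal r) := inferInstanceAs (Algebra ℂ (RingQuot (StarRel r)))

/-- The quotient map, as a morphism of algebras. -/
def mkAlg (r : StarPoly X → StarPoly X → Prop) : StarPoly X →ₐ[ℂ] Universal r :=
  RingQuot.mkAlgHom ℂ (StarRel r)

theorem mkAlg_surjective : Function.Surjective (mkAlg r) :=
  RingQuot.mkAlgHom_surjective ℂ (StarRel r)

theorem mkAlg_rel {a b : StarPoly X} (h : StarRel r a b) : mkAlg r a = mkAlg r b :=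
  RingQuot.mkAlgHom_rel ℂ h

/-- The star operation of the quotient, with values in the opposite ring. -/
def starHom (r : StarPoly X → StarPoly X → Prop) : Universal r →+* (Universal r)ᵐᵒᵖ :=
  RingQuot.lift (r := StarRel r)
    ⟨(RingHom.op (mkAlg r : StarPoly X →+* Universal r)).comp
      (starRingEquiv : StarPoly X ≃+* (StarPoly X)ᵐᵒᵖ).toRingHom, fun a b h => by
        have h' : StarRel r (star a) (star b) := by
          rcases h with h | h
          · exact Or.inr (by simpa using h)
          · exact Or.inl h
        exact congrArg MulOpposite.op (mkAlg_rel h')⟩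

theorem starHom_mk (a : StarPoly X) :
    starHom r (mkAlg r a) = MulOpposite.op (mkAlg r (star a)) := by
  have : mkAlg r a = RingQuot.mkRingHom (StarRel r) a :=
    congrArg (fun f => f a) (RingQuot.mkAlgHom_coe ℂ (StarRel r))
  rw [this]
  exact RingQuot.lift_mkRingHom_apply _ _ _

instance : StarRing (Universal r) where
  star a := MulOpposite.unop (starHom r a)
  star_involutive a := by
    obtain ⟨a, rfl⟩ := mkAlg_surjective a
    simp [starHom_mk]
  star_mul a b := by rw [map_mul]; rfl
  star_add a b := by rw [map_add]; rfl

theorem star_mk (a : StarPoly X) : star (mkAlg r a) = mkAlg r (star a) :=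
  congrArg MulOpposite.unop (starHom_mk a)

instance : StarModule ℂ (Universal r) where
  star_smul c a := by
    obtain ⟨a, rfl⟩ := mkAlg_surjective a
    rw [← map_smul, star_mk, star_smul, map_smul, star_mk]

/-- The quotient map. -/
def mk (r : StarPoly X → StarPoly X → Prop) : StarPoly X →⋆ₐ[ℂ] Universal r where
  __ := mkAlg r
  map_star' a := (star_mk a).symm

/-- The generators. -/
def gen (r : StarPoly X → StarPoly X → Prop) (x : X) : Universal r := mk r (StarPoly.var x)

theorem mk_rel {a b : StarPoly X} (h : r a b) : mk r a = mk r b := mkAlg_rel (Or.inl h)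

@[simp] theorem mk_var (x : X) : mk r (StarPoly.var x) = gen r x := rfl

variable {B : Type} [Ring B] [StarRing B] [Algebra ℂ B] [StarModule ℂ B]

/-- The universal property. -/
def lift (f : X → B) (h : ∀ a b, r a b → StarPoly.eval f a = StarPoly.eval f b) :
    Universal r →⋆ₐ[ℂ] B :=
  let F : Universal r →ₐ[ℂ] B := RingQuot.liftAlgHom ℂ (s := StarRel r)
    ⟨(StarPoly.eval f).toAlgHom, fun a b hab => by
      rcases hab with hab | hab
      · exact h a b hab
      · have := h _ _ hab
        rw [map_star, map_star] at this
        exact star_injective this⟩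
  have hF : ∀ a, F (mkAlg r a) = StarPoly.eval f a :=
    fun a => RingQuot.liftAlgHom_mkAlgHom_apply ℂ _ _ _
  { F with
    map_star' := fun a => by
      obtain ⟨a, rfl⟩ := mkAlg_surjective a
      change F (star (mkAlg r a)) = star (F (mkAlg r a))
      rw [star_mk, hF, hF, map_star] }

@[simp] theorem lift_gen (f : X → B) (h : ∀ a b, r a b → StarPoly.eval f a = StarPoly.eval f b)
    (x : X) : lift f h (gen r x) = f x :=
  (RingQuot.liftAlgHom_mkAlgHom_apply ℂ _ _ _).trans (StarPoly.eval_var f x)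

theorem adjoin_gen : StarAlgebra.adjoin ℂ (Set.range (gen r)) = ⊤ := by
  rw [eq_top_iff]
  rintro a -
  obtain ⟨a, rfl⟩ := mkAlg_surjective a
  change mk r a ∈ _
  induction a using StarPoly.induction with
  | hc c => rw [AlgHomClass.commutes]; exact algebraMap_mem _ c
  | hv z =>
    have hx : ∀ x, mk r (StarPoly.letter (Sum.inl x)) ∈
        StarAlgebra.adjoin ℂ (Set.range (gen r)) :=
      fun x => StarAlgebra.subset_adjoin ℂ _ ⟨x, rfl⟩
    cases z with
    | inl x => exact hx x
    | inr x =>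
      have : StarPoly.letter (Sum.inr x) = star (StarPoly.letter (Sum.inl x)) := by
        rw [StarPoly.star_letter]; rfl
      rw [this, map_star]
      exact star_mem (hx x)
  | hm a b ha hb => rw [map_mul]; exact mul_mem ha hb
  | ha a b ha hb => rw [map_add]; exact add_mem ha hb

end Universal

/-! ### Quantum permutation groups -/

/-- The matrix `u` satisfies the magic relations: its entries are self-adjoint projections, they
sum up to `1` on each row and each column, and they are orthogonal on each row and each column. -/
structure IsMagic {I J A : Type} [Fintype I] [Fintype J] [Ring A] [StarRing A]
    (u : Matrix I J A) : Prop where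
  star_eq : ∀ i j, star (u i j) = u i j
  idem : ∀ i j, u i j * u i j = u i j
  row_sum : ∀ i, ∑ j, u i j = 1
  col_sum : ∀ j, ∑ i, u i j = 1
  row_orth : ∀ i j k, j ≠ k → u i j * u i k = 0
  col_orth : ∀ i k j, i ≠ k → u i j * u k j = 0

/-- The matrix of variables. -/
def varMatrix (I : Type) : Matrix I I (StarPoly (I × I)) := Matrix.of fun i j => StarPoly.var (i, j)

/-- The magic relations between the entries of the matrix of variables. -/
inductive MagicRel (I : Type) [Fintype I] : StarPoly (I × I) → StarPoly (I × I) → Prop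
  | star_eq (i j : I) : MagicRel I (star (varMatrix I i j)) (varMatrix I i j)
  | idem (i j : I) : MagicRel I (varMatrix I i j * varMatrix I i j) (varMatrix I i j)
  | row_sum (i : I) : MagicRel I (∑ j, varMatrix I i j) 1
  | col_sum (j : I) : MagicRel I (∑ i, varMatrix I i j) 1
  | row_orth (i j k : I) : j ≠ k → MagicRel I (varMatrix I i j * varMatrix I i k) 0
  | col_orth (i k j : I) : i ≠ k → MagicRel I (varMatrix I i j * varMatrix I k j) 0

section Tensor

variable {A B C D : Type} [Ring A] [StarRing A] [Algebra ℂ A] [StarModule ℂ A]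
  [Ring B] [StarRing B] [Algebra ℂ B] [StarModule ℂ B]
  [Ring C] [StarRing C] [Algebra ℂ C] [StarModule ℂ C]
  [Ring D] [StarRing D] [Algebra ℂ D] [StarModule ℂ D]

/-- The morphism `f ⊗ g`. -/
def tensorMap (f : A →⋆ₐ[ℂ] B) (g : C →⋆ₐ[ℂ] D) : A ⊗[ℂ] C →⋆ₐ[ℂ] B ⊗[ℂ] D where
  __ := Algebra.TensorProduct.map f.toAlgHom g.toAlgHom
  map_star' x := by
    change Algebra.TensorProduct.map f.toAlgHom g.toAlgHom (star x)
      = star (Algebra.TensorProduct.map f.toAlgHom g.toAlgHom x)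
    induction x with
    | zero => simp
    | tmul a c =>
      simp only [TensorProduct.star_tmul, Algebra.TensorProduct.map_tmul]
      exact congrArg₂ _ (map_star f a) (map_star g c)
    | add x y hx hy => rw [star_add, map_add, map_add, star_add, hx, hy]

@[simp] theorem tensorMap_tmul (f : A →⋆ₐ[ℂ] B) (g : C →⋆ₐ[ℂ] D) (a : A) (c : C) :
    tensorMap f g (a ⊗ₜ c) = f a ⊗ₜ g c := rfl

/-- The matrix with entries `∑ k, u i k ⊗ v k j`. -/
def tensorProd {I J K : Type} [Fintype J] (u : Matrix I J A) (v : Matrix J K B) :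
    Matrix I K (A ⊗[ℂ] B) := Matrix.of fun i k => ∑ j, u i j ⊗ₜ[ℂ] v j k

theorem tensorProd_apply {I J K : Type} [Fintype J] (u : Matrix I J A) (v : Matrix J K B)
    (i : I) (k : K) : tensorProd u v i k = ∑ j, u i j ⊗ₜ[ℂ] v j k := rfl

theorem IsMagic.tensorProd_mul {I : Type} [Fintype I] {u : Matrix I I A} {v : Matrix I I B}
    (hu : IsMagic u) (i j l : I) :
    tensorProd u v i j * tensorProd u v i l = ∑ k, u i k ⊗ₜ[ℂ] (v k j * v k l) := by
  simp only [tensorProd_apply, Finset.sum_mul_sum, Algebra.TensorProduct.tmul_mul_tmul]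
  refine Finset.sum_congr rfl fun k _ => ?_
  rw [Finset.sum_eq_single k]
  · rw [hu.idem]
  · intro m _ hm
    rw [hu.row_orth _ _ _ hm.symm, TensorProduct.zero_tmul]
  · simp

theorem IsMagic.tensorProd_mul' {I : Type} [Fintype I] {u : Matrix I I A} {v : Matrix I I B}
    (hv : IsMagic v) (i l j : I) :
    tensorProd u v i j * tensorProd u v l j = ∑ k, (u i k * u l k) ⊗ₜ[ℂ] v k j := by
  simp only [tensorProd_apply, Finset.sum_mul_sum, Algebra.TensorProduct.tmul_mul_tmul]
  refine Finset.sum_congr rfl fun k _ => ?_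
  rw [Finset.sum_eq_single k]
  · rw [hv.idem]
  · intro m _ hm
    rw [hv.col_orth _ _ _ hm.symm, TensorProduct.tmul_zero]
  · simp

theorem IsMagic.tensorProd {I : Type} [Fintype I] {u : Matrix I I A} {v : Matrix I I B}
    (hu : IsMagic u) (hv : IsMagic v) : IsMagic (tensorProd u v) where
  star_eq i j := by simp [tensorProd_apply, star_sum, hu.star_eq, hv.star_eq]
  idem i j := by rw [hu.tensorProd_mul]; simp only [hv.idem, tensorProd_apply]
  row_sum i := by
    simp only [tensorProd_apply]
    rw [Finset.sum_comm]
    simp only [← TensorProduct.tmul_sum, hv.row_sum, ← TensorProduct.sum_tmul, hu.row_sum]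
    rfl
  col_sum j := by
    simp only [tensorProd_apply]
    rw [Finset.sum_comm]
    simp only [← TensorProduct.sum_tmul, hu.col_sum, ← TensorProduct.tmul_sum, hv.col_sum]
    rfl
  row_orth i j k h := by simp [hu.tensorProd_mul, hv.row_orth _ _ _ h]
  col_orth i k j h := by simp [hv.tensorProd_mul', hu.col_orth _ _ _ h]

/-- If `T t` are morphisms and `e t` orthogonal projections with sum `1`, and if the image of `T t`
commutes with `e t`, then `a ↦ ∑ t, T t a * e t` is a morphism. -/
def sumHom {I : Type} [Fintype I] (T : I → A →⋆ₐ[ℂ] B) (e : I → B) (hs : ∀ t, star (e t) = e t)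
    (hi : ∀ t, e t * e t = e t) (ho : ∀ s t, s ≠ t → e s * e t = 0) (h1 : ∑ t, e t = 1)
    (hc : ∀ t a, Commute (T t a) (e t)) : A →⋆ₐ[ℂ] B where
  toFun a := ∑ t, T t a * e t
  map_one' := by simp [h1]
  map_mul' a b := by
    rw [Finset.sum_mul_sum]
    refine Finset.sum_congr rfl fun s _ => ?_
    rw [Finset.sum_eq_single s]
    · rw [map_mul, mul_assoc (T s a) (e s), ← mul_assoc (e s) (T s b), ← (hc s b).eq, mul_assoc,
        mul_assoc (T s b), hi]
    · intro t _ ht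
      rw [(hc t b).eq, mul_assoc (T s a), ← mul_assoc (e s), ho s t ht.symm, zero_mul, mul_zero]
    · simp
  map_zero' := by simp
  map_add' a b := by simp [add_mul, Finset.sum_add_distrib]
  commutes' c := by
    simp only [AlgHomClass.commutes]
    rw [← Finset.mul_sum, h1, mul_one]
  map_star' a := by
    rw [star_sum]
    refine Finset.sum_congr rfl fun t _ => ?_
    rw [star_mul, hs, map_star, ← map_star, (hc t _).eq]

end Tensor

theorem eval_magicRel {I A : Type} [Fintype I] [Ring A] [StarRing A] [Algebra ℂ A] [StarModule ℂ A]
    {u : Matrix I I A} (hu : IsMagic u) {a b : StarPoly (I × I)} (h : MagicRel I a b) :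
    StarPoly.eval (fun x : I × I => u x.1 x.2) a = StarPoly.eval (fun x : I × I => u x.1 x.2) b := by
  have hv : ∀ i j, StarPoly.eval (fun x : I × I => u x.1 x.2) (varMatrix I i j) = u i j :=
    fun i j => StarPoly.eval_var _ _
  cases h with
  | star_eq i j => simp only [map_star, hv, hu.star_eq]
  | idem i j => simp only [map_mul, hv, hu.idem]
  | row_sum i => simp only [map_sum, hv, hu.row_sum, map_one]
  | col_sum i => simp only [map_sum, hv, hu.col_sum, map_one]
  | row_orth i j k h => simp only [map_mul, hv, hu.row_orth _ _ _ h, map_zero]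
  | col_orth i k j h => simp only [map_mul, hv, hu.col_orth _ _ _ h, map_zero]

/-- A quantum permutation group: a unital `*`-algebra generated by the entries of a square matrix
`u` (of size at least one, indexed by a finite set `I`) which satisfy the magic relations, such that
there is a (necessarily unique) comultiplication with `Δ (u i j) = ∑ k, u i k ⊗ u k j`. -/
structure QuantumPermGroup where
  /-- The index set of the generating matrix. -/
  I : Type
  [fintype : Fintype I]
  [nonempty : Nonempty I]
  /-- The algebra of coefficients. -/
  alg : Type
  [ring : Ring alg]
  [starRing : StarRing alg]
  [algebra : Algebra ℂ alg]
  [starModule : StarModule ℂ alg]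
  u : Matrix I I alg
  magic : IsMagic u
  generates : StarAlgebra.adjoin ℂ (Set.range fun x : I × I => u x.1 x.2) = ⊤
  comul : alg →⋆ₐ[ℂ] alg ⊗[ℂ] alg
  comul_u : ∀ i j, comul (u i j) = ∑ k, u i k ⊗ₜ[ℂ] u k j

namespace QuantumPermGroup

attribute [instance] fintype nonempty ring starRing algebra starModule

/-- Isomorphism of quantum groups: a `*`-isomorphism compatible with the comultiplications. The
matrices of generators need not correspond to each other. -/
def Isomorphic (Γ Λ : QuantumPermGroup) : Prop :=
  ∃ e : Γ.alg ≃⋆ₐ[ℂ] Λ.alg, ∀ a : Γ.alg,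
    Λ.comul (e a) = tensorMap (e : Γ.alg →⋆ₐ[ℂ] Λ.alg) (e : Γ.alg →⋆ₐ[ℂ] Λ.alg) (Γ.comul a)

theorem Isomorphic.refl (Γ : QuantumPermGroup) : Isomorphic Γ Γ := by
  refine ⟨StarAlgEquiv.refl ℂ Γ.alg, fun a => ?_⟩
  change Γ.comul a = _
  induction Γ.comul a with
  | zero => simp
  | tmul x y => rfl
  | add x y hx hy => rw [map_add, ← hx, ← hy]

theorem Isomorphic.symm {Γ Λ : QuantumPermGroup} (h : Isomorphic Γ Λ) : Isomorphic Λ Γ := by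
  obtain ⟨e, he⟩ := h
  refine ⟨e.symm, fun b => ?_⟩
  obtain ⟨a, rfl⟩ : ∃ a, e a = b := ⟨e.symm b, e.apply_symm_apply b⟩
  rw [he, StarAlgEquiv.symm_apply_apply]
  induction Γ.comul a with
  | zero => simp
  | tmul x y => simp
  | add x y hx hy => rw [map_add, map_add, ← hx, ← hy]

theorem Isomorphic.trans {Γ Λ Θ : QuantumPermGroup} (h : Isomorphic Γ Λ) (h' : Isomorphic Λ Θ) :
    Isomorphic Γ Θ := by
  obtain ⟨e, he⟩ := h
  obtain ⟨f, hf⟩ := h'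
  refine ⟨e.trans f, fun a => ?_⟩
  rw [StarAlgEquiv.trans_apply, hf, he]
  induction Γ.comul a with
  | zero => simp
  | tmul x y => simp
  | add x y hx hy => rw [map_add, map_add, map_add, ← hx, ← hy]

instance setoid : Setoid QuantumPermGroup where
  r := Isomorphic
  iseqv := ⟨Isomorphic.refl, Isomorphic.symm, Isomorphic.trans⟩

/-- The quantum permutation group whose algebra is the universal unital `*`-algebra generated by the
entries of a matrix, subject to the magic relations and to additional relations `R`, when these are
compatible with the comultiplication. -/
def ofRelations (I : Type) [Fintype I] [Nonempty I] (R : StarPoly (I × I) → StarPoly (I × I) → Prop)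
    (hR : ∀ {A : Type} [Ring A] [StarRing A] [Algebra ℂ A] [StarModule ℂ A] (u : Matrix I I A),
      (∀ a b, R a b → StarPoly.eval (fun x : I × I => u x.1 x.2) a
        = StarPoly.eval (fun x : I × I => u x.1 x.2) b) →
      (∀ a b, R a b → StarPoly.eval (fun x : I × I => tensorProd u u x.1 x.2) a
        = StarPoly.eval (fun x : I × I => tensorProd u u x.1 x.2) b)) :
    QuantumPermGroup :=
  let r : StarPoly (I × I) → StarPoly (I × I) → Prop := fun a b => MagicRel I a b ∨ R a b
  let p : Matrix I I (Universal r) := Matrix.of fun i j => Universal.gen r (i, j)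
  have hp : ∀ i j, Universal.mk r (varMatrix I i j) = p i j := fun _ _ => rfl
  have magic : IsMagic p :=
    { star_eq := fun i j => by
        rw [← hp, ← map_star]; exact Universal.mk_rel (Or.inl (.star_eq i j))
      idem := fun i j => by
        rw [← hp, ← map_mul]; exact Universal.mk_rel (Or.inl (.idem i j))
      row_sum := fun i => by
        simp only [← hp]; rw [← map_sum, ← map_one (Universal.mk r)]
        exact Universal.mk_rel (Or.inl (.row_sum i))
      col_sum := fun i => by
        simp only [← hp]; rw [← map_sum, ← map_one (Universal.mk r)]
        exact Universal.mk_rel (Or.inl (.col_sum i))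
      row_orth := fun i j k h => by
        simp only [← hp]; rw [← map_mul, ← map_zero (Universal.mk r)]
        exact Universal.mk_rel (Or.inl (.row_orth i j k h))
      col_orth := fun i k j h => by
        simp only [← hp]; rw [← map_mul, ← map_zero (Universal.mk r)]
        exact Universal.mk_rel (Or.inl (.col_orth i k j h)) }
  have heval : ∀ a, StarPoly.eval (fun x : I × I => p x.1 x.2) a = Universal.mk r a := by
    intro a
    have : (StarPoly.eval (fun x : I × I => p x.1 x.2)).toAlgHom = (Universal.mk r).toAlgHom := by
      refine StarPoly.algHom_ext fun z => ?_
      change StarPoly.eval (fun x : I × I => p x.1 x.2) _ = Universal.mk r _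
      cases z with
      | inl x => exact StarPoly.eval_var _ x
      | inr x =>
        have hx : StarPoly.letter (Sum.inr x) = star (StarPoly.var x) := by
          rw [StarPoly.var, StarPoly.star_letter]; rfl
        rw [hx, map_star, map_star, StarPoly.eval_var]; rfl
    exact congrArg (fun f => f a) this
  have hΔ : ∀ a b, r a b → StarPoly.eval (fun x : I × I => tensorProd p p x.1 x.2) a
      = StarPoly.eval (fun x : I × I => tensorProd p p x.1 x.2) b := by
    rintro a b (h | h)
    · exact eval_magicRel (magic.tensorProd magic) h
    · refine hR p (fun a b h => ?_) a b h
      rw [heval, heval]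
      exact Universal.mk_rel (Or.inr h)
  { I := I
    alg := Universal r
    u := p
    magic := magic
    generates := Universal.adjoin_gen
    comul := Universal.lift (fun x : I × I => tensorProd p p x.1 x.2) hΔ
    comul_u := fun i j => Universal.lift_gen _ hΔ (i, j) }

/-- The quantum permutation group `S_n^+`, for `n ≥ 1`. -/
def Splus (n : ℕ) [NeZero n] : QuantumPermGroup :=
  ofRelations (Fin n) (fun _ _ => False) (fun _ _ _ _ h => h.elim)

/-- The generating matrix of `S_n^+`, indexed by `Fin n`. -/
def splusU (n : ℕ) [NeZero n] : Matrix (Fin n) (Fin n) (Splus n).alg := (Splus n).u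

theorem splusU_magic (n : ℕ) [NeZero n] : IsMagic (splusU n) := (Splus n).magic

theorem comul_splusU (n : ℕ) [NeZero n] (i j : Fin n) :
    (Splus n).comul (splusU n i j) = ∑ k, splusU n i k ⊗ₜ[ℂ] splusU n k j := (Splus n).comul_u i j

/-- The relations stating that `f` is a morphism of unital `*`-algebras. -/
inductive HomRel {X A : Type} [Ring A] [StarRing A] [Algebra ℂ A] (f : A → StarPoly X) :
    StarPoly X → StarPoly X → Prop
  | add (a b : A) : HomRel f (f (a + b)) (f a + f b)
  | mul (a b : A) : HomRel f (f (a * b)) (f a * f b)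
  | scalar (c : ℂ) : HomRel f (f (algebraMap ℂ A c)) (algebraMap ℂ (StarPoly X) c)
  | star (a : A) : HomRel f (f (star a)) (star (f a))

section Hom

variable {X A B : Type} [Ring A] [StarRing A] [Algebra ℂ A] [StarModule ℂ A]
  [Ring B] [StarRing B] [Algebra ℂ B] [StarModule ℂ B]

/-- The morphism defined by a map satisfying the relations. -/
def homOfRel (f : A → StarPoly X) (φ : StarPoly X →⋆ₐ[ℂ] B)
    (h : ∀ a b, HomRel f a b → φ a = φ b) : A →⋆ₐ[ℂ] B where
  toFun a := φ (f a)
  map_one' := by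
    have := h _ _ (HomRel.scalar (f := f) 1)
    rwa [map_one, map_one, map_one] at this
  map_zero' := by
    have := h _ _ (HomRel.scalar (f := f) 0)
    rwa [map_zero, map_zero, map_zero] at this
  map_mul' a b := by rw [h _ _ (HomRel.mul a b), map_mul]
  map_add' a b := by rw [h _ _ (HomRel.add a b), map_add]
  commutes' c := by rw [h _ _ (HomRel.scalar c), AlgHomClass.commutes]
  map_star' a := by rw [h _ _ (HomRel.star a), map_star]

theorem eval_homRel {f : A → StarPoly X} {φ : StarPoly X →⋆ₐ[ℂ] B} (g : A →⋆ₐ[ℂ] B)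
    (hg : ∀ a, φ (f a) = g a) {a b : StarPoly X} (h : HomRel f a b) : φ a = φ b := by
  cases h with
  | add a b => rw [map_add, hg, hg, hg, map_add]
  | mul a b => rw [map_mul, hg, hg, hg, map_mul]
  | scalar c => rw [hg, AlgHomClass.commutes, AlgHomClass.commutes]
  | star a => rw [map_star, hg, hg, map_star]

theorem mem_of_generates {I : Type} {u : Matrix I I A}
    (hu : StarAlgebra.adjoin ℂ (Set.range fun x : I × I => u x.1 x.2) = ⊤)
    (φ : A →⋆ₐ[ℂ] B) (S : StarSubalgebra ℂ B) (h : ∀ i j, φ (u i j) ∈ S) (a : A) : φ a ∈ S := by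
  have : StarAlgebra.adjoin ℂ (Set.range fun x : I × I => u x.1 x.2) ≤ S.comap φ := by
    rw [StarAlgebra.adjoin_le_iff]
    rintro _ ⟨x, rfl⟩
    exact h x.1 x.2
  rw [hu] at this
  exact this (Set.mem_univ a)

end Hom

section FreeProduct

variable (A B : Type) [Ring A] [StarRing A] [Algebra ℂ A] [StarModule ℂ A]
  [Ring B] [StarRing B] [Algebra ℂ B] [StarModule ℂ B]

/-- The relations of the unital free product: the maps from `A` and `B` are morphisms. -/
def FreeProdRel (a b : StarPoly (A ⊕ B)) : Prop :=
  HomRel (fun x : A => StarPoly.var (Sum.inl x)) a b ∨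
    HomRel (fun x : B => StarPoly.var (Sum.inr x)) a b

/-- The unital free product `A * B` of `*`-algebras. -/
abbrev FreeProd : Type := Universal (FreeProdRel A B)

namespace FreeProd

/-- The canonical morphism from `A`. -/
def inl : A →⋆ₐ[ℂ] FreeProd A B :=
  homOfRel _ (Universal.mk (FreeProdRel A B)) (fun _ _ h => Universal.mk_rel (Or.inl h))

/-- The canonical morphism from `B`. -/
def inr : B →⋆ₐ[ℂ] FreeProd A B :=
  homOfRel _ (Universal.mk (FreeProdRel A B)) (fun _ _ h => Universal.mk_rel (Or.inr h))

variable {A B} {C : Type} [Ring C] [StarRing C] [Algebra ℂ C] [StarModule ℂ C]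

/-- The universal property. -/
def lift (f : A →⋆ₐ[ℂ] C) (g : B →⋆ₐ[ℂ] C) : FreeProd A B →⋆ₐ[ℂ] C :=
  Universal.lift (Sum.elim f g) (by
    rintro a b (h | h)
    · exact eval_homRel f (fun a => StarPoly.eval_var _ (Sum.inl a)) h
    · exact eval_homRel g (fun a => StarPoly.eval_var _ (Sum.inr a)) h)

@[simp] theorem lift_inl (f : A →⋆ₐ[ℂ] C) (g : B →⋆ₐ[ℂ] C) (a : A) :
    lift f g (inl A B a) = f a := Universal.lift_gen (Sum.elim f g) _ (Sum.inl a)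

@[simp] theorem lift_inr (f : A →⋆ₐ[ℂ] C) (g : B →⋆ₐ[ℂ] C) (b : B) :
    lift f g (inr A B b) = g b := Universal.lift_gen (Sum.elim f g) _ (Sum.inr b)

end FreeProd

end FreeProduct

/-- The free product of quantum permutation groups: the algebra is the unital free product, and the
generating matrix is block diagonal. -/
def freeProd (Γ Λ : QuantumPermGroup) : QuantumPermGroup where
  I := Γ.I ⊕ Λ.I
  alg := FreeProd Γ.alg Λ.alg
  u := Matrix.fromBlocks (Γ.u.map (FreeProd.inl Γ.alg Λ.alg)) 0 0
    (Λ.u.map (FreeProd.inr Γ.alg Λ.alg))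
  magic :=
    { star_eq := by
        rintro (i | i) (j | j) <;> simp [← map_star, Γ.magic.star_eq, Λ.magic.star_eq]
      idem := by
        rintro (i | i) (j | j) <;> simp [← map_mul, Γ.magic.idem, Λ.magic.idem]
      row_sum := by
        rintro (i | i) <;> simp [← map_sum, Γ.magic.row_sum, Λ.magic.row_sum]
      col_sum := by
        rintro (i | i) <;> simp [← map_sum, Γ.magic.col_sum, Λ.magic.col_sum]
      row_orth := by
        rintro (i | i) (j | j) (k | k) h <;> simp [← map_mul]
        · rw [Γ.magic.row_orth _ _ _ (fun e => h (congrArg _ e)), map_zero]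
        · rw [Λ.magic.row_orth _ _ _ (fun e => h (congrArg _ e)), map_zero]
      col_orth := by
        rintro (i | i) (j | j) (k | k) h <;> simp [← map_mul]
        · rw [Γ.magic.col_orth _ _ _ (fun e => h (congrArg _ e)), map_zero]
        · rw [Λ.magic.col_orth _ _ _ (fun e => h (congrArg _ e)), map_zero] }
  generates := by
    refine le_antisymm le_top ?_
    rw [← Universal.adjoin_gen, StarAlgebra.adjoin_le_iff]
    rintro _ ⟨a | b, rfl⟩
    · refine mem_of_generates Γ.generates (FreeProd.inl Γ.alg Λ.alg) _ (fun i j => ?_) a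
      exact StarAlgebra.subset_adjoin ℂ _ ⟨(Sum.inl i, Sum.inl j), rfl⟩
    · refine mem_of_generates Λ.generates (FreeProd.inr Γ.alg Λ.alg) _ (fun i j => ?_) b
      exact StarAlgebra.subset_adjoin ℂ _ ⟨(Sum.inr i, Sum.inr j), rfl⟩
  comul := FreeProd.lift
    ((tensorMap (FreeProd.inl Γ.alg Λ.alg) (FreeProd.inl Γ.alg Λ.alg)).comp Γ.comul)
    ((tensorMap (FreeProd.inr Γ.alg Λ.alg) (FreeProd.inr Γ.alg Λ.alg)).comp Λ.comul)
  comul_u := by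
    rintro (i | i) (j | j) <;> simp [Γ.comul_u, Λ.comul_u]

section Wreath

variable (Γ : QuantumPermGroup) (n : ℕ) [NeZero n]

/-- The relations of the wreath product. The variable `Sum.inl (i, a)` stands for the `i`-th copy
`ν_i(a)` of `a`, and `Sum.inr s` for `s` in the algebra of `S_n^+`: the `n` maps `ν_i` and the map
from the algebra of `S_n^+` are morphisms, and `ν_i(a)` commutes with `p i j`. -/
inductive WreathRel : StarPoly ((Fin n × Γ.alg) ⊕ (Splus n).alg) →
    StarPoly ((Fin n × Γ.alg) ⊕ (Splus n).alg) → Prop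
  | left (i : Fin n) {x y : StarPoly ((Fin n × Γ.alg) ⊕ (Splus n).alg)} :
      HomRel (fun a : Γ.alg => StarPoly.var (Sum.inl (i, a))) x y → WreathRel x y
  | right {x y : StarPoly ((Fin n × Γ.alg) ⊕ (Splus n).alg)} :
      HomRel (fun s : (Splus n).alg => StarPoly.var (Sum.inr s)) x y → WreathRel x y
  | comm (i j : Fin n) (a : Γ.alg) :
      WreathRel (StarPoly.var (Sum.inl (i, a)) * StarPoly.var (Sum.inr (splusU n i j)))
        (StarPoly.var (Sum.inr (splusU n i j)) * StarPoly.var (Sum.inl (i, a)))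

/-- The algebra of the wreath product of `Γ` by `S_n^+`. -/
abbrev WreathAlg : Type := Universal (WreathRel Γ n)

namespace WreathAlg

/-- The morphism `ν_i` from the `i`-th copy of the algebra of `Γ`. -/
def nu (i : Fin n) : Γ.alg →⋆ₐ[ℂ] WreathAlg Γ n :=
  homOfRel _ (Universal.mk (WreathRel Γ n)) (fun _ _ h => Universal.mk_rel (.left i h))

/-- The morphism from the algebra of `S_n^+`. -/
def sig : (Splus n).alg →⋆ₐ[ℂ] WreathAlg Γ n :=
  homOfRel _ (Universal.mk (WreathRel Γ n)) (fun _ _ h => Universal.mk_rel (.right h))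

/-- The image of the generating matrix of `S_n^+`. -/
def p : Matrix (Fin n) (Fin n) (WreathAlg Γ n) := (splusU n).map (sig Γ n)

theorem p_magic : IsMagic (p Γ n) where
  star_eq i j := by simp [p, ← map_star, (splusU_magic n).star_eq]
  idem i j := by simp [p, ← map_mul, (splusU_magic n).idem]
  row_sum i := by simp [p, ← map_sum, (splusU_magic n).row_sum]
  col_sum i := by simp [p, ← map_sum, (splusU_magic n).col_sum]
  row_orth i j k h := by simp [p, ← map_mul, (splusU_magic n).row_orth i j k h]
  col_orth i j k h := by simp [p, ← map_mul, (splusU_magic n).col_orth i j k h]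

theorem comm (i j : Fin n) (a : Γ.alg) : Commute (nu Γ n i a) (p Γ n i j) := by
  have := Universal.mk_rel (WreathRel.comm (Γ := Γ) (n := n) i j a)
  rw [map_mul, map_mul] at this
  exact this

variable {Γ n} {C : Type} [Ring C] [StarRing C] [Algebra ℂ C] [StarModule ℂ C]

/-- The universal property. -/
def lift (f : Fin n → Γ.alg →⋆ₐ[ℂ] C) (g : (Splus n).alg →⋆ₐ[ℂ] C)
    (h : ∀ i j a, Commute (f i a) (g (splusU n i j))) : WreathAlg Γ n →⋆ₐ[ℂ] C :=
  Universal.lift (Sum.elim (fun x => f x.1 x.2) g) (by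
    intro x y hxy
    cases hxy with
    | left i hh => exact eval_homRel (f i) (fun a => StarPoly.eval_var _ (Sum.inl (i, a))) hh
    | right hh => exact eval_homRel g (fun a => StarPoly.eval_var _ (Sum.inr a)) hh
    | comm i j a =>
      simp only [map_mul, StarPoly.eval_var]
      exact h i j a)

@[simp] theorem lift_nu (f : Fin n → Γ.alg →⋆ₐ[ℂ] C) (g : (Splus n).alg →⋆ₐ[ℂ] C)
    (h : ∀ i j a, Commute (f i a) (g (splusU n i j))) (i : Fin n) (a : Γ.alg) :
    lift f g h (nu Γ n i a) = f i a :=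
  Universal.lift_gen (Sum.elim (fun x : Fin n × Γ.alg => f x.1 x.2) g) _ (Sum.inl (i, a))

@[simp] theorem lift_sig (f : Fin n → Γ.alg →⋆ₐ[ℂ] C) (g : (Splus n).alg →⋆ₐ[ℂ] C)
    (h : ∀ i j a, Commute (f i a) (g (splusU n i j))) (s : (Splus n).alg) :
    lift f g h (sig Γ n s) = g s :=
  Universal.lift_gen (Sum.elim (fun x : Fin n × Γ.alg => f x.1 x.2) g) _ (Sum.inr s)

variable (Γ n)

theorem comm_tensor (i t j : Fin n) (b : WreathAlg Γ n)
    (hb : ∀ a, Commute (nu Γ n t a) b) (x : Γ.alg ⊗[ℂ] Γ.alg) :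
    Commute (tensorMap (nu Γ n i) (nu Γ n t) x) (p Γ n i j ⊗ₜ[ℂ] b) := by
  induction x with
  | zero => rw [map_zero]; exact Commute.zero_left _
  | tmul a c =>
    change _ * _ = _ * _
    rw [tensorMap_tmul, Algebra.TensorProduct.tmul_mul_tmul, Algebra.TensorProduct.tmul_mul_tmul,
      (comm Γ n i j a).eq, (hb c).eq]
  | add x y hx hy => rw [map_add]; exact hx.add_left hy

/-- The comultiplication on the `i`-th copy: `a ↦ ∑ t, (ν_i ⊗ ν_t)(Δ a) (p i t ⊗ 1)`. -/
def comulNu (i : Fin n) : Γ.alg →⋆ₐ[ℂ] WreathAlg Γ n ⊗[ℂ] WreathAlg Γ n :=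
  sumHom (fun t => (tensorMap (nu Γ n i) (nu Γ n t)).comp Γ.comul)
    (fun t => p Γ n i t ⊗ₜ[ℂ] 1)
    (fun t => by simp [(p_magic Γ n).star_eq])
    (fun t => by simp [(p_magic Γ n).idem])
    (fun s t h => by simp [(p_magic Γ n).row_orth _ _ _ h])
    (by rw [← TensorProduct.sum_tmul, (p_magic Γ n).row_sum]; rfl)
    (fun t a => comm_tensor Γ n i t t 1 (fun _ => Commute.one_right _) _)

theorem comulNu_apply (i : Fin n) (a : Γ.alg) : comulNu Γ n i a
    = ∑ t, tensorMap (nu Γ n i) (nu Γ n t) (Γ.comul a) * (p Γ n i t ⊗ₜ[ℂ] 1) := rfl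

/-- The comultiplication on the algebra of `S_n^+`. -/
def comulSig : (Splus n).alg →⋆ₐ[ℂ] WreathAlg Γ n ⊗[ℂ] WreathAlg Γ n :=
  (tensorMap (sig Γ n) (sig Γ n)).comp (Splus n).comul

theorem comulSig_u (i j : Fin n) :
    comulSig Γ n (splusU n i j) = ∑ t, p Γ n i t ⊗ₜ[ℂ] p Γ n t j := by
  change tensorMap _ _ ((Splus n).comul _) = _
  rw [comul_splusU, map_sum]
  rfl

theorem comulNu_mul (i j : Fin n) (a : Γ.alg) :
    comulNu Γ n i a * comulSig Γ n (splusU n i j)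
      = ∑ t, tensorMap (nu Γ n i) (nu Γ n t) (Γ.comul a) * (p Γ n i t ⊗ₜ[ℂ] p Γ n t j) := by
  rw [comulNu_apply, comulSig_u, Finset.sum_mul_sum]
  refine Finset.sum_congr rfl fun t _ => ?_
  rw [Finset.sum_eq_single t]
  · rw [mul_assoc, Algebra.TensorProduct.tmul_mul_tmul, (p_magic Γ n).idem, one_mul]
  · intro s _ hs
    rw [mul_assoc, Algebra.TensorProduct.tmul_mul_tmul, (p_magic Γ n).row_orth _ _ _ hs.symm,
      TensorProduct.zero_tmul, mul_zero]
  · simp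

theorem comulSig_mul (i j : Fin n) (a : Γ.alg) :
    comulSig Γ n (splusU n i j) * comulNu Γ n i a
      = ∑ t, tensorMap (nu Γ n i) (nu Γ n t) (Γ.comul a) * (p Γ n i t ⊗ₜ[ℂ] p Γ n t j) := by
  rw [comulNu_apply, comulSig_u, Finset.sum_mul_sum]
  refine Finset.sum_congr rfl fun t _ => ?_
  have h1 : ∀ s, Commute (tensorMap (nu Γ n i) (nu Γ n s) (Γ.comul a)) (p Γ n i s ⊗ₜ[ℂ] 1) :=
    fun s => comm_tensor Γ n i s s 1 (fun _ => Commute.one_right _) _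
  rw [Finset.sum_eq_single t]
  · rw [(h1 t).eq, ← mul_assoc, Algebra.TensorProduct.tmul_mul_tmul, (p_magic Γ n).idem, mul_one]
    exact (comm_tensor Γ n i t t _ (fun a => comm Γ n t j a) _).eq.symm
  · intro s _ hs
    rw [(h1 s).eq, ← mul_assoc, Algebra.TensorProduct.tmul_mul_tmul,
      (p_magic Γ n).row_orth _ _ _ hs.symm, TensorProduct.zero_tmul, zero_mul]
  · simp

theorem comulNu_comm (i j : Fin n) (a : Γ.alg) :
    Commute (comulNu Γ n i a) (comulSig Γ n (splusU n i j)) :=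
  (comulNu_mul Γ n i j a).trans (comulSig_mul Γ n i j a).symm

/-- The comultiplication of the wreath product. -/
def comul : WreathAlg Γ n →⋆ₐ[ℂ] WreathAlg Γ n ⊗[ℂ] WreathAlg Γ n :=
  lift (comulNu Γ n) (comulSig Γ n)
    (comulNu_comm Γ n)

theorem comul_w (i j : Fin n) (k l : Γ.I) : comul Γ n (nu Γ n i (Γ.u k l) * p Γ n i j)
    = ∑ x : Fin n × Γ.I, (nu Γ n i (Γ.u k x.2) * p Γ n i x.1) ⊗ₜ[ℂ]
        (nu Γ n x.1 (Γ.u x.2 l) * p Γ n x.1 j) := by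
  have h : comul Γ n (p Γ n i j) = comulSig Γ n (splusU n i j) := lift_sig _ _ _ _
  rw [map_mul, h, comul, lift_nu, comulNu_mul, Γ.comul_u, Fintype.sum_prod_type]
  refine Finset.sum_congr rfl fun t _ => ?_
  rw [map_sum, Finset.sum_mul]
  refine Finset.sum_congr rfl fun r _ => ?_
  rw [tensorMap_tmul, Algebra.TensorProduct.tmul_mul_tmul]

end WreathAlg

open WreathAlg in
/-- The wreath product of `Γ` by `S_n^+`, with generating matrix
`w (i, k) (j, l) = ν_i(u k l) p i j`. -/
def wreath : QuantumPermGroup where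
  I := Fin n × Γ.I
  alg := WreathAlg Γ n
  u := Matrix.of fun x y => nu Γ n x.1 (Γ.u x.2 y.2) * p Γ n x.1 y.1
  magic :=
    have key : ∀ (i j j' : Fin n) (k l k' l' : Γ.I),
        (nu Γ n i (Γ.u k l) * p Γ n i j) * (nu Γ n i (Γ.u k' l') * p Γ n i j')
          = nu Γ n i (Γ.u k l * Γ.u k' l') * (p Γ n i j * p Γ n i j') := by
      intro i j j' k l k' l'
      rw [map_mul, mul_assoc, ← mul_assoc (p Γ n i j), ← (comm Γ n i j _).eq]
      simp only [mul_assoc]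
    { star_eq := fun x y => by
        simp only [Matrix.of_apply, star_mul]
        rw [← map_star, Γ.magic.star_eq, (p_magic Γ n).star_eq, (comm Γ n _ _ _).eq]
      idem := fun x y => by
        simp only [Matrix.of_apply, key, Γ.magic.idem, (p_magic Γ n).idem]
      row_sum := fun x => by
        simp only [Matrix.of_apply, Fintype.sum_prod_type, ← Finset.sum_mul, ← map_sum,
          Γ.magic.row_sum, map_one, one_mul, (p_magic Γ n).row_sum]
      col_sum := fun y => by
        simp only [Matrix.of_apply, Fintype.sum_prod_type, ← Finset.sum_mul, ← map_sum,
          Γ.magic.col_sum, map_one, one_mul, (p_magic Γ n).col_sum]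
      row_orth := by
        rintro ⟨i, k⟩ ⟨j, l⟩ ⟨j', l'⟩ h
        simp only [Matrix.of_apply, key]
        by_cases hj : j = j'
        · have hl : l ≠ l' := fun hl => h (by rw [hj, hl])
          rw [Γ.magic.row_orth _ _ _ hl, map_zero, zero_mul]
        · rw [(p_magic Γ n).row_orth _ _ _ hj, mul_zero]
      col_orth := by
        rintro ⟨i, k⟩ ⟨i', k'⟩ ⟨j, l⟩ h
        by_cases hi : i = i'
        · subst hi
          have hk : k ≠ k' := fun hk => h (by rw [hk])
          simp only [Matrix.of_apply, key]
          rw [Γ.magic.col_orth _ _ _ hk, map_zero, zero_mul]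
        · simp only [Matrix.of_apply]
          rw [(comm Γ n i' j _).eq, mul_assoc, ← mul_assoc (p Γ n i j),
            (p_magic Γ n).col_orth _ _ _ hi, zero_mul, mul_zero] }
  generates := by
    refine le_antisymm le_top ?_
    rw [← Universal.adjoin_gen, StarAlgebra.adjoin_le_iff]
    set w : (Fin n × Γ.I) × (Fin n × Γ.I) → WreathAlg Γ n :=
      fun x => nu Γ n x.1.1 (Γ.u x.1.2 x.2.2) * p Γ n x.1.1 x.2.1 with hw
    change _ ⊆ (StarAlgebra.adjoin ℂ (Set.range w) : Set (WreathAlg Γ n))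
    have hmem : ∀ x, w x ∈ StarAlgebra.adjoin ℂ (Set.range w) :=
      fun x => StarAlgebra.subset_adjoin ℂ _ ⟨x, rfl⟩
    rintro _ ⟨⟨i, a⟩ | b, rfl⟩
    · refine mem_of_generates Γ.generates (nu Γ n i) _ (fun k l => ?_) a
      have : nu Γ n i (Γ.u k l) = ∑ j, w ((i, k), (j, l)) := by
        simp only [hw, ← Finset.mul_sum, (p_magic Γ n).row_sum, mul_one]
      rw [this]
      exact sum_mem fun j _ => hmem _
    · refine mem_of_generates (Splus n).generates (sig Γ n) _ (fun (i j : Fin n) => ?_) b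
      obtain ⟨k⟩ := Γ.nonempty
      have : sig Γ n (splusU n i j) = ∑ l, w ((i, k), (j, l)) := by
        simp only [hw, ← Finset.sum_mul, ← map_sum, Γ.magic.row_sum, map_one, one_mul]
        rfl
      change sig Γ n (splusU n i j) ∈ _
      rw [this]
      exact sum_mem fun j _ => hmem _
  comul := WreathAlg.comul Γ n
  comul_u x y := comul_w Γ n x.1 y.1 x.2 y.2

end Wreath

/-- A family of quantum permutation groups is a set of isomorphism classes. The Jordan closure of
`Q` is the smallest family containing `Q` which is stable under free products and under wreath
products with `S_n^+` for all `n ≥ 1`. -/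
def jordanClosure (Q : Set (Quotient setoid)) : Set (Quotient setoid) :=
  ⋂₀ {S | Q ⊆ S ∧ (∀ Γ Λ : QuantumPermGroup, ⟦Γ⟧ ∈ S → ⟦Λ⟧ ∈ S → ⟦freeProd Γ Λ⟧ ∈ S) ∧
    (∀ (Γ : QuantumPermGroup) (n : ℕ) [NeZero n], ⟦Γ⟧ ∈ S → ⟦wreath Γ n⟧ ∈ S)}

end QuantumPermGroup

/-! ### Graphs -/

/-- A finite simple graph with at least one vertex. -/
structure FinGraph where
  V : Type
  [fintype : Fintype V]
  [nonempty : Nonempty V]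
  graph : SimpleGraph V

namespace FinGraph

attribute [instance] fintype nonempty

instance setoid : Setoid FinGraph where
  r G H := Nonempty (G.graph ≃g H.graph)
  iseqv := ⟨fun _ => ⟨SimpleGraph.Iso.refl⟩, fun ⟨e⟩ => ⟨e.symm⟩, fun ⟨e⟩ ⟨f⟩ => ⟨e.trans f⟩⟩

/-- The graph with one vertex. -/
def K1 : FinGraph where
  V := Unit
  graph := ⊥

/-- The complement. -/
def compl (G : FinGraph) : FinGraph where
  V := G.V
  graph := G.graphᶜ

/-- The sum (disjoint union). -/
def sum (G H : FinGraph) : FinGraph where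
  V := G.V ⊕ H.V
  graph := G.graph ⊕g H.graph

/-- A connected component, as a graph. -/
def component (G : FinGraph) (c : G.graph.ConnectedComponent) : FinGraph where
  V := c
  fintype := Fintype.ofFinite c
  nonempty := c.nonempty_supp.to_subtype
  graph := c.toSimpleGraph

/-- The adjacency matrix with coefficients in a ring `A`. -/
def adj (G : FinGraph) (A : Type) [Ring A] : Matrix G.V G.V A :=
  open Classical in G.graph.adjMatrix A

/-- Quantum isomorphism: there is a magic unitary `P` with coefficients in a nonzero unital
C*-algebra such that `P Adj(G) = Adj(H) P`. -/
def QuantumIso (G H : FinGraph) : Prop :=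
  Fintype.card G.V = Fintype.card H.V ∧
    ∃ (A : Type) (_ : CStarAlgebra A) (_ : Nontrivial A) (P : Matrix H.V G.V A),
      IsMagic P ∧ P * G.adj A = H.adj A * P

/-- The relations `[Adj(G), u] = 0`. -/
inductive AdjRel (G : FinGraph) : StarPoly (G.V × G.V) → StarPoly (G.V × G.V) → Prop
  | comm (x y : G.V) :
      AdjRel G ((G.adj (StarPoly (G.V × G.V)) * varMatrix G.V : Matrix G.V G.V _) x y) ((varMatrix G.V * G.adj (StarPoly (G.V × G.V)) : Matrix G.V G.V _) x y)

theorem map_adj {A B : Type} [Ring A] [StarRing A] [Algebra ℂ A] [Ring B] [StarRing B] [Algebra ℂ B]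
    (G : FinGraph) (φ : A →⋆ₐ[ℂ] B) (x y : G.V) : φ (G.adj A x y) = G.adj B x y := by
  simp only [adj, SimpleGraph.adjMatrix_apply]
  split_ifs <;> simp

theorem eval_adj_mul {A : Type} [Ring A] [StarRing A] [Algebra ℂ A] [StarModule ℂ A]
    (G : FinGraph) (u : Matrix G.V G.V A) (x y : G.V) :
    StarPoly.eval (fun x : G.V × G.V => u x.1 x.2) ((G.adj (StarPoly (G.V × G.V)) * varMatrix G.V : Matrix G.V G.V _) x y)
      = (G.adj A * u : Matrix G.V G.V A) x y := by
  simp only [Matrix.mul_apply, map_sum, map_mul, map_adj]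
  exact Finset.sum_congr rfl fun z _ => congrArg _ (StarPoly.eval_var _ _)

theorem eval_mul_adj {A : Type} [Ring A] [StarRing A] [Algebra ℂ A] [StarModule ℂ A]
    (G : FinGraph) (u : Matrix G.V G.V A) (x y : G.V) :
    StarPoly.eval (fun x : G.V × G.V => u x.1 x.2) ((varMatrix G.V * G.adj (StarPoly (G.V × G.V)) : Matrix G.V G.V _) x y)
      = (u * G.adj A : Matrix G.V G.V A) x y := by
  simp only [Matrix.mul_apply, map_sum, map_mul, map_adj]
  exact Finset.sum_congr rfl fun z _ => congrArg (· * _) (StarPoly.eval_var _ _)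

theorem adj_tensorProd {A : Type} [Ring A] [StarRing A] [Algebra ℂ A] [StarModule ℂ A]
    (G : FinGraph) (u : Matrix G.V G.V A) (h : G.adj A * u = u * G.adj A) :
    G.adj _ * tensorProd u u = tensorProd u u * G.adj _ := by
  have h1 : ∀ x t, ∑ z, G.adj A x z * u z t = ∑ z, u x z * G.adj A z t := fun x t => by
    rw [← Matrix.mul_apply, h, Matrix.mul_apply]
  have hl : ∀ x y, (G.adj (A ⊗[ℂ] A)) x y = G.adj A x y ⊗ₜ[ℂ] 1 := fun x y => by
    simp only [adj, SimpleGraph.adjMatrix_apply]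
    split_ifs <;> simp [Algebra.TensorProduct.one_def]
  have hr : ∀ x y, (G.adj (A ⊗[ℂ] A)) x y = 1 ⊗ₜ[ℂ] G.adj A x y := fun x y => by
    simp only [adj, SimpleGraph.adjMatrix_apply]
    split_ifs <;> simp [Algebra.TensorProduct.one_def]
  have hm : ∀ x y, G.adj A x y ⊗ₜ[ℂ] (1 : A) = 1 ⊗ₜ[ℂ] G.adj A x y :=
    fun x y => (hl x y).symm.trans (hr x y)
  ext x y
  have e1 : (G.adj _ * tensorProd u u : Matrix G.V G.V (A ⊗[ℂ] A)) x y = ∑ t, (∑ z, G.adj A x z * u z t) ⊗ₜ[ℂ] u t y := by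
    simp only [Matrix.mul_apply, tensorProd_apply, hl, Finset.mul_sum,
      Algebra.TensorProduct.tmul_mul_tmul, one_mul, TensorProduct.sum_tmul]
    exact Finset.sum_comm
  have e2 : (tensorProd u u * G.adj _ : Matrix G.V G.V (A ⊗[ℂ] A)) x y = ∑ t, u x t ⊗ₜ[ℂ] (∑ z, u t z * G.adj A z y) := by
    simp only [Matrix.mul_apply, tensorProd_apply, hr, Finset.sum_mul,
      Algebra.TensorProduct.tmul_mul_tmul, mul_one, TensorProduct.tmul_sum]
    exact Finset.sum_comm
  simp only [h1] at e1
  simp only [← h1] at e2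
  rw [e1, e2]
  simp only [TensorProduct.sum_tmul, TensorProduct.tmul_sum]
  rw [Finset.sum_comm]
  refine Finset.sum_congr rfl fun t _ => Finset.sum_congr rfl fun z _ => ?_
  have := congrArg (fun m => (u x t ⊗ₜ[ℂ] (1 : A)) * m * ((1 : A) ⊗ₜ[ℂ] u z y)) (hm t z)
  simpa using this

/-- The quantum automorphism group of a graph: its algebra is the universal unital `*`-algebra
generated by the entries of a matrix `u`, indexed by the vertices, subject to the magic relations
and to `Adj(G) u = u Adj(G)`. -/
def Qu (G : FinGraph) : QuantumPermGroup :=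
  QuantumPermGroup.ofRelations G.V (AdjRel G) (by
    intro A _ _ _ _ u hu a b hab
    have h : G.adj A * u = u * G.adj A := by
      ext x y
      rw [← eval_adj_mul, ← eval_mul_adj]
      exact hu _ _ (AdjRel.comm x y)
    cases hab with
    | comm x y => rw [eval_adj_mul, eval_mul_adj, adj_tensorProd G u h])

end FinGraph

/-- A class of graphs is a set of isomorphism classes of finite graphs. -/
abbrev GraphClass : Type 1 := Set (Quotient FinGraph.setoid)

namespace GraphClass

open FinGraph

/-- Closed under complements. -/
def ClosedCompl (F : GraphClass) : Prop := ∀ G : FinGraph, ⟦G⟧ ∈ F → ⟦G.compl⟧ ∈ F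

/-- Closed under sums of two, hence of finitely many (at least one), graphs. -/
def ClosedSum (F : GraphClass) : Prop :=
  ∀ G H : FinGraph, ⟦G⟧ ∈ F → ⟦H⟧ ∈ F → ⟦G.sum H⟧ ∈ F

/-- Closed under connected components. -/
def ClosedComponent (F : GraphClass) : Prop :=
  ∀ G : FinGraph, ⟦G⟧ ∈ F → ∀ c : G.graph.ConnectedComponent, ⟦G.component c⟧ ∈ F

/-- Axiom (QI): graphs in `F` are quantum isomorphic if and only if they are isomorphic. -/
def QI (F : GraphClass) : Prop :=
  ∀ G H : FinGraph, ⟦G⟧ ∈ F → ⟦H⟧ ∈ F → (QuantumIso G H ↔ Nonempty (G.graph ≃g H.graph))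

/-- The class of `F`-cographs: the smallest class of graphs containing `F` and closed under sums and
complements. -/
def co (F : GraphClass) : GraphClass := ⋂₀ {S | F ⊆ S ∧ ClosedSum S ∧ ClosedCompl S}

/-- The connected graphs of `F`. -/
def conn (F : GraphClass) : GraphClass :=
  {x | ∃ G : FinGraph, ⟦G⟧ = x ∧ x ∈ F ∧ G.graph.Connected}

/-- The family of the quantum automorphism groups of the graphs in `F`, up to isomorphism. -/
def Qu (F : GraphClass) : Set (Quotient QuantumPermGroup.setoid) :=
  {q | ∃ G : FinGraph, ⟦G⟧ ∈ F ∧ q = ⟦G.Qu⟧}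

end GraphClass

end QGraph

end

/-! The inclusions to prove are `Jor(Qu(co F)) ⊆ Qu(co F)` and `Qu(co F) ⊆ Jor(Qu(F_conn))`; the
rest is monotonicity. Three computations drive both: `Qu(Gᶜ) = Qu(G)` (`qu_compl`), `Qu(nG) = Qu(G)
≀ S_n^+` for connected `G` (`qu_copies`), and `Qu(G + H) = Qu(G) * Qu(H)` when no component of `G`
is isomorphic to a component of `H` (`qu_sum_isomorphic`). One of `G`, `Gᶜ` is always connected.

The last computation needs rigidity (`nonempty_iso_of_isIntertwiner`): two `F`-cographs linked by a
nonzero magic intertwiner are isomorphic. An intertwiner restricts to blocks between connected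
components. The rows and columns of such a block sum to a projection that need not be `1`, so
intertwiners carry an arbitrary unit `p`. Counting with these units matches the components
bijectively. Induction on the number of vertices, passing to complements when only the complement is
disconnected, leads to graphs that are connected together with their complement. Such cographs lie
in `F`, where (QI) applies.

(QI) speaks of C*-algebras, whereas a nonzero block of `Qu(G)` lives in a mere `*`-algebra.
`exists_cstarAlgebra` bridges the gap by building a Haar functional directly on words in the entries
of the block. On words of length `k` its values form the matrix of the orthogonal projection onto
the vectors sent by the `k`-th tensor power of `P` to `p` times a scalar vector, followed by that
assignment. It respects every intertwining relation, it is positive because the Gram matrices are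
Casimir elements of `*`-algebras of matrices, and the GNS construction gives operators satisfying
the relations.

For stability of `Qu(co F)`, replace the graphs by connected ones. Wreath products come from copies,
and free products from sums of nonisomorphic graphs. If the two graphs are isomorphic, one of them,
`H`, is replaced by `(H + K1)ᶜ`, which has the same quantum group if `H` has at least two vertices
(`freeProd_mem`). Conversely, a disconnected cograph is split into the copies of one component and
the remaining components, and induction concludes (`qu_mem_jordanClosure`). -/

set_option linter.unusedSectionVars false

noncomputable section

namespace QGraph
-- Fixed vectors of a unitary matrix over a `*`-algebra, and positivity of the associated averages.
section Haar

open Matrix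

variable {A : Type} [Ring A] [StarRing A] [Algebra ℂ A] [StarModule ℂ A]
variable {I J I' J' K : Type}

/-- A complex matrix, viewed as a matrix with coefficients in `A`. -/
abbrev scalarMat (A : Type) [Ring A] [Algebra ℂ A] (R : Matrix I J ℂ) : Matrix I J A :=
  R.map (algebraMap ℂ A)

theorem scalarMat_mul [Fintype J] (R : Matrix I J ℂ) (S : Matrix J K ℂ) :
    scalarMat A (R * S) = scalarMat A R * scalarMat A S :=
  Matrix.map_mul

theorem scalarMat_conjTranspose (R : Matrix I J ℂ) : (scalarMat A R)ᴴ = scalarMat A Rᴴ := by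
  ext i j
  exact (algebraMap_star_comm (R j i)).symm

theorem scalarMat_mul_smul [Fintype J] (p : A) (R : Matrix I J ℂ) (X : Matrix J K A) :
    scalarMat A R * (p • X) = p • (scalarMat A R * X) := by
  ext i k
  simp only [Matrix.mul_apply, Matrix.smul_apply, Matrix.map_apply, smul_eq_mul, Finset.mul_sum]
  refine Finset.sum_congr rfl fun j _ => ?_
  rw [← mul_assoc, Algebra.commutes, mul_assoc]

theorem smul_scalarMat_injective {p : A} (hp : p ≠ 0) {R S : Matrix I J ℂ}
    (h : p • scalarMat A R = p • scalarMat A S) : R = S := by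
  ext i j
  have h1 := congrFun (congrFun h i) j
  simp only [Matrix.smul_apply, Matrix.map_apply, smul_eq_mul] at h1
  rw [← Algebra.commutes, ← Algebra.commutes, ← Algebra.smul_def, ← Algebra.smul_def] at h1
  exact smul_left_injective ℂ hp h1

/-- The matrix `q` is unitary, with unit `p`. -/
structure PUnitary [Fintype I] [Fintype J] [DecidableEq I] [DecidableEq J] (p : A)
    (q : Matrix I J A) : Prop where
  star_eq : star p = p
  mul_star : q * qᴴ = p • 1
  star_mul : qᴴ * q = p • 1
  smul_eq : p • q = q

variable [Fintype I] [Fintype J] [DecidableEq I] [DecidableEq J] [Fintype I'] [Fintype J']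
  [DecidableEq I'] [DecidableEq J']

theorem PUnitary.reindex {p : A} {q : Matrix I J A} (h : PUnitary p q) (e : I' ≃ I) (f : J' ≃ J) :
    PUnitary p (q.submatrix e f) where
  star_eq := h.star_eq
  mul_star := by
    rw [conjTranspose_submatrix, submatrix_mul_equiv, h.mul_star, submatrix_smul, Pi.smul_apply,
      Pi.smul_apply, submatrix_one_equiv]
  star_mul := by
    rw [conjTranspose_submatrix, submatrix_mul_equiv, h.star_mul, submatrix_smul, Pi.smul_apply,
      Pi.smul_apply, submatrix_one_equiv]
  smul_eq := by
    conv_rhs => rw [← h.smul_eq]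
    rfl

/-- The columns of `η` form an orthonormal basis of the space of vectors fixed by `q`, and `ξ` is
their image by `q`. -/
structure IsFrame {n : ℕ} (p : A) (q : Matrix I J A) (η : Matrix J (Fin n) ℂ)
    (ξ : Matrix I (Fin n) ℂ) : Prop where
  fixed : q * scalarMat A η = p • scalarMat A ξ
  expand : ∀ {K : Type} (R : Matrix J K ℂ) (S : Matrix I K ℂ),
    q * scalarMat A R = p • scalarMat A S → η * (ηᴴ * R) = R ∧ ξ * (ηᴴ * R) = S

/-- The vectors that `q` sends to `p` times a scalar vector form a subspace, and `η` is an
orthonormal basis of it. The scalar vector is determined by the original one because `p ≠ 0`, which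
yields the formula for `S`. -/
theorem exists_isFrame {p : A} (hp : p ≠ 0) (q : Matrix I J A) :
    ∃ (n : ℕ) (η : Matrix J (Fin n) ℂ) (ξ : Matrix I (Fin n) ℂ), IsFrame p q η ξ := by
  classical
  let S : Submodule ℂ (EuclideanSpace ℂ J) :=
    { carrier := {v | ∃ w : I → ℂ, ∀ i, ∑ j, q i j * algebraMap ℂ A (v j) = p * algebraMap ℂ A (w i)}
      add_mem' := by
        rintro v v' ⟨w, hw⟩ ⟨w', hw'⟩
        refine ⟨w + w', fun i => ?_⟩
        simp only [PiLp.add_apply, map_add, mul_add, Finset.sum_add_distrib, hw, hw', Pi.add_apply]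
      zero_mem' := ⟨0, fun i => by simp⟩
      smul_mem' := by
        rintro c v ⟨w, hw⟩
        refine ⟨c • w, fun i => ?_⟩
        simp only [PiLp.smul_apply, smul_eq_mul, map_mul, Pi.smul_apply]
        rw [Algebra.left_comm, ← hw, Finset.mul_sum]
        exact Finset.sum_congr rfl fun j _ => Algebra.left_comm _ _ _ }
  let b := stdOrthonormalBasis ℂ S
  choose w hw using fun α => (b α).2
  refine ⟨_, Matrix.of fun j α => (b α).1 j, Matrix.of fun i α => w α i, ?_, ?_⟩
  · ext i α
    simpa [Matrix.mul_apply] using hw α i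
  · intro K R T h
    have h1 : (Matrix.of fun j α => (b α).1 j) *
        ((Matrix.of fun j α => (b α).1 j)ᴴ * R) = R := by
      ext j k
      have hk : WithLp.toLp 2 (fun j => R j k) ∈ S := by
        refine ⟨fun i => T i k, fun i => ?_⟩
        have := congrFun (congrFun h i) k
        simpa [Matrix.mul_apply] using this
      have := congrArg (fun x : S => x.1 j) (b.sum_repr' ⟨_, hk⟩)
      simp only [Submodule.coe_sum, Submodule.coe_smul, Submodule.coe_inner] at this
      rw [Matrix.mul_apply]
      rw [WithLp.ofLp_sum, Finset.sum_apply] at this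
      refine Eq.trans (Finset.sum_congr rfl fun α _ => ?_) this
      rw [PiLp.smul_apply, smul_eq_mul, mul_comm, PiLp.inner_apply, Matrix.mul_apply]
      simp [mul_comm]
    refine ⟨h1, smul_scalarMat_injective hp (h.symm.trans ?_).symm⟩
    conv_lhs => rw [← h1]
    rw [scalarMat_mul, scalarMat_mul, ← Matrix.mul_assoc]
    have h2 : q * scalarMat A (Matrix.of fun j α => (b α).1 j)
        = p • scalarMat A (Matrix.of fun i α => w α i) := by
      ext i α
      simpa [Matrix.mul_apply] using hw α i
    rw [h2, Matrix.smul_mul, ← scalarMat_mul, ← scalarMat_mul]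

/-- `M` is the matrix of the values of the Haar functional on the entries of `q`. -/
def IsHaar (p : A) (q : Matrix I J A) (M : Matrix I J ℂ) : Prop :=
  ∃ (n : ℕ) (η : Matrix J (Fin n) ℂ) (ξ : Matrix I (Fin n) ℂ), IsFrame p q η ξ ∧ M = ξ * ηᴴ

theorem exists_isHaar {p : A} (hp : p ≠ 0) (q : Matrix I J A) : ∃ M, IsHaar p q M := by
  obtain ⟨n, η, ξ, h⟩ := exists_isFrame hp q
  exact ⟨_, n, η, ξ, h, rfl⟩

theorem PUnitary.star_mul_smul {p : A} {q : Matrix I J A} (hq : PUnitary p q) :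
    qᴴ * (p • (1 : Matrix I I A)) = qᴴ := by
  have h : (p • (1 : Matrix I I A))ᴴ = p • 1 := by
    ext i j
    by_cases hij : i = j
    · subst hij; simp [hq.star_eq]
    · simp [hij, Ne.symm hij]
  rw [← h, ← conjTranspose_mul, Matrix.smul_mul, Matrix.one_mul, hq.smul_eq]

theorem PUnitary.smul_star {p : A} {q : Matrix I J A} (hq : PUnitary p q) : p • qᴴ = qᴴ := by
  have h : qᴴ * q * qᴴ = qᴴ * (q * qᴴ) := Matrix.mul_assoc _ _ _
  rwa [hq.star_mul, hq.mul_star, hq.star_mul_smul, Matrix.smul_mul, Matrix.one_mul] at h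

/-- Multiply the relation by `q'ᴴ` on the left and by `qᴴ` on the right, cancel by unitarity, and
take adjoints. -/
theorem PUnitary.intertwine_star {p : A} {q : Matrix I J A} {q' : Matrix I' J' A}
    (hq : PUnitary p q) (hq' : PUnitary p q') {R : Matrix J' J ℂ} {S : Matrix I' I ℂ}
    (h : q' * scalarMat A R = scalarMat A S * q) :
    q * scalarMat A Rᴴ = scalarMat A Sᴴ * q' := by
  have h1 : q'ᴴ * q' * (scalarMat A R * qᴴ) = q'ᴴ * (scalarMat A S * (q * qᴴ)) := by
    rw [Matrix.mul_assoc, ← Matrix.mul_assoc q', h]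
    simp only [Matrix.mul_assoc]
  have h2 : scalarMat A S * (p • (1 : Matrix I I A)) = (p • (1 : Matrix I' I' A)) * scalarMat A S := by
    rw [scalarMat_mul_smul, Matrix.mul_one, Matrix.smul_mul, Matrix.one_mul]
  rw [hq'.star_mul, hq.mul_star, h2, ← Matrix.mul_assoc q'ᴴ, hq'.star_mul_smul, Matrix.smul_mul,
    Matrix.one_mul, ← scalarMat_mul_smul, hq.smul_star] at h1
  have h3 := congrArg conjTranspose h1
  rwa [conjTranspose_mul, conjTranspose_mul, conjTranspose_conjTranspose,
    conjTranspose_conjTranspose, scalarMat_conjTranspose, scalarMat_conjTranspose] at h3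

/-- Both `R` and, by `intertwine_star`, `Rᴴ` preserve fixed vectors. Hence `R` intertwines the
orthogonal projections onto them, and on fixed vectors the identity is the hypothesis itself. -/
theorem IsHaar.intertwine {p : A} {q : Matrix I J A} {q' : Matrix I' J' A}
    (hq : PUnitary p q) (hq' : PUnitary p q') {M : Matrix I J ℂ} {M' : Matrix I' J' ℂ}
    (hM : IsHaar p q M) (hM' : IsHaar p q' M') {R : Matrix J' J ℂ} {S : Matrix I' I ℂ}
    (h : q' * scalarMat A R = scalarMat A S * q) : M' * R = S * M := by
  obtain ⟨n, η, ξ, hf, rfl⟩ := hM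
  obtain ⟨n', η', ξ', hf', rfl⟩ := hM'
  have h' := hq.intertwine_star hq' h
  have h1 : q * scalarMat A (Rᴴ * η') = p • scalarMat A (Sᴴ * ξ') := by
    rw [scalarMat_mul, ← Matrix.mul_assoc, h', Matrix.mul_assoc, hf'.fixed, scalarMat_mul_smul,
      scalarMat_mul]
  have h2 : q' * scalarMat A (R * η) = p • scalarMat A (S * ξ) := by
    rw [scalarMat_mul, ← Matrix.mul_assoc, h, Matrix.mul_assoc, hf.fixed, scalarMat_mul_smul,
      scalarMat_mul]
  have h3 : η'ᴴ * R * (η * ηᴴ) = η'ᴴ * R := by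
    have := congrArg conjTranspose (hf.expand _ _ h1).1
    simpa [conjTranspose_mul, Matrix.mul_assoc] using this
  have h4 := (hf'.expand _ _ h2).2
  rw [Matrix.mul_assoc, ← h3, ← Matrix.mul_assoc S, ← h4]
  simp only [Matrix.mul_assoc]

theorem IsHaar.mul_eq {p : A} {q : Matrix I J A} {M : Matrix I J ℂ} (hM : IsHaar p q M)
    {R : Matrix J K ℂ} {S : Matrix I K ℂ} (h : q * scalarMat A R = p • scalarMat A S) :
    M * R = S := by
  obtain ⟨n, η, ξ, hf, rfl⟩ := hM
  rw [Matrix.mul_assoc, (hf.expand _ _ h).2]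

open scoped Kronecker ComplexOrder

theorem kronecker_sum {ι : Type} (s : Finset ι) (X : Matrix I I ℂ) (Y : ι → Matrix J J ℂ) :
    X ⊗ₖ (∑ a ∈ s, Y a) = ∑ a ∈ s, X ⊗ₖ Y a := by
  ext x y
  simp [Matrix.sum_apply, Finset.mul_sum]

theorem sum_kronecker {ι : Type} (s : Finset ι) (X : ι → Matrix I I ℂ) (Y : Matrix J J ℂ) :
    (∑ a ∈ s, X a) ⊗ₖ Y = ∑ a ∈ s, X a ⊗ₖ Y := by
  ext x y
  simp [Matrix.sum_apply, Finset.sum_mul]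

/-- The Casimir element of a finite-dimensional `*`-algebra of matrices, twisted by a
representation, is positive. -/
theorem posSemidef_casimir {n : ℕ} (D : Matrix J J ℂ → Matrix I I ℂ → Prop)
    (hone : D 1 1) (hmul : ∀ S S' T T', D S S' → D T T' → D (S * T) (S' * T'))
    (hstar : ∀ S S', D S S' → D Sᴴ S'ᴴ) (T : Fin n → Matrix J J ℂ) (T' : Fin n → Matrix I I ℂ)
    (hT : ∀ α, D (T α) (T' α))
    (hexp : ∀ S S', D S S' → ∑ α, ((T α)ᴴ * S).trace • T α = S ∧
      ∑ α, ((T α)ᴴ * S).trace • T' α = S') :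
    (∑ α, T' α ⊗ₖ (T α).map (starRingEnd ℂ)).PosSemidef := by
  -- `D` is the graph of a `*`-representation `S ↦ S'` of a matrix algebra with trace-orthonormal
  -- basis `T`. The element `Z` commutes with the image of the representation and is positive and
  -- invertible, so its inverse can normalize the Casimir element.
  set Z : Matrix I I ℂ := ∑ α, (T' α)ᴴ * T' α with hZ
  have key : ∀ β γ, ∑ α, (T γ * ((T β)ᴴ * T α)).trace • (T' α)ᴴ = T' γ * (T' β)ᴴ := by
    intro β γ
    have h1 := (hexp _ _ (hmul _ _ _ _ (hT β) (hstar _ _ (hT γ)))).2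
    have h2 := congrArg conjTranspose h1
    rw [conjTranspose_sum, conjTranspose_mul, conjTranspose_conjTranspose] at h2
    rw [← h2]
    refine Finset.sum_congr rfl fun α _ => ?_
    rw [conjTranspose_smul, ← trace_conjTranspose]
    simp [conjTranspose_mul, Matrix.mul_assoc]
  have hcomm : ∀ γ, Z * T' γ = T' γ * Z := by
    intro γ
    have h1 : ∀ β, T' β * T' γ = ∑ δ, (T γ * ((T δ)ᴴ * T β)).trace • T' δ := by
      intro β
      rw [← (hexp _ _ (hmul _ _ _ _ (hT β) (hT γ))).2]
      refine Finset.sum_congr rfl fun δ _ => ?_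
      rw [← Matrix.mul_assoc, trace_mul_comm]
    simp only [hZ, Finset.sum_mul, Finset.mul_sum, Matrix.mul_assoc, h1]
    rw [Finset.sum_comm]
    refine Finset.sum_congr rfl fun δ _ => ?_
    rw [← Matrix.mul_assoc, ← key, Finset.sum_mul]
    simp only [Matrix.mul_smul, Matrix.smul_mul]
  have hpos : Z.PosSemidef := posSemidef_sum _ fun β _ => posSemidef_conjTranspose_mul_self _
  -- A vector killed by `Z` is killed by every `T' β`, hence by the identity, which is a combination
  -- of them.
  have hunit : IsUnit Z := by
    rw [← mulVec_injective_iff_isUnit, ← coe_mulVecLin, ← LinearMap.ker_eq_bot, LinearMap.ker_eq_bot']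
    intro x hx
    rw [mulVecLin_apply] at hx
    have h1 : ∑ β, star (T' β *ᵥ x) ⬝ᵥ (T' β *ᵥ x) = 0 := by
      have : star x ⬝ᵥ (Z *ᵥ x) = 0 := by rw [hx, dotProduct_zero]
      rw [hZ, sum_mulVec, dotProduct_sum] at this
      rw [← this]
      refine Finset.sum_congr rfl fun β _ => ?_
      rw [star_mulVec, ← dotProduct_mulVec, mulVec_mulVec]
    rw [Finset.sum_eq_zero_iff_of_nonneg fun β _ => dotProduct_star_self_nonneg _] at h1
    have h2 : ∀ β, T' β *ᵥ x = 0 := fun β => dotProduct_star_self_eq_zero.1 (h1 β (Finset.mem_univ _))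
    have h3 := congrArg (· *ᵥ x) (hexp _ _ hone).2
    simpa [sum_mulVec, smul_mulVec, h2] using h3.symm
  have hdet : IsUnit Z.det := (isUnit_iff_isUnit_det _).1 hunit
  have hcomm' : ∀ γ, T' γ * Z⁻¹ = Z⁻¹ * T' γ := by
    intro γ
    have h1 : Z⁻¹ * (Z * T' γ) * Z⁻¹ = Z⁻¹ * (T' γ * Z) * Z⁻¹ := by rw [hcomm]
    rwa [nonsing_inv_mul_cancel_left _ _ hdet, Matrix.mul_assoc, mul_nonsing_inv_cancel_right _ _ hdet]
      at h1
  have hconj : ∀ α β, ((T α).map (starRingEnd ℂ))ᴴ * (T β).map (starRingEnd ℂ)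
      = ∑ γ, (T γ * ((T β)ᴴ * T α)).trace • (T γ).map (starRingEnd ℂ) := by
    intro α β
    have h1 := (hexp _ _ (hmul _ _ _ _ (hstar _ _ (hT α)) (hT β))).1
    have h2 := congrArg (fun M : Matrix J J ℂ => Mᴴᵀ) h1
    simp only [conjTranspose_sum, conjTranspose_smul, transpose_sum, transpose_smul,
      ← trace_conjTranspose] at h2
    simp only [conjTranspose_mul, conjTranspose_conjTranspose, transpose_mul] at h2
    have h3 : ((T α).map (starRingEnd ℂ))ᴴ = (T α)ᵀ := by ext i j; simp
    rw [h3]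
    refine Eq.trans ?_ (h2.symm.trans ?_)
    · rfl
    · refine Finset.sum_congr rfl fun γ _ => ?_
      rw [trace_mul_comm]
      rfl
  -- Writing `Q` for the Casimir element, `Q = Qᴴ (Z⁻¹ ⊗ 1) Q` exhibits it as a conjugate of a
  -- positive matrix. Expanding the products in the basis leaves `T' γ * Z * Z⁻¹` as the coefficient
  -- of the conjugate of `T γ`.
  have hQ : (∑ α, T' α ⊗ₖ (T α).map (starRingEnd ℂ))ᴴ * (Z⁻¹ ⊗ₖ (1 : Matrix J J ℂ)) *
      (∑ α, T' α ⊗ₖ (T α).map (starRingEnd ℂ)) = ∑ α, T' α ⊗ₖ (T α).map (starRingEnd ℂ) := by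
    rw [conjTranspose_sum, Finset.sum_mul, Finset.sum_mul]
    simp only [Finset.mul_sum, conjTranspose_kronecker, ← mul_kronecker_mul, Matrix.mul_one, hconj]
    have h1 : ∀ α β : Fin n, ((T' α)ᴴ * Z⁻¹ * T' β) ⊗ₖ
        (∑ γ, (T γ * ((T β)ᴴ * T α)).trace • (T γ).map (starRingEnd ℂ))
        = ∑ γ, (((T γ * ((T β)ᴴ * T α)).trace • (T' α)ᴴ) * (Z⁻¹ * T' β)) ⊗ₖ
          (T γ).map (starRingEnd ℂ) := by
      intro α β
      rw [kronecker_sum]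
      refine Finset.sum_congr rfl fun γ _ => ?_
      rw [kronecker_smul, Matrix.smul_mul, smul_kronecker, Matrix.mul_assoc]
    simp only [h1]
    rw [Finset.sum_comm_cycle]
    refine Finset.sum_congr rfl fun γ _ => ?_
    have h2 : ∀ β, ∑ α, ((T γ * ((T β)ᴴ * T α)).trace • (T' α)ᴴ) * (Z⁻¹ * T' β)
        = T' γ * ((T' β)ᴴ * T' β) * Z⁻¹ := by
      intro β
      rw [← Finset.sum_mul, key, ← hcomm']
      simp only [Matrix.mul_assoc]
    rw [Finset.sum_comm]
    simp only [← sum_kronecker, h2]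
    rw [← Finset.sum_mul, ← Finset.mul_sum, ← hZ, mul_nonsing_inv_cancel_right _ _ hdet]
  rw [← hQ]
  refine PosSemidef.conjTranspose_mul_mul_same ?_ _
  exact hpos.inv.kronecker PosSemidef.one

theorem PUnitary.mul_smul_one {p : A} {q : Matrix I J A} (hq : PUnitary p q) :
    q * (p • (1 : Matrix J J A)) = q := by
  rw [← hq.star_mul, ← Matrix.mul_assoc, hq.mul_star, Matrix.smul_mul, Matrix.one_mul, hq.smul_eq]

/-- A vector indexed by `J × J` is a matrix `S`, and it is fixed exactly when `S qᵀ = qᵀ S'` for a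
scalar `S'`. Such pairs are closed under products and adjoints, so the reshuffled matrix `M` is a
twisted Casimir element. -/
theorem IsHaar.posSemidef {p : A} {q : Matrix I J A} (hq : PUnitary p qᵀ)
    {M : Matrix (I × I) (J × J) ℂ}
    (hM : IsHaar p (Matrix.of fun x y : _ × _ => star (q x.1 y.1) * q x.2 y.2) M) :
    (Matrix.of fun x y : I × J => M (x.1, y.1) (x.2, y.2)).PosSemidef := by
  obtain ⟨n, η, ξ, hf, rfl⟩ := hM
  set Q : Matrix (I × I) (J × J) A := Matrix.of fun x y : _ × _ => star (q x.1 y.1) * q x.2 y.2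
  have hent : ∀ {K : Type} (R : Matrix (J × J) K ℂ) (i₁ i₂ : I) (k : K),
      (Q * scalarMat A R) (i₁, i₂) k
        = (qᵀᴴ * (scalarMat A (Matrix.of fun j₁ j₂ => R (j₁, j₂) k) * qᵀ)) i₁ i₂ := by
    intro K R i₁ i₂ k
    simp only [Q, Matrix.mul_apply, Fintype.sum_prod_type, Matrix.of_apply, Finset.mul_sum,
      Matrix.map_apply, Matrix.conjTranspose_apply, Matrix.transpose_apply]
    refine Finset.sum_congr rfl fun j₁ _ => Finset.sum_congr rfl fun j₂ _ => ?_
    rw [mul_assoc, Algebra.commutes]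
  -- Unitarity of `qᵀ` turns the condition of being fixed, which is quadratic in `q`, into a linear
  -- commutation relation, visibly multiplicative in `(S, S')`.
  have hD : ∀ (S : Matrix J J ℂ) (S' : Matrix I I ℂ),
      scalarMat A S * qᵀ = qᵀ * scalarMat A S' ↔
        qᵀᴴ * (scalarMat A S * qᵀ) = p • scalarMat A S' := by
    intro S S'
    constructor
    · intro h
      rw [h, ← Matrix.mul_assoc, hq.star_mul, Matrix.smul_mul, Matrix.one_mul]
    · intro h
      have h1 : qᵀ * (qᵀᴴ * (scalarMat A S * qᵀ)) = qᵀ * (p • (1 : Matrix I I A)) * scalarMat A S' := by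
        rw [h, Matrix.mul_assoc, Matrix.smul_mul, Matrix.one_mul]
      rwa [hq.mul_smul_one, ← Matrix.mul_assoc, hq.mul_star, Matrix.smul_mul, Matrix.one_mul,
        ← scalarMat_mul_smul, hq.smul_eq] at h1
  have h := posSemidef_casimir (fun S S' => scalarMat A S * qᵀ = qᵀ * scalarMat A S')
    (by simp) (fun S S' T T' h h' => by
      rw [scalarMat_mul, Matrix.mul_assoc, h', ← Matrix.mul_assoc, h, Matrix.mul_assoc,
        scalarMat_mul])
    (fun S S' h => (hq.intertwine_star hq h.symm).symm)
    (fun α => Matrix.of fun j₁ j₂ => η (j₁, j₂) α) (fun α => Matrix.of fun i₁ i₂ => ξ (i₁, i₂) α)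
    (fun α => by
      rw [hD]
      ext i₁ i₂
      rw [← hent, hf.fixed]
      simp)
    (fun S S' h => by
      rw [hD] at h
      have h1 : Q * scalarMat A (Matrix.of fun (x : J × J) (_ : Unit) => S x.1 x.2)
          = p • scalarMat A (Matrix.of fun (x : I × I) (_ : Unit) => S' x.1 x.2) := by
        ext ⟨i₁, i₂⟩ k
        rw [hent]
        exact congrFun (congrFun h i₁) i₂
      have htr : ∀ α, (ηᴴ * Matrix.of fun (x : J × J) (_ : Unit) => S x.1 x.2) α ()
          = ((Matrix.of fun j₁ j₂ => η (j₁, j₂) α)ᴴ * S).trace := by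
        intro α
        simp only [Matrix.mul_apply, Matrix.trace, Matrix.diag, Fintype.sum_prod_type,
          Matrix.conjTranspose_apply, Matrix.of_apply]
        exact Finset.sum_comm
      obtain ⟨h2, h3⟩ := hf.expand _ _ h1
      constructor
      · ext j₁ j₂
        have := congrFun (congrFun h2 (j₁, j₂)) ()
        rw [Matrix.mul_apply] at this
        simp only [htr] at this
        simpa [Matrix.sum_apply, mul_comm] using this
      · ext j₁ j₂
        have := congrFun (congrFun h3 (j₁, j₂)) ()
        rw [Matrix.mul_apply] at this
        simp only [htr] at this
        simpa [Matrix.sum_apply, mul_comm] using this)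
  convert h using 1
  ext ⟨i₁, j₁⟩ ⟨i₂, j₂⟩
  simp [Matrix.mul_apply, Matrix.sum_apply]

end Haar

/-! ### Tensor powers of a magic matrix, and the Haar functional on words in its entries. -/

section Words

open Matrix
open scoped Kronecker

variable {A : Type} [Ring A] [StarRing A] [Algebra ℂ A] [StarModule ℂ A]
variable {I J I' J' K L V W : Type}

/-- The magic relations, with the unit replaced by `p`. -/
structure IsMagicOn [Fintype I] [Fintype J] (p : A) (u : Matrix I J A) : Prop where
  star_eq : ∀ i j, star (u i j) = u i j
  idem : ∀ i j, u i j * u i j = u i j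
  row_sum : ∀ i, ∑ j, u i j = p
  col_sum : ∀ j, ∑ i, u i j = p
  row_orth : ∀ i j k, j ≠ k → u i j * u i k = 0
  col_orth : ∀ i k j, i ≠ k → u i j * u k j = 0

namespace IsMagicOn

variable [Fintype I] [Fintype J] {p : A} {u : Matrix I J A}

theorem transpose (h : IsMagicOn p u) : IsMagicOn p uᵀ where
  star_eq i j := h.star_eq j i
  idem i j := h.idem j i
  row_sum := h.col_sum
  col_sum := h.row_sum
  row_orth i j k := h.col_orth j k i
  col_orth i k j := h.row_orth j i k

theorem mul_unit (h : IsMagicOn p u) (i : I) (j : J) : u i j * p = u i j := by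
  rw [← h.row_sum i, Finset.mul_sum, Finset.sum_eq_single j, h.idem]
  · exact fun k _ hk => h.row_orth _ _ _ hk.symm
  · simp

theorem unit_mul (h : IsMagicOn p u) (i : I) (j : J) : p * u i j = u i j := by
  rw [← h.row_sum i, Finset.sum_mul, Finset.sum_eq_single j, h.idem]
  · exact fun k _ hk => h.row_orth _ _ _ hk
  · simp

theorem unit_star [Nonempty I] (h : IsMagicOn p u) : star p = p := by
  obtain ⟨i⟩ := ‹Nonempty I›
  rw [← h.row_sum i, star_sum]
  exact Finset.sum_congr rfl fun j _ => h.star_eq i j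

theorem unit_idem [Nonempty I] (h : IsMagicOn p u) : p * p = p := by
  obtain ⟨i⟩ := ‹Nonempty I›
  calc p * p = (∑ j, u i j) * p := by rw [h.row_sum]
    _ = ∑ j, u i j := by
      rw [Finset.sum_mul]
      exact Finset.sum_congr rfl fun j _ => h.mul_unit i j
    _ = p := h.row_sum i

theorem pUnitary [Nonempty I] [DecidableEq I] [DecidableEq J] (h : IsMagicOn p u) :
    PUnitary p u where
  star_eq := h.unit_star
  mul_star := by
    ext i k
    simp only [Matrix.mul_apply, conjTranspose_apply, h.star_eq, Matrix.smul_apply, smul_eq_mul,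
      Matrix.one_apply]
    split_ifs with hik
    · subst hik
      simp [h.idem, h.row_sum]
    · simp [h.col_orth _ _ _ hik]
  star_mul := by
    ext i k
    simp only [Matrix.mul_apply, conjTranspose_apply, h.star_eq, Matrix.smul_apply, smul_eq_mul,
      Matrix.one_apply]
    split_ifs with hik
    · subst hik
      simp [h.idem, h.col_sum]
    · simp [h.row_orth _ _ _ hik]
  smul_eq := by
    ext i j
    exact h.unit_mul i j

end IsMagicOn

/-- The tensor product of two matrices with coefficients in `A`. -/
def tens (a : Matrix I J A) (b : Matrix I' J' A) : Matrix (I × I') (J × J') A :=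
  Matrix.of fun x y => a x.1 y.1 * b x.2 y.2

theorem tens_apply (a : Matrix I J A) (b : Matrix I' J' A) (x : I × I') (y : J × J') :
    tens a b x y = a x.1 y.1 * b x.2 y.2 := rfl

theorem tens_mul_scalarMat [Fintype J] [Fintype J'] (a : Matrix I J A) (b : Matrix I' J' A)
    (R : Matrix J K ℂ) (S : Matrix J' L ℂ) :
    tens a b * scalarMat A (R ⊗ₖ S) = tens (a * scalarMat A R) (b * scalarMat A S) := by
  ext x y
  simp only [Matrix.mul_apply, tens_apply, Fintype.sum_prod_type, Finset.sum_mul_sum,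
    Matrix.map_apply, kroneckerMap_apply, map_mul]
  refine Finset.sum_congr rfl fun j _ => Finset.sum_congr rfl fun j' _ => ?_
  rw [mul_assoc, mul_assoc, ← mul_assoc (b _ _), ← Algebra.commutes _ (b _ _), mul_assoc]

theorem scalarMat_mul_tens [Fintype J] [Fintype J'] (a : Matrix J K A) (b : Matrix J' L A)
    (R : Matrix I J ℂ) (S : Matrix I' J' ℂ) :
    scalarMat A (R ⊗ₖ S) * tens a b = tens (scalarMat A R * a) (scalarMat A S * b) := by
  ext x y
  simp only [Matrix.mul_apply, tens_apply, Fintype.sum_prod_type, Finset.sum_mul_sum,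
    Matrix.map_apply, kroneckerMap_apply, map_mul]
  refine Finset.sum_congr rfl fun j _ => Finset.sum_congr rfl fun j' _ => ?_
  rw [mul_assoc, mul_assoc, ← mul_assoc _ (a _ _), Algebra.commutes _ (a _ _), mul_assoc]

theorem one_prod_apply [DecidableEq I] [DecidableEq J] (x y : I × J) :
    (1 : Matrix (I × J) (I × J) A) x y = (1 : Matrix I I A) x.1 y.1 * (1 : Matrix J J A) x.2 y.2 := by
  obtain ⟨i, j⟩ := x
  obtain ⟨k, l⟩ := y
  simp only [Matrix.one_apply, Prod.mk.injEq, mul_ite, mul_one, mul_zero, ite_and]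
  split_ifs <;> rfl

theorem one_apply_mul_one_apply [DecidableEq I] [DecidableEq J] (i k : I) (j l : J) :
    (1 : Matrix I I A) i k * (1 : Matrix J J A) j l
      = (1 : Matrix J J A) j l * (1 : Matrix I I A) i k := by
  simp only [Matrix.one_apply, mul_ite, mul_one, mul_zero]
  split_ifs <;> rfl

/-- The entries do not commute, so the order of summation is forced: the factors from `b` are
adjacent in the product with the adjoint on the right, those from `a` in the other product. -/
theorem PUnitary.tens [Fintype I] [Fintype J] [Fintype I'] [Fintype J'] [DecidableEq I]
    [DecidableEq J] [DecidableEq I'] [DecidableEq J'] {p : A} {a : Matrix I J A}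
    {b : Matrix I' J' A} (ha : PUnitary p a) (hb : PUnitary p b) : PUnitary p (tens a b) where
  star_eq := ha.star_eq
  mul_star := by
    ext x y
    have h1 : ∀ i k, ∑ j, b i j * star (b k j) = p * (1 : Matrix I' I' A) i k := fun i k => by
      simpa [Matrix.mul_apply] using congrFun (congrFun hb.mul_star i) k
    have h2 : ∀ i k, ∑ j, a i j * star (a k j) = p * (1 : Matrix I I A) i k := fun i k => by
      simpa [Matrix.mul_apply] using congrFun (congrFun ha.mul_star i) k
    have h3 : ∀ i j, a i j * p = a i j := fun i j => by
      simpa [Matrix.mul_apply, Matrix.one_apply] using congrFun (congrFun ha.mul_smul_one i) j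
    simp only [Matrix.mul_apply, conjTranspose_apply, tens_apply, Fintype.sum_prod_type, StarMul.star_mul,
      Matrix.smul_apply, smul_eq_mul]
    have h4 : ∀ j, ∑ j', a x.1 j * b x.2 j' * (star (b y.2 j') * star (a y.1 j))
        = a x.1 j * star (a y.1 j) * (1 : Matrix I' I' A) x.2 y.2 := by
      intro j
      have : ∀ j', a x.1 j * b x.2 j' * (star (b y.2 j') * star (a y.1 j))
          = a x.1 j * (b x.2 j' * star (b y.2 j')) * star (a y.1 j) := fun j' => by
        simp only [mul_assoc]
      simp only [this]
      rw [← Finset.sum_mul, ← Finset.mul_sum, h1, ← mul_assoc, h3]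
      rw [Matrix.one_apply]
      split_ifs <;> simp
    simp only [h4]
    rw [← Finset.sum_mul, h2, mul_assoc]
    rw [one_prod_apply]
  star_mul := by
    ext x y
    have h1 : ∀ i k, ∑ j, star (b j i) * b j k = p * (1 : Matrix J' J' A) i k := fun i k => by
      simpa [Matrix.mul_apply] using congrFun (congrFun hb.star_mul i) k
    have h2 : ∀ i k, ∑ j, star (a j i) * a j k = p * (1 : Matrix J J A) i k := fun i k => by
      simpa [Matrix.mul_apply] using congrFun (congrFun ha.star_mul i) k
    have h3 : ∀ i j, p * b i j = b i j := fun i j => by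
      simpa using congrFun (congrFun hb.smul_eq i) j
    simp only [Matrix.mul_apply, conjTranspose_apply, tens_apply, Fintype.sum_prod_type, StarMul.star_mul,
      Matrix.smul_apply, smul_eq_mul]
    rw [Finset.sum_comm]
    have h4 : ∀ j', ∑ j, star (b j' x.2) * star (a j x.1) * (a j y.1 * b j' y.2)
        = star (b j' x.2) * b j' y.2 * (1 : Matrix J J A) x.1 y.1 := by
      intro j'
      have : ∀ j, star (b j' x.2) * star (a j x.1) * (a j y.1 * b j' y.2)
          = star (b j' x.2) * (star (a j x.1) * a j y.1) * b j' y.2 := fun j => by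
        simp only [mul_assoc]
      simp only [this]
      rw [← Finset.sum_mul, ← Finset.mul_sum, h2, Matrix.one_apply]
      split_ifs
      · rw [mul_one, mul_one, mul_assoc, h3]
      · simp
    simp only [h4]
    rw [← Finset.sum_mul, h1, mul_assoc]
    rw [one_prod_apply, one_apply_mul_one_apply]
  smul_eq := by
    ext x y
    have h3 : ∀ i j, p * a i j = a i j := fun i j => by
      simpa using congrFun (congrFun ha.smul_eq i) j
    rw [Matrix.smul_apply, smul_eq_mul, tens_apply, ← mul_assoc, h3]

/-- The product of the coefficients of `P` corresponding to the letters of a word. -/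
def wordProd (p : A) (P : Matrix W V A) : List (W × V) → A
  | [] => p
  | x :: s => P x.1 x.2 * wordProd p P s

/-- The matrix of the words of length `k`. -/
def wordMat (p : A) (P : Matrix W V A) (k : ℕ) :
    Matrix (List.Vector W k) (List.Vector V k) A :=
  Matrix.of fun x y => wordProd p P (x.toList.zip y.toList)

/-- Concatenation. -/
def appendEquiv (V : Type) (a b : ℕ) : List.Vector V a × List.Vector V b ≃ List.Vector V (a + b) where
  toFun x := ⟨x.1.toList ++ x.2.toList, by simp⟩
  invFun x := (⟨x.toList.take a, by simp⟩, ⟨x.toList.drop a, by simp⟩)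
  left_inv x := by
    rcases x with ⟨⟨x, hx⟩, ⟨y, hy⟩⟩
    ext1 <;> apply Subtype.ext <;> simp [List.Vector.toList, hx]
  right_inv x := by
    apply Subtype.ext
    simp [List.Vector.toList]

/-- Adding a letter at the beginning. -/
def consEquiv (V : Type) (k : ℕ) : V × List.Vector V k ≃ List.Vector V (k + 1) where
  toFun x := x.1 ::ᵥ x.2
  invFun x := (x.head, x.tail)
  left_inv x := by simp
  right_inv x := by simp

/-- Reversal. -/
def reverseEquiv (V : Type) (k : ℕ) : List.Vector V k ≃ List.Vector V k where
  toFun x := x.reverse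
  invFun x := x.reverse
  left_inv x := by apply Subtype.ext; simp [List.Vector.reverse, List.Vector.toList]
  right_inv x := by apply Subtype.ext; simp [List.Vector.reverse, List.Vector.toList]

variable [Fintype V] [Fintype W] [DecidableEq V] [DecidableEq W] [Nonempty W] [Nonempty V]
  {p : A} {P : Matrix W V A}

theorem unit_mul_wordProd (hP : IsMagicOn p P) (s : List (W × V)) :
    p * wordProd p P s = wordProd p P s := by
  cases s with
  | nil => exact hP.unit_idem
  | cons x s => rw [wordProd, ← mul_assoc, hP.unit_mul]

theorem wordProd_append (hP : IsMagicOn p P) (s t : List (W × V)) :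
    wordProd p P (s ++ t) = wordProd p P s * wordProd p P t := by
  induction s with
  | nil => exact (unit_mul_wordProd hP t).symm
  | cons x s ih => rw [List.cons_append, wordProd, ih, wordProd, mul_assoc]

theorem star_wordProd (hP : IsMagicOn p P) (s : List (W × V)) :
    star (wordProd p P s) = wordProd p P s.reverse := by
  induction s with
  | nil => exact hP.unit_star
  | cons x s ih =>
    rw [wordProd, star_mul, ih, hP.star_eq, List.reverse_cons, wordProd_append hP, wordProd, wordProd,
      hP.mul_unit]

theorem wordMat_transpose (k : ℕ) : (wordMat p P k)ᵀ = wordMat p Pᵀ k := by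
  ext x y
  rw [transpose_apply, wordMat, wordMat, Matrix.of_apply, Matrix.of_apply,
    ← List.zip_swap x.toList y.toList]
  generalize x.toList.zip y.toList = s
  induction s with
  | nil => rfl
  | cons a s ih => exact congrArg _ ih

theorem wordMat_pUnitary (hP : IsMagicOn p P) (k : ℕ) : PUnitary p (wordMat p P k) := by
  induction k with
  | zero =>
    have h : ∀ x y, wordMat p P 0 x y = p := fun x y => by
      rw [Subsingleton.elim x List.Vector.nil, Subsingleton.elim y List.Vector.nil]; rfl
    refine ⟨hP.unit_star, ?_, ?_, ?_⟩
    · ext x y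
      rw [Subsingleton.elim x y]
      simp [Matrix.mul_apply, h, hP.unit_star, hP.unit_idem]
    · ext x y
      rw [Subsingleton.elim x y]
      simp [Matrix.mul_apply, h, hP.unit_star, hP.unit_idem]
    · ext x y
      simp [h, hP.unit_idem]
  | succ k ih =>
    have h := (hP.pUnitary.tens ih).reindex (consEquiv W k).symm (consEquiv V k).symm
    convert h using 1
    ext x y
    obtain ⟨x, rfl⟩ := (consEquiv W k).surjective x
    obtain ⟨y, rfl⟩ := (consEquiv V k).surjective y
    simp [tens_apply, wordMat, consEquiv, wordProd]

theorem wordMat_append (hP : IsMagicOn p P) (a b : ℕ) :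
    (wordMat p P (a + b)).submatrix (appendEquiv W a b) (appendEquiv V a b)
      = tens (wordMat p P a) (wordMat p P b) := by
  ext x y
  simp only [submatrix_apply, wordMat, tens_apply, Matrix.of_apply, appendEquiv]
  rw [← wordProd_append hP, ← List.zip_append (by simp)]
  rfl

theorem IsHaar.reindex [Fintype I] [Fintype J] [DecidableEq I] [DecidableEq J] [Fintype I'] [Fintype J']
    [DecidableEq I'] [DecidableEq J'] {q : Matrix I J A} {M : Matrix I J ℂ} (h : IsHaar p q M)
    (e : I' ≃ I) (f : J' ≃ J) : IsHaar p (q.submatrix e f) (M.submatrix e f) := by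
  obtain ⟨n, η, ξ, hf, rfl⟩ := h
  have hsum : ∀ {B K : Type} [Semiring B] (X : Matrix I J B) (Y : Matrix J K B) (i : I') (k : K),
      ∑ j, X (e i) (f j) * Y (f j) k = (X * Y) (e i) k := fun X Y i k => by
    rw [Matrix.mul_apply]
    exact f.sum_comp fun j => X (e i) j * Y j k
  refine ⟨n, η.submatrix f id, ξ.submatrix e id, ⟨?_, ?_⟩, ?_⟩
  · ext i k
    have := congrFun (congrFun hf.fixed (e i)) k
    rw [← hsum] at this
    exact this
  · intro K R S h
    have h1 : q * scalarMat A (R.submatrix f.symm id) = p • scalarMat A (S.submatrix e.symm id) := by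
      ext i k
      obtain ⟨i, rfl⟩ := e.surjective i
      have := congrFun (congrFun h i) k
      rw [← hsum]
      simpa [Matrix.mul_apply] using this
    obtain ⟨h2, h3⟩ := hf.expand _ _ h1
    have h4 : (η.submatrix f id)ᴴ * R = ηᴴ * R.submatrix f.symm id := by
      ext α k
      rw [Matrix.mul_apply, Matrix.mul_apply, ← f.sum_comp]
      simp
    rw [h4]
    constructor
    · ext j k
      have := congrFun (congrFun h2 (f j)) k
      rw [submatrix_apply, f.symm_apply_apply] at this
      exact this
    · ext i k
      have := congrFun (congrFun h3 (e i)) k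
      rw [submatrix_apply, e.symm_apply_apply] at this
      exact this
  · rw [conjTranspose_submatrix]
    rfl

/-- The values of the Haar functional on the words of length `k`. -/
def haarMat (p : A) (P : Matrix W V A) (k : ℕ) : Matrix (List.Vector W k) (List.Vector V k) ℂ :=
  open Classical in if h : ∃ M, IsHaar p (wordMat p P k) M then h.choose else 0

theorem isHaar_haarMat (hp : p ≠ 0) (k : ℕ) : IsHaar p (wordMat p P k) (haarMat p P k) := by
  have h := exists_isHaar hp (wordMat p P k)
  rw [haarMat, dif_pos h]
  exact h.choose_spec

/-- The Haar functional, on words. -/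
def haar (p : A) (P : Matrix W V A) (s : List (W × V)) : ℂ :=
  haarMat p P s.length ⟨s.map Prod.fst, by simp⟩ ⟨s.map Prod.snd, by simp⟩

theorem haar_zip {k : ℕ} (x : List.Vector W k) (y : List.Vector V k) :
    haar p P (x.toList.zip y.toList) = haarMat p P k x y := by
  have h : ∀ (s : List (W × V)) (hs : s.length = k) (h1 : s.map Prod.fst = x.toList)
      (h2 : s.map Prod.snd = y.toList), haar p P s = haarMat p P k x y := by
    intro s hs h1 h2
    subst hs
    rw [haar]
    congr 1 <;> exact Subtype.ext ‹_›
  refine h _ (by simp) (List.map_fst_zip (by simp)) (List.map_snd_zip (by simp))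

theorem exists_zip (s : List (W × V)) : ∃ (k : ℕ) (x : List.Vector W k) (y : List.Vector V k),
    x.toList.zip y.toList = s :=
  ⟨s.length, ⟨s.map Prod.fst, by simp⟩, ⟨s.map Prod.snd, by simp⟩, by
    induction s with
    | nil => rfl
    | cons a s ih => exact congrArg _ ih⟩

/-- A relation between tensor powers of `P` stays valid after tensoring with identities on both
sides, so `IsHaar.intertwine` transfers it to `haar` between arbitrary words `s` and `t`. Relations
inside any context are what the GNS operators require. The equivalences only allow convenient index
types. -/
theorem haar_intertwine (hp : p ≠ 0) (hP : IsMagicOn p P) [Fintype I] [Fintype J] [Fintype I']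
    [Fintype J'] [DecidableEq I] [DecidableEq J] [DecidableEq I'] [DecidableEq J'] {m m' : ℕ}
    (e : I ≃ List.Vector W m) (f : J ≃ List.Vector V m) (e' : I' ≃ List.Vector W m')
    (f' : J' ≃ List.Vector V m') (R : Matrix J' J ℂ) (S : Matrix I' I ℂ)
    (h : (wordMat p P m').submatrix e' f' * scalarMat A R
      = scalarMat A S * (wordMat p P m).submatrix e f) (s t : List (W × V)) (i' : I') (j : J) :
    ∑ j', haar p P (s ++ ((e' i').toList.zip (f' j').toList ++ t)) * R j' j
      = ∑ i, S i' i * haar p P (s ++ ((e i).toList.zip (f j).toList ++ t)) := by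
  obtain ⟨a, xs, ys, rfl⟩ := exists_zip s
  obtain ⟨b, xt, yt, rfl⟩ := exists_zip t
  have hmat : ∀ {I J : Type} {m : ℕ} (e : I ≃ List.Vector W m) (f : J ≃ List.Vector V m),
      (wordMat p P (a + (m + b))).submatrix
        (((Equiv.refl _).prodCongr ((e.prodCongr (Equiv.refl _)).trans (appendEquiv W m b))).trans
          (appendEquiv W a (m + b)))
        (((Equiv.refl _).prodCongr ((f.prodCongr (Equiv.refl _)).trans (appendEquiv V m b))).trans
          (appendEquiv V a (m + b)))
        = tens (wordMat p P a) (tens ((wordMat p P m).submatrix e f) (wordMat p P b)) := by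
    intro I J m e f
    ext x y
    have h1 := fun x y => congrFun (congrFun (wordMat_append hP a (m + b)) x) y
    have h2 := fun x y => congrFun (congrFun (wordMat_append hP m b) x) y
    simp only [submatrix_apply] at h1 h2
    rw [submatrix_apply]
    refine (h1 _ _).trans ?_
    rw [tens_apply, tens_apply, tens_apply]
    exact congrArg _ (h2 _ _)
  have hH : ∀ {I J : Type} [Fintype I] [Fintype J] [DecidableEq I] [DecidableEq J] {m : ℕ}
      (e : I ≃ List.Vector W m) (f : J ≃ List.Vector V m),
      PUnitary p (tens (wordMat p P a) (tens ((wordMat p P m).submatrix e f) (wordMat p P b))) ∧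
      IsHaar p (tens (wordMat p P a) (tens ((wordMat p P m).submatrix e f) (wordMat p P b)))
        (Matrix.of fun x y => haar p P ((x.1.toList.zip y.1.toList) ++
          (((e x.2.1).toList.zip (f y.2.1).toList) ++ (x.2.2.toList.zip y.2.2.toList)))) := by
    intro I J _ _ _ _ m e f
    rw [← hmat e f]
    refine ⟨(wordMat_pUnitary hP _).reindex _ _, ?_⟩
    refine Eq.subst (motive := IsHaar p _) ?_
      ((isHaar_haarMat (P := P) hp (a + (m + b))).reindex _ _)
    ext x y
    rw [submatrix_apply, ← haar_zip, Matrix.of_apply, ← List.zip_append (by simp),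
      ← List.zip_append (by simp)]
    rfl
  have hint : tens (wordMat p P a) (tens ((wordMat p P m').submatrix e' f') (wordMat p P b)) *
      scalarMat A ((1 : Matrix (List.Vector V a) (List.Vector V a) ℂ) ⊗ₖ
        (R ⊗ₖ (1 : Matrix (List.Vector V b) (List.Vector V b) ℂ)))
      = scalarMat A ((1 : Matrix (List.Vector W a) (List.Vector W a) ℂ) ⊗ₖ
        (S ⊗ₖ (1 : Matrix (List.Vector W b) (List.Vector W b) ℂ))) *
      tens (wordMat p P a) (tens ((wordMat p P m).submatrix e f) (wordMat p P b)) := by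
    rw [tens_mul_scalarMat, tens_mul_scalarMat, scalarMat_mul_tens, scalarMat_mul_tens, h]
    simp
  have key := congrFun (congrFun (IsHaar.intertwine (hH e f).1 (hH e' f').1 (hH e f).2 (hH e' f').2
    hint) (xs, i', xt)) (ys, j, yt)
  simpa [Matrix.mul_apply, Fintype.sum_prod_type, Matrix.one_apply] using key

end Words

/-! ### The magic and adjacency relations for the Haar functional. -/

section HaarRelations

open Matrix

variable {A : Type} [Ring A] [StarRing A] [Algebra ℂ A] [StarModule ℂ A]
variable {V W : Type} [Fintype V] [Fintype W] [DecidableEq V] [DecidableEq W] [Nonempty W]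
  [Nonempty V] {p : A} {P : Matrix W V A}

/-- Words of length zero. -/
def vecZero (V : Type) : Unit ≃ List.Vector V 0 where
  toFun _ := List.Vector.nil
  invFun _ := ()
  left_inv _ := rfl
  right_inv _ := Subsingleton.elim _ _

/-- Words of length one. -/
def vecOne (V : Type) : V ≃ List.Vector V 1 where
  toFun v := ⟨[v], rfl⟩
  invFun x := x.head
  left_inv _ := rfl
  right_inv x := by
    obtain ⟨v, t, rfl⟩ := x.exists_eq_cons
    rw [Subsingleton.elim t List.Vector.nil]
    rfl

/-- Words of length two. -/
def vecTwo (V : Type) : V × V ≃ List.Vector V 2 where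
  toFun x := ⟨[x.1, x.2], rfl⟩
  invFun x := (x.head, x.tail.head)
  left_inv _ := rfl
  right_inv x := by
    obtain ⟨v, t, rfl⟩ := x.exists_eq_cons
    obtain ⟨w, t, rfl⟩ := t.exists_eq_cons
    rw [Subsingleton.elim t List.Vector.nil]
    rfl

theorem wordMat_vecZero : (wordMat p P 0).submatrix (vecZero W) (vecZero V)
    = Matrix.of fun _ _ => p := rfl

theorem wordMat_vecOne (hP : IsMagicOn p P) :
    (wordMat p P 1).submatrix (vecOne W) (vecOne V) = P := by
  ext w v
  exact hP.mul_unit w v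

theorem wordMat_vecTwo (hP : IsMagicOn p P) :
    (wordMat p P 2).submatrix (vecTwo W) (vecTwo V) = tens P P := by
  ext w v
  exact congrArg (_ * ·) (hP.mul_unit _ _)

theorem haar_nil (hp : p ≠ 0) : haar p P [] = 1 := by
  have h := (isHaar_haarMat (P := P) hp 0).mul_eq (R := (1 : Matrix (List.Vector V 0) (List.Vector V 0) ℂ))
    (S := Matrix.of fun _ _ => 1) (by
      ext x y
      rw [Subsingleton.elim x List.Vector.nil, Subsingleton.elim y List.Vector.nil]
      rw [Matrix.mul_apply, Fintype.sum_subsingleton _ List.Vector.nil]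
      simp [wordMat, wordProd])
  rw [Matrix.mul_one] at h
  exact congrFun (congrFun h _) _

theorem haar_adj (hp : p ≠ 0) (hP : IsMagicOn p P) (R : Matrix V V ℂ) (S : Matrix W W ℂ)
    (h : P * scalarMat A R = scalarMat A S * P) (s t : List (W × V)) (w : W) (v : V) :
    ∑ v', haar p P (s ++ (w, v') :: t) * R v' v = ∑ w', S w w' * haar p P (s ++ (w', v) :: t) :=
  haar_intertwine hp hP (vecOne W) (vecOne V) (vecOne W) (vecOne V) R S
    (by rwa [wordMat_vecOne hP]) s t w v

theorem haar_row_sum (hp : p ≠ 0) (hP : IsMagicOn p P) (s t : List (W × V)) (w : W) :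
    ∑ v, haar p P (s ++ (w, v) :: t) = haar p P (s ++ t) := by
  -- The intertwiner from length zero to length one is the vector with all coordinates `1`.
  have h := haar_intertwine hp hP (vecZero W) (vecZero V) (vecOne W) (vecOne V)
    (Matrix.of fun _ _ => 1) (Matrix.of fun _ _ => 1) (by
      rw [wordMat_vecOne hP, wordMat_vecZero]
      ext w x
      simp [Matrix.mul_apply, hP.row_sum]) s t w ()
  simp only [Matrix.of_apply, mul_one, one_mul, Finset.univ_unique, Finset.sum_singleton] at h
  exact h

theorem haar_col_sum (hp : p ≠ 0) (hP : IsMagicOn p P) (s t : List (W × V)) (v : V) :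
    ∑ w, haar p P (s ++ (w, v) :: t) = haar p P (s ++ t) := by
  have h := haar_intertwine hp hP (vecOne W) (vecOne V) (vecZero W) (vecZero V)
    (Matrix.of fun _ _ => 1) (Matrix.of fun _ _ => 1) (by
      rw [wordMat_vecOne hP, wordMat_vecZero]
      ext w x
      simp [Matrix.mul_apply, hP.col_sum]) s t () v
  simp only [Matrix.of_apply, mul_one, one_mul, Finset.univ_unique, Finset.sum_singleton] at h
  exact h.symm

/-- Orthogonality and idempotency along columns together say that `e_u ↦ e_u ⊗ e_u` intertwines `P`
with its tensor square. The row version uses the adjoint map. -/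
theorem haar_col_mul (hp : p ≠ 0) (hP : IsMagicOn p P) (s t : List (W × V)) (w w' : W) (v : V) :
    haar p P (s ++ (w, v) :: (w', v) :: t) = if w = w' then haar p P (s ++ (w, v) :: t) else 0 := by
  have h := haar_intertwine hp hP (vecOne W) (vecOne V) (vecTwo W) (vecTwo V)
    (Matrix.of fun (x : V × V) u => if x = (u, u) then 1 else 0)
    (Matrix.of fun (x : W × W) u => if x = (u, u) then 1 else 0) (by
      rw [wordMat_vecOne hP, wordMat_vecTwo hP]
      ext ⟨w, w'⟩ u
      have h1 : ∀ x, ((w, w') = (x, x)) ↔ (w = x ∧ w' = x) := fun x => by simp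
      simp only [Matrix.mul_apply, tens_apply, Matrix.map_apply, Matrix.of_apply, h1, apply_ite,
        map_one, map_zero, mul_one, mul_zero, ite_mul, one_mul, zero_mul,
        Finset.sum_ite_eq', Finset.mem_univ, if_true]
      by_cases hw : w = w'
      · subst hw
        simp [hP.idem]
      · rw [hP.col_orth _ _ _ hw, Finset.sum_eq_zero]
        intro x _
        rw [if_neg]
        rintro ⟨rfl, rfl⟩
        exact hw rfl) s t (w, w') v
  simp only [Matrix.of_apply, mul_ite, mul_one, mul_zero, ite_mul, one_mul, zero_mul,
    Finset.sum_ite_eq', Finset.mem_univ, if_true] at h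
  refine h.trans ?_
  by_cases hw : w = w'
  · subst hw
    rw [if_pos rfl, Finset.sum_eq_single w]
    · rw [if_pos rfl]; rfl
    · intro x _ hx
      rw [if_neg]
      simp [hx.symm]
    · simp
  · rw [if_neg hw, Finset.sum_eq_zero]
    intro x _
    rw [if_neg]
    rw [Prod.mk.injEq]
    rintro ⟨rfl, rfl⟩
    exact hw rfl

theorem haar_row_mul (hp : p ≠ 0) (hP : IsMagicOn p P) (s t : List (W × V)) (w : W) (v v' : V) :
    haar p P (s ++ (w, v) :: (w, v') :: t) = if v = v' then haar p P (s ++ (w, v) :: t) else 0 := by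
  have h := haar_intertwine hp hP (vecTwo W) (vecTwo V) (vecOne W) (vecOne V)
    (Matrix.of fun u (x : V × V) => if x = (u, u) then 1 else 0)
    (Matrix.of fun u (x : W × W) => if x = (u, u) then 1 else 0) (by
      rw [wordMat_vecOne hP, wordMat_vecTwo hP]
      ext u ⟨v, v'⟩
      have h1 : ∀ x, ((v, v') = (x, x)) ↔ (v = x ∧ v' = x) := fun x => by simp
      simp only [Matrix.mul_apply, tens_apply, Matrix.map_apply, Matrix.of_apply, h1, apply_ite,
        map_one, map_zero, mul_one, mul_zero, ite_mul, one_mul, zero_mul,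
        Finset.sum_ite_eq', Finset.mem_univ, if_true]
      by_cases hw : v = v'
      · subst hw
        simp [hP.idem]
      · rw [hP.row_orth _ _ _ hw, Finset.sum_eq_zero]
        intro x _
        rw [if_neg]
        rintro ⟨rfl, rfl⟩
        exact hw rfl) s t w (v, v')
  simp only [Matrix.of_apply, mul_ite, mul_one, mul_zero, ite_mul, one_mul, zero_mul,
    Finset.sum_ite_eq', Finset.mem_univ, if_true] at h
  refine h.symm.trans ?_
  by_cases hw : v = v'
  · subst hw
    rw [if_pos rfl, Finset.sum_eq_single v]
    · rw [if_pos rfl]; rfl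
    · intro x _ hx
      rw [if_neg]
      simp [hx.symm]
    · simp
  · rw [if_neg hw, Finset.sum_eq_zero]
    intro x _
    rw [if_neg]
    rw [Prod.mk.injEq]
    rintro ⟨rfl, rfl⟩
    exact hw rfl

-- Reversing a word takes the adjoint of the product of its entries, so this is the Gram matrix
-- treated by `IsHaar.posSemidef`. The unitarity of the transpose required there holds because the
-- transpose of a magic matrix is magic.
open scoped ComplexOrder in
theorem haar_posSemidef (hp : p ≠ 0) (hP : IsMagicOn p P) (k : ℕ) :
    (Matrix.of fun x y : List.Vector W k × List.Vector V k =>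
      haar p P ((x.1.toList.zip x.2.toList).reverse ++ y.1.toList.zip y.2.toList)).PosSemidef := by
  have h1 : PUnitary p (wordMat p P k)ᵀ := by
    rw [wordMat_transpose]
    exact wordMat_pUnitary hP.transpose k
  have h2 := (isHaar_haarMat (P := P) hp (k + k)).reindex
    (((reverseEquiv W k).prodCongr (Equiv.refl _)).trans (appendEquiv W k k))
    (((reverseEquiv V k).prodCongr (Equiv.refl _)).trans (appendEquiv V k k))
  have hrev : ∀ (x : List.Vector W k) (y : List.Vector V k),
      (x.toList.zip y.toList).reverse = x.toList.reverse.zip y.toList.reverse := by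
    intro x y
    exact List.reverse_zipWith (by simp)
  have h3 : (wordMat p P (k + k)).submatrix
      (((reverseEquiv W k).prodCongr (Equiv.refl _)).trans (appendEquiv W k k))
      (((reverseEquiv V k).prodCongr (Equiv.refl _)).trans (appendEquiv V k k))
      = Matrix.of fun x y => star (wordMat p P k x.1 y.1) * wordMat p P k x.2 y.2 := by
    ext x y
    refine (congrFun (congrFun (wordMat_append hP k k) _) _).trans ?_
    rw [tens_apply, Matrix.of_apply]
    congr 1
    simp only [wordMat, Matrix.of_apply]
    rw [star_wordProd hP, hrev]
    rfl
  rw [h3] at h2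
  convert h2.posSemidef h1 using 1
  ext x y
  rw [Matrix.of_apply, Matrix.of_apply, submatrix_apply, ← haar_zip, hrev,
    ← List.zip_append (by simp)]
  rfl

end HaarRelations

/-! ### The GNS construction for a positive functional on words. -/

section GNS

open scoped InnerProductSpace

variable {X : Type}

/-- A positive functional on words whose letters are selfadjoint projections. -/
structure IsPositiveOnWords (h : List X → ℂ) : Prop where
  nil : h [] = 1
  conj : ∀ s, starRingEnd ℂ (h s.reverse) = h s
  nonneg : ∀ f : List X →₀ ℂ,
    0 ≤ (f.sum fun s a => f.sum fun t b => starRingEnd ℂ a * b * h (s.reverse ++ t)).re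
  idem : ∀ s x t, h (s ++ x :: x :: t) = h (s ++ x :: t)

/-- The space of the combinations of words, with the inner product defined by `h`. -/
@[nolint unusedArguments]
def PreGNS (_ : List X → ℂ) : Type := List X →₀ ℂ

variable {h : List X → ℂ}

instance : AddCommGroup (PreGNS h) := inferInstanceAs (AddCommGroup (List X →₀ ℂ))
instance : Module ℂ (PreGNS h) := inferInstanceAs (Module ℂ (List X →₀ ℂ))

/-- The form defined by `h`. -/
def wordForm (h : List X → ℂ) (f g : List X →₀ ℂ) : ℂ :=
  f.sum fun s a => g.sum fun t b => starRingEnd ℂ a * b * h (s.reverse ++ t)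

theorem wordForm_add_left (f f' g : List X →₀ ℂ) :
    wordForm h (f + f') g = wordForm h f g + wordForm h f' g :=
  Finsupp.sum_add_index' (by simp) (by simp [add_mul, Finsupp.sum_add])

theorem wordForm_smul_left (c : ℂ) (f g : List X →₀ ℂ) :
    wordForm h (c • f) g = starRingEnd ℂ c * wordForm h f g := by
  rw [wordForm, Finsupp.sum_smul_index' (by simp), wordForm, Finsupp.mul_sum]
  refine Finsupp.sum_congr fun s _ => ?_
  rw [Finsupp.mul_sum]
  simp [mul_assoc]

theorem wordForm_single_single (s t : List X) (a b : ℂ) :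
    wordForm h (Finsupp.single s a) (Finsupp.single t b)
      = starRingEnd ℂ a * b * h (s.reverse ++ t) := by
  simp [wordForm]

theorem wordForm_single_left (s : List X) (a : ℂ) (g : List X →₀ ℂ) :
    wordForm h (Finsupp.single s a) g
      = g.sum fun t b => starRingEnd ℂ a * b * h (s.reverse ++ t) :=
  Finsupp.sum_single_index (by simp)

theorem wordForm_single_right (t : List X) (b : ℂ) (g : List X →₀ ℂ) :
    wordForm h g (Finsupp.single t b)
      = g.sum fun s a => starRingEnd ℂ a * b * h (s.reverse ++ t) :=
  Finsupp.sum_congr fun _ _ => Finsupp.sum_single_index (by simp)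

theorem wordForm_conj (hh : ∀ s, starRingEnd ℂ (h s.reverse) = h s) (f g : List X →₀ ℂ) :
    starRingEnd ℂ (wordForm h g f) = wordForm h f g := by
  rw [wordForm, wordForm, Finsupp.sum_comm]
  simp only [Finsupp.sum, map_sum, map_mul, Complex.conj_conj]
  refine Finset.sum_congr rfl fun s _ => Finset.sum_congr rfl fun t _ => ?_
  rw [← hh (s.reverse ++ t)]
  simp [mul_comm]

theorem wordForm_cons (x : X) (f g : List X →₀ ℂ) :
    wordForm h (Finsupp.lmapDomain ℂ ℂ (List.cons x) f) g
      = wordForm h f (Finsupp.lmapDomain ℂ ℂ (List.cons x) g) := by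
  rw [wordForm, wordForm, Finsupp.lmapDomain_apply, Finsupp.sum_mapDomain_index (by simp)
    (by simp [add_mul, Finsupp.sum_add])]
  refine Finsupp.sum_congr fun s _ => ?_
  rw [Finsupp.lmapDomain_apply, Finsupp.sum_mapDomain_index (by simp) (by simp [mul_add, add_mul])]
  simp

theorem wordForm_cons_cons (hh : IsPositiveOnWords h) (x : X) (f g : List X →₀ ℂ) :
    wordForm h (Finsupp.lmapDomain ℂ ℂ (List.cons x) f) (Finsupp.lmapDomain ℂ ℂ (List.cons x) g)
      = wordForm h f (Finsupp.lmapDomain ℂ ℂ (List.cons x) g) := by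
  rw [wordForm_cons]
  simp only [wordForm, Finsupp.lmapDomain_apply]
  refine Finsupp.sum_congr fun s _ => ?_
  rw [Finsupp.sum_mapDomain_index (by simp) (by simp [mul_add, add_mul]),
    Finsupp.sum_mapDomain_index (by simp) (by simp [mul_add, add_mul]),
    Finsupp.sum_mapDomain_index (by simp) (by simp [mul_add, add_mul])]
  simp [hh.idem]

/-- The pre-Hilbert space structure. -/
abbrev preGNSCore (hh : IsPositiveOnWords h) : PreInnerProductSpace.Core ℂ (PreGNS h) where
  inner f g := wordForm h f g
  conj_inner_symm f g := wordForm_conj hh.conj f g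
  re_inner_nonneg f := hh.nonneg f
  add_left f f' g := wordForm_add_left f f' g
  smul_left f g c := wordForm_smul_left c f g

variable [hh : Fact (IsPositiveOnWords h)]

instance : SeminormedAddCommGroup (PreGNS h) :=
  InnerProductSpace.Core.toSeminormedAddCommGroup (c := preGNSCore hh.out)

instance : InnerProductSpace ℂ (PreGNS h) := InnerProductSpace.ofCore (preGNSCore hh.out)

theorem preGNS_inner (f g : PreGNS h) : ⟪f, g⟫_ℂ = wordForm h f g := rfl

/-- The Hilbert space defined by `h`. -/
abbrev GNS (h : List X → ℂ) [Fact (IsPositiveOnWords h)] : Type :=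
  UniformSpace.Completion (PreGNS h)

/-- The operator of left multiplication by a letter. -/
def preLetter (h : List X → ℂ) [hh : Fact (IsPositiveOnWords h)] (x : X) :
    PreGNS h →L[ℂ] PreGNS h :=
  LinearMap.mkContinuous (Finsupp.lmapDomain ℂ ℂ (List.cons x) : (List X →₀ ℂ) →ₗ[ℂ] (List X →₀ ℂ)) 1
    (by
      intro f
      set g : PreGNS h := (Finsupp.lmapDomain ℂ ℂ (List.cons x) : (List X →₀ ℂ) →ₗ[ℂ] _) f
      rw [one_mul]
      change ‖g‖ ≤ ‖f‖
      -- Letters are symmetric and idempotent for the form. With the Cauchy–Schwarz inequality this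
      -- gives the bound `1`, which no topology on the original algebra provides.
      have h1 : ⟪g, g⟫_ℂ = ⟪f, g⟫_ℂ := wordForm_cons_cons hh.out x f f
      have h2 : ‖g‖ * ‖g‖ ≤ ‖f‖ * ‖g‖ := by
        have h3 := norm_inner_le_norm (𝕜 := ℂ) f g
        rw [← h1] at h3
        refine le_trans (le_of_eq ?_) h3
        rw [← inner_self_eq_norm_mul_norm (𝕜 := ℂ), inner_self_re_eq_norm]
      by_contra hc
      push Not at hc
      have : 0 < ‖g‖ := lt_of_le_of_lt (norm_nonneg f) hc
      nlinarith)

/-- The projection associated to a letter. -/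
def letterOp (h : List X → ℂ) [Fact (IsPositiveOnWords h)] (x : X) : GNS h →L[ℂ] GNS h :=
  (preLetter h x).completion

/-- A word, as a vector of the pre-Hilbert space. -/
def preWord (h : List X → ℂ) (s : List X) : PreGNS h := Finsupp.single s (1 : ℂ)

theorem preGNS_induction {C : PreGNS h → Prop} (h0 : C 0) (hadd : ∀ f g, C f → C g → C (f + g))
    (hs : ∀ (c : ℂ) s, C (c • preWord h s)) (f : PreGNS h) : C f := by
  refine Finsupp.induction_linear (motive := C) f h0 hadd fun s c => ?_
  have h1 := hs c s
  rwa [show c • preWord h s = Finsupp.single s c from Finsupp.smul_single_one s c] at h1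

/-- The vector associated to a word. -/
def wordVec (h : List X → ℂ) [Fact (IsPositiveOnWords h)] (s : List X) : GNS h :=
  (preWord h s : GNS h)

theorem inner_wordVec (s t : List X) : ⟪wordVec h s, wordVec h t⟫_ℂ = h (s.reverse ++ t) := by
  rw [wordVec, wordVec, UniformSpace.Completion.inner_coe, preGNS_inner]
  refine (wordForm_single_single s t 1 1).trans ?_
  simp

theorem letterOp_wordVec (x : X) (s : List X) : letterOp h x (wordVec h s) = wordVec h (x :: s) := by
  rw [letterOp, wordVec, ContinuousLinearMap.completion_apply_coe]
  exact congrArg (fun f : PreGNS h => (f : GNS h)) Finsupp.mapDomain_single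

theorem gns_induction {C : GNS h → Prop} (hC : IsClosed {v | C v}) (h0 : C 0)
    (hadd : ∀ v w, C v → C w → C (v + w)) (hs : ∀ (c : ℂ) s, C (c • wordVec h s)) (v : GNS h) :
    C v := by
  induction v using UniformSpace.Completion.induction_on with
  | hp => exact hC
  | ih f =>
    refine preGNS_induction (C := fun f => C (f : GNS h)) h0 (fun f g hf hg => ?_)
      (fun c s => ?_) f
    · rw [UniformSpace.Completion.coe_add]
      exact hadd _ _ hf hg
    · rw [UniformSpace.Completion.coe_smul]
      exact hs c s

theorem eq_zero_of_inner_wordVec {v : GNS h} (hv : ∀ s, ⟪wordVec h s, v⟫_ℂ = 0) : v = 0 := by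
  refine (inner_self_eq_zero (𝕜 := ℂ)).1 (gns_induction (C := fun w => ⟪w, v⟫_ℂ = 0)
    (isClosed_eq (by fun_prop) continuous_const) (inner_zero_left _) (fun w w' hw hw' => ?_)
    (fun c s => ?_) v)
  · rw [inner_add_left, hw, hw', add_zero]
  · rw [inner_smul_left, hv, mul_zero]

/-- Words span a dense subspace, so an identity between operators reduces to an identity between
values of `h`. -/
theorem op_ext {S T : GNS h →L[ℂ] GNS h}
    (hST : ∀ s t, ⟪wordVec h s, S (wordVec h t)⟫_ℂ = ⟪wordVec h s, T (wordVec h t)⟫_ℂ) : S = T := by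
  ext v
  refine gns_induction (C := fun v => S v = T v) (isClosed_eq (by fun_prop) (by fun_prop))
    (by simp) (fun w w' hw hw' => by rw [map_add, map_add, hw, hw']) (fun c t => ?_) v
  rw [map_smul, map_smul, ← sub_eq_zero, ← smul_sub]
  rw [eq_zero_of_inner_wordVec (v := S (wordVec h t) - T (wordVec h t)), smul_zero]
  intro s
  rw [inner_sub_right, hST, sub_self]

theorem star_letterOp (x : X) : star (letterOp h x) = letterOp h x := by
  refine op_ext fun s t => ?_
  rw [ContinuousLinearMap.star_eq_adjoint, ContinuousLinearMap.adjoint_inner_right,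
    letterOp_wordVec, letterOp_wordVec, inner_wordVec, inner_wordVec]
  simp

/-- The empty word is a unit vector, since `h [] = 1`. -/
theorem gns_nontrivial (h : List X → ℂ) [hh : Fact (IsPositiveOnWords h)] :
    Nontrivial (GNS h →L[ℂ] GNS h) := by
  refine ⟨1, 0, fun h1 => ?_⟩
  have h2 := congrArg (fun T : GNS h →L[ℂ] GNS h => ⟪wordVec h [], T (wordVec h [])⟫_ℂ) h1
  simp only [one_apply_eq_self, zero_apply, inner_zero_right,
    inner_wordVec] at h2
  exact one_ne_zero (hh.out.nil.symm.trans h2)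

end GNS

/-! ### Positivity of the Haar functional on words of all lengths, and passage to a C*-algebra. -/

section Haar

open Matrix
open scoped ComplexOrder

variable {A : Type} [Ring A] [StarRing A] [Algebra ℂ A] [StarModule ℂ A]
variable {V W : Type} [Fintype V] [Fintype W] [DecidableEq V] [DecidableEq W] [Nonempty W]
  [Nonempty V] {p : A} {P : Matrix W V A}

theorem wordForm_sum_left {X ι : Type} {h : List X → ℂ} (T : Finset ι) (f : ι → List X →₀ ℂ)
    (g : List X →₀ ℂ) : wordForm h (∑ i ∈ T, f i) g = ∑ i ∈ T, wordForm h (f i) g := by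
  classical
  induction T using Finset.induction_on with
  | empty => simp [wordForm]
  | insert i T hi ih => rw [Finset.sum_insert hi, wordForm_add_left, ih, Finset.sum_insert hi]

theorem wordForm_add_right {X : Type} {h : List X → ℂ} (f g g' : List X →₀ ℂ) :
    wordForm h f (g + g') = wordForm h f g + wordForm h f g' := by
  rw [wordForm, wordForm, wordForm, ← Finsupp.sum_add]
  refine Finsupp.sum_congr fun s _ => ?_
  exact Finsupp.sum_add_index' (by simp) (by simp [add_mul, mul_add])

theorem wordForm_sum_right {X ι : Type} {h : List X → ℂ} (T : Finset ι) (f : ι → List X →₀ ℂ)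
    (g : List X →₀ ℂ) : wordForm h g (∑ i ∈ T, f i) = ∑ i ∈ T, wordForm h g (f i) := by
  classical
  induction T using Finset.induction_on with
  | empty => simp [wordForm]
  | insert i T hi ih => rw [Finset.sum_insert hi, wordForm_add_right, ih, Finset.sum_insert hi]

/-- A combination of words has an equivalent one of degree `k`. -/
def HasPad (h : List (W × V) → ℂ) (k : ℕ) (f : List (W × V) →₀ ℂ) : Prop :=
  ∃ g : List (W × V) →₀ ℂ, (∀ s ∈ g.support, s.length = k) ∧
    (∀ r, wordForm h f r = wordForm h g r) ∧ (∀ r, wordForm h r f = wordForm h r g)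

/-- `haar_posSemidef` only compares words of one common length. By `haar_row_sum`, appending `(w,
v)` with `w` fixed and summing over `v` does not change the form, so words can be lengthened at
will. -/
theorem hasPad_single (hp : p ≠ 0) (hP : IsMagicOn p P) (c : ℂ) (n : ℕ) :
    ∀ s : List (W × V), HasPad (haar p P) (s.length + n) (Finsupp.single s c) := by
  classical
  obtain ⟨w⟩ := ‹Nonempty W›
  induction n with
  | zero =>
    intro s
    refine ⟨Finsupp.single s c, fun t ht => ?_, fun _ => rfl, fun _ => rfl⟩
    rw [Finset.mem_singleton.1 (Finsupp.support_single_subset ht), add_zero]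
  | succ n ih =>
    intro s
    choose g hg1 hg2 hg3 using fun v : V => ih (s ++ [(w, v)])
    refine ⟨∑ v, g v, fun t ht => ?_, fun r => ?_, fun r => ?_⟩
    · obtain ⟨v, _, hv⟩ := Finset.mem_biUnion.1 (Finsupp.support_finsetSum ht)
      rw [hg1 v t hv]
      simp
      ring
    · rw [wordForm_sum_left]
      simp only [← hg2]
      simp only [wordForm_single_left, List.reverse_append, List.reverse_cons, List.reverse_nil,
        List.nil_append, List.cons_append]
      rw [← Finsupp.sum_finsetSum_comm]
      refine Finsupp.sum_congr fun t _ => ?_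
      rw [← Finset.mul_sum]
      exact congrArg _ (haar_row_sum hp hP [] _ w).symm
    · rw [wordForm_sum_right]
      simp only [← hg3]
      simp only [wordForm_single_right]
      rw [← Finsupp.sum_finsetSum_comm]
      refine Finsupp.sum_congr fun t _ => ?_
      rw [← Finset.mul_sum]
      refine congrArg _ ?_
      have := haar_row_sum hp hP (t.reverse ++ s) [] w
      simpa using this.symm

theorem exists_hasPad (hp : p ≠ 0) (hP : IsMagicOn p P) (f : List (W × V) →₀ ℂ) :
    ∃ k₀, ∀ k, k₀ ≤ k → HasPad (haar p P) k f := by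
  classical
  induction f using Finsupp.induction_linear with
  | zero => exact ⟨0, fun k _ => ⟨0, by simp, fun _ => rfl, fun _ => rfl⟩⟩
  | add f g hf hg =>
    obtain ⟨k, hk⟩ := hf
    obtain ⟨l, hl⟩ := hg
    refine ⟨max k l, fun m hm => ?_⟩
    obtain ⟨f', hf1, hf2, hf3⟩ := hk m ((le_max_left _ _).trans hm)
    obtain ⟨g', hg1, hg2, hg3⟩ := hl m ((le_max_right _ _).trans hm)
    refine ⟨f' + g', fun s hs => ?_, fun r => ?_, fun r => ?_⟩
    · rcases Finset.mem_union.1 (Finsupp.support_add hs) with h | h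
      · exact hf1 s h
      · exact hg1 s h
    · rw [wordForm_add_left, wordForm_add_left, hf2, hg2]
    · rw [wordForm_add_right, wordForm_add_right, hf3, hg3]
  | single s c =>
    refine ⟨s.length, fun k hk => ?_⟩
    obtain ⟨n, rfl⟩ := Nat.exists_eq_add_of_le hk
    exact hasPad_single hp hP c n s

theorem haar_conj_of_length (hp : p ≠ 0) (hP : IsMagicOn p P) {k : ℕ} {s t : List (W × V)}
    (hs : s.length = k) (ht : t.length = k) :
    starRingEnd ℂ (haar p P (s.reverse ++ t)) = haar p P (t.reverse ++ s) := by
  obtain ⟨k₁, x, y, rfl⟩ := exists_zip s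
  obtain ⟨k₂, x', y', rfl⟩ := exists_zip t
  obtain rfl : k₁ = k := by simpa using hs
  obtain rfl : k₂ = k₁ := by simpa using ht
  exact congrFun (congrFun (haar_posSemidef hp hP k₂).1 (x', y')) (x, y)

theorem isPositiveOnWords_haar (hp : p ≠ 0) (hP : IsMagicOn p P) :
    IsPositiveOnWords (haar p P) where
  nil := haar_nil hp
  conj s := by
    -- The values at `s` and at its reverse are the two pairings of `s` with the empty word. Once
    -- both are padded to the same length, the Gram matrix is Hermitian.
    obtain ⟨k, hk⟩ := exists_hasPad hp hP (Finsupp.single s 1)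
    obtain ⟨l, hl⟩ := exists_hasPad hp hP (Finsupp.single [] 1)
    obtain ⟨f, hf1, hf2, hf3⟩ := hk (max k l) (le_max_left _ _)
    obtain ⟨g, hg1, hg2, hg3⟩ := hl (max k l) (le_max_right _ _)
    have h1 : starRingEnd ℂ (wordForm (haar p P) f g) = wordForm (haar p P) g f := by
      rw [wordForm, wordForm, Finsupp.sum_comm]
      simp only [Finsupp.sum, map_sum, map_mul, Complex.conj_conj]
      refine Finset.sum_congr rfl fun t ht => Finset.sum_congr rfl fun s hs => ?_
      rw [haar_conj_of_length hp hP (hf1 s hs) (hg1 t ht)]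
      ring
    rw [← hf2, ← hg3, ← hg2, ← hf3, wordForm_single_single, wordForm_single_single] at h1
    simpa using h1
  nonneg f := by
    obtain ⟨k, hk⟩ := exists_hasPad hp hP f
    obtain ⟨g, hg1, hg2, hg3⟩ := hk k le_rfl
    change 0 ≤ (wordForm (haar p P) f f).re
    rw [hg2, hg3]
    have hinj : Function.Injective (fun x : List.Vector W k × List.Vector V k =>
        x.1.toList.zip x.2.toList) := by
      rintro ⟨x, y⟩ ⟨x', y'⟩ h
      have h1 := congrArg (List.map Prod.fst) h
      have h2 := congrArg (List.map Prod.snd) h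
      simp only at h1 h2
      rw [List.map_fst_zip (by simp), List.map_fst_zip (by simp)] at h1
      rw [List.map_snd_zip (by simp), List.map_snd_zip (by simp)] at h2
      exact Prod.ext (Subtype.ext h1) (Subtype.ext h2)
    -- A word of length `k` is a pair of vectors, so `g` can be moved to the index set of the
    -- positive Gram matrix.
    have hg : Finsupp.mapDomain (fun x : List.Vector W k × List.Vector V k =>
        x.1.toList.zip x.2.toList) (Finsupp.comapDomain _ g hinj.injOn) = g := by
      refine Finsupp.mapDomain_comapDomain _ hinj g fun s hs => ?_
      obtain ⟨l, x, y, rfl⟩ := exists_zip s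
      obtain rfl : l = k := by simpa using hg1 _ hs
      exact ⟨(x, y), rfl⟩
    rw [← hg, wordForm, Finsupp.sum_mapDomain_index (by simp) (by simp [add_mul, Finsupp.sum_add])]
    have h1 := (haar_posSemidef (P := P) hp hP k).2 (Finsupp.comapDomain _ g hinj.injOn)
    refine le_of_le_of_eq (Complex.le_def.1 h1).1 (congrArg Complex.re ?_)
    refine Finsupp.sum_congr fun x _ => ?_
    rw [Finsupp.sum_mapDomain_index (by simp) (by simp [add_mul, mul_add])]
    refine Finsupp.sum_congr fun y _ => ?_
    rw [Matrix.of_apply]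
    simp only [starRingEnd_apply]
    ring
  idem s x t := by
    have := haar_row_mul hp hP s t x.1 x.2 x.2
    rwa [if_pos rfl] at this

/-- A magic intertwiner with coefficients in a `*`-algebra can be realized in a `C*`-algebra. -/
theorem exists_cstarAlgebra (hp : p ≠ 0) (hP : IsMagicOn p P) (R : Matrix V V ℂ) (S : Matrix W W ℂ)
    (h : P * scalarMat A R = scalarMat A S * P) :
    ∃ (B : Type) (_ : CStarAlgebra B) (_ : Nontrivial B) (Q : Matrix W V B),
      IsMagic Q ∧ Q * scalarMat B R = scalarMat B S * Q := by
  -- The letters act by left multiplication. Their matrix coefficients between words are values of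
  -- `haar` in a context, so each relation for `haar` becomes an operator relation; the former unit
  -- `p` becomes the identity.
  have : Fact (IsPositiveOnWords (haar p P)) := ⟨isPositiveOnWords_haar hp hP⟩
  refine ⟨GNS (haar p P) →L[ℂ] GNS (haar p P), inferInstance, gns_nontrivial _,
    Matrix.of fun w v => letterOp (haar p P) (w, v), ⟨?_, ?_, ?_, ?_, ?_, ?_⟩, ?_⟩
  · exact fun w v => star_letterOp _
  · intro w v
    refine op_ext fun s t => ?_
    simp only [Matrix.of_apply, mul_apply_eq_comp, letterOp_wordVec, inner_wordVec]
    rw [haar_row_mul hp hP, if_pos rfl]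
  · intro w
    refine op_ext fun s t => ?_
    simp only [Matrix.of_apply, _root_.sum_apply, letterOp_wordVec, inner_wordVec, inner_sum,
      one_apply_eq_self]
    exact haar_row_sum hp hP _ _ _
  · intro v
    refine op_ext fun s t => ?_
    simp only [Matrix.of_apply, _root_.sum_apply, letterOp_wordVec, inner_wordVec, inner_sum,
      one_apply_eq_self]
    exact haar_col_sum hp hP _ _ _
  · intro w v v' hv
    refine op_ext fun s t => ?_
    simp only [Matrix.of_apply, mul_apply_eq_comp, letterOp_wordVec, inner_wordVec,
      _root_.zero_apply, inner_zero_right]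
    rw [haar_row_mul hp hP, if_neg hv]
  · intro w w' v hw
    refine op_ext fun s t => ?_
    simp only [Matrix.of_apply, mul_apply_eq_comp, letterOp_wordVec, inner_wordVec,
      _root_.zero_apply, inner_zero_right]
    rw [haar_col_mul hp hP, if_neg hw]
  · ext1 w v
    refine op_ext fun s t => ?_
    have := haar_adj hp hP R S h s.reverse t w v
    simp only [Matrix.mul_apply, Matrix.of_apply, Matrix.map_apply, _root_.sum_apply,
      mul_apply_eq_comp, Algebra.algebraMap_eq_smul_one, _root_.smul_apply,
      one_apply_eq_self, map_smul, letterOp_wordVec, inner_sum, inner_smul_right,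
      inner_wordVec]
    simpa only [mul_comm] using this

end Haar

/-! ### Magic intertwiners between graphs and their blocks between connected components. -/

section Intertwiners

open Matrix

variable {A : Type} [Ring A] [StarRing A] [Algebra ℂ A] [StarModule ℂ A]

theorem nsmul_left_cancel_of_ne_zero {p : A} (hp : p ≠ 0) {m n : ℕ} (h : m • p = n • p) : m = n := by
  rw [← Nat.cast_smul_eq_nsmul ℂ, ← Nat.cast_smul_eq_nsmul ℂ n] at h
  exact Nat.cast_injective (smul_left_injective ℂ hp h)

/-- Two finite sets of the same size up to a "magic" matching preserving the labels. -/
theorem exists_equiv_of_sum {ι κ Z : Type*} [Fintype ι] [Fintype κ] {p : A} (hp : p ≠ 0)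
    (q : κ → ι → A) (hrow : ∀ k, ∑ i, q k i = p) (hcol : ∀ i, ∑ k, q k i = p) (f : ι → Z) (g : κ → Z)
    (hfg : ∀ k i, q k i ≠ 0 → f i = g k) : ∃ σ : ι ≃ κ, ∀ i, g (σ i) = f i := by
  classical
  have hcard : ∀ z, Fintype.card {i // f i = z} = Fintype.card {k // g k = z} := by
    intro z
    -- Nonzero entries only join equal labels, so the block over `z` has all row and column sums
    -- equal to `p`. Summing it both ways gives two multiples of `p`, and the cardinalities agree
    -- because `p ≠ 0` in a complex vector space.
    have h1 : ∑ k with g k = z, ∑ i with f i = z, q k i = Fintype.card {k // g k = z} • p := by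
      rw [Fintype.card_subtype, ← Finset.sum_const]
      refine Finset.sum_congr rfl fun k hk => ?_
      rw [← hrow k]
      refine Finset.sum_subset (Finset.filter_subset _ _) fun i _ hi => ?_
      by_contra hne
      exact hi (by simpa using (hfg k i hne).trans (by simpa using hk))
    have h2 : ∑ i with f i = z, ∑ k with g k = z, q k i = Fintype.card {i // f i = z} • p := by
      rw [Fintype.card_subtype, ← Finset.sum_const]
      refine Finset.sum_congr rfl fun i hi => ?_
      rw [← hcol i]
      refine Finset.sum_subset (Finset.filter_subset _ _) fun k _ hk => ?_
      by_contra hne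
      exact hk (by simpa using (hfg k i hne).symm.trans (by simpa using hi))
    rw [Finset.sum_comm] at h1
    exact nsmul_left_cancel_of_ne_zero hp (h2.symm.trans h1)
  refine ⟨Equiv.ofFiberEquiv (f := f) (g := g) fun z => Fintype.equivOfCardEq (hcard z), fun i => ?_⟩
  exact Equiv.ofFiberEquiv_map _ i

theorem idem_eq_of_smul_eq {r c : A} (hr : r * r = r) (hc : c * c = c) {a b : ℕ} (ha : a ≠ 0)
    (hb : b ≠ 0) (h : b • r = a • c) : r = c := by
  rw [← Nat.cast_smul_eq_nsmul ℂ, ← Nat.cast_smul_eq_nsmul ℂ a] at h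
  have ha' : (a : ℂ) ≠ 0 := Nat.cast_ne_zero.2 ha
  have hb' : (b : ℂ) ≠ 0 := Nat.cast_ne_zero.2 hb
  have h1 : r = ((b : ℂ)⁻¹ * a) • c := by rw [mul_smul, ← h, inv_smul_smul₀ hb']
  set t : ℂ := (b : ℂ)⁻¹ * a with ht
  have ht0 : t ≠ 0 := mul_ne_zero (inv_ne_zero hb') ha'
  have h2 : (t * t) • c = t • c := by
    rw [h1, smul_mul_smul_comm, hc] at hr
    exact hr
  rw [mul_smul] at h2
  -- Idempotency of `r = t • c` gives `t² • c = t • c`; cancelling one factor `t` settles the matter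
  -- without asking whether `c` vanishes.
  have h3 := smul_right_injective A ht0 h2
  rw [h1, h3]

/-- A magic matrix with unit `p` which intertwines the adjacency matrices. -/
structure IsIntertwiner (p : A) (G H : FinGraph) (P : Matrix H.V G.V A) : Prop where
  magic : IsMagicOn p P
  comm : P * G.adj A = H.adj A * P

theorem adj_apply (G : FinGraph) (x y : G.V) [Decidable (G.graph.Adj x y)] :
    G.adj A x y = if G.graph.Adj x y then 1 else 0 := by
  simp only [FinGraph.adj, SimpleGraph.adjMatrix_apply]
  congr

theorem adj_eq_scalarMat (G : FinGraph) : G.adj A = scalarMat A (G.adj ℂ) := by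
  classical
  ext x y
  change G.adj A x y = algebraMap ℂ A (G.adj ℂ x y)
  rw [adj_apply, adj_apply]
  split_ifs <;> simp

theorem adj_symm (G : FinGraph) (x y : G.V) : G.adj A x y = G.adj A y x := by
  classical
  simp only [adj_apply, G.graph.adj_comm]

theorem adj_mul_comm (G : FinGraph) (x y : G.V) (a : A) : G.adj A x y * a = a * G.adj A x y := by
  classical
  rw [adj_apply]
  split_ifs <;> simp

namespace IsIntertwiner

variable {p : A} {G H : FinGraph} {P : Matrix H.V G.V A}

theorem transpose (h : IsIntertwiner p G H P) : IsIntertwiner p H G Pᵀ where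
  magic := h.magic.transpose
  comm := by
    ext y x
    have h1 := congrFun (congrFun h.comm x) y
    simp only [Matrix.mul_apply, Matrix.transpose_apply] at h1 ⊢
    simp only [adj_mul_comm G, adj_mul_comm H] at h1 ⊢
    simp only [adj_symm G y, adj_symm H _ x]
    exact h1.symm

/-- Multiply entry `(x, y')` of the commutation relation by `P x y` on the left and by `P x' y'` on
the right. The side of `G` has no term at `y` and dies; the side of `H` leaves only the term at
`x'`. -/
theorem mul_eq_zero (h : IsIntertwiner p G H P) {x x' : H.V} {y y' : G.V} (hx : H.graph.Adj x x')
    (hy : ¬ G.graph.Adj y y') : P x y * P x' y' = 0 := by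
  classical
  have h1 := congrFun (congrFun h.comm x) y'
  simp only [Matrix.mul_apply, adj_apply, mul_ite, mul_one, mul_zero, ite_mul, one_mul, zero_mul] at h1
  have h2 : P x y * ∑ z, (if G.graph.Adj z y' then P x z else 0) = 0 := by
    rw [Finset.mul_sum]
    refine Finset.sum_eq_zero fun z _ => ?_
    split_ifs with hz
    · exact h.magic.row_orth _ _ _ (fun e => hy (e ▸ hz))
    · simp
  have h3 : (∑ z, if H.graph.Adj x z then P z y' else 0) * P x' y' = P x' y' := by
    rw [Finset.sum_mul, Finset.sum_eq_single x']
    · rw [if_pos hx, h.magic.idem]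
    · intro z _ hz
      split_ifs
      · exact h.magic.col_orth _ _ _ hz
      · simp
    · simp
  rw [← h3, ← h1, ← mul_assoc, h2, zero_mul]

variable {ι κ : Type} [DecidableEq ι] [DecidableEq κ]

/-- The sum of the entries in a row, over a set of columns with a given label. -/
def _root_.QGraph.blockSum {I J : Type} [Fintype J] (P : Matrix I J A) (π : J → ι) (i : ι) (x : I) : A :=
  ∑ y with π y = i, P x y

theorem _root_.QGraph.IsMagicOn.mul_blockSum {I J : Type} [Fintype I] [Fintype J] {P : Matrix I J A}
    (h : IsMagicOn p P) (π : J → ι) (i : ι) (x : I) (y : J) :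
    P x y * blockSum P π i x = if π y = i then P x y else 0 := by
  classical
  rw [blockSum, Finset.mul_sum]
  split_ifs with hy
  · rw [Finset.sum_eq_single y, h.idem]
    · exact fun z _ hz => h.row_orth _ _ _ hz.symm
    · intro hn
      exact absurd hy (by simpa using hn)
  · refine Finset.sum_eq_zero fun z hz => h.row_orth _ _ _ ?_
    rintro rfl
    exact hy (by simpa using hz)

theorem _root_.QGraph.IsMagicOn.blockSum_mul {I J : Type} [Fintype I] [Fintype J] {P : Matrix I J A}
    (h : IsMagicOn p P) (π : J → ι) (i : ι) (x : I) (y : J) :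
    blockSum P π i x * P x y = if π y = i then P x y else 0 := by
  classical
  rw [blockSum, Finset.sum_mul]
  split_ifs with hy
  · rw [Finset.sum_eq_single y, h.idem]
    · exact fun z _ hz => h.row_orth _ _ _ hz
    · intro hn
      exact absurd hy (by simpa using hn)
  · refine Finset.sum_eq_zero fun z hz => h.row_orth _ _ _ ?_
    rintro rfl
    exact hy (by simpa using hz)

theorem _root_.QGraph.IsMagicOn.blockSum_mul_blockSum {I J : Type} [Fintype I] [Fintype J]
    {P : Matrix I J A} (h : IsMagicOn p P) (π : J → ι) (i j : ι) (x : I) :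
    blockSum P π i x * blockSum P π j x = if i = j then blockSum P π i x else 0 := by
  conv_lhs => rw [blockSum, Finset.sum_mul]
  simp only [h.mul_blockSum]
  split_ifs with hij
  · subst hij
    exact Finset.sum_congr rfl fun y hy => if_pos (by simpa using hy)
  · refine Finset.sum_eq_zero fun y hy => if_neg ?_
    rintro rfl
    exact hij (Finset.mem_filter.1 hy).2.symm

theorem _root_.QGraph.IsMagicOn.star_blockSum {I J : Type} [Fintype I] [Fintype J]
    {P : Matrix I J A} (h : IsMagicOn p P) (π : J → ι) (i : ι) (x : I) :
    star (blockSum P π i x) = blockSum P π i x := by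
  rw [blockSum, star_sum]
  exact Finset.sum_congr rfl fun y _ => h.star_eq _ _

theorem _root_.QGraph.IsMagicOn.sum_blockSum {I J : Type} [Fintype I] [Fintype J] [Fintype ι]
    {P : Matrix I J A} (h : IsMagicOn p P) (π : J → ι) (x : I) :
    ∑ i, blockSum P π i x = p := by
  rw [← h.row_sum x]
  exact Finset.sum_fiberwise _ _ _

/-- For adjacent rows, block sums with different labels are orthogonal by `mul_eq_zero`. As each
family sums to `p`, both block sums equal their product. -/
theorem blockSum_adj [Fintype ι] (h : IsIntertwiner p G H P) {π : G.V → ι}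
    (hπ : ∀ y y', G.graph.Adj y y' → π y = π y') {x x' : H.V} (hx : H.graph.Adj x x') (i : ι) :
    blockSum P π i x = blockSum P π i x' := by
  have h1 : ∀ (x x' : H.V), H.graph.Adj x x' → ∀ i j, i ≠ j →
      blockSum P π i x * blockSum P π j x' = 0 := by
    intro x x' hx i j hij
    rw [blockSum, blockSum, Finset.sum_mul_sum]
    refine Finset.sum_eq_zero fun y hy => Finset.sum_eq_zero fun y' hy' => ?_
    refine h.mul_eq_zero hx fun hyy' => hij ?_
    rw [Finset.mem_filter] at hy hy'
    rw [← hy.2, ← hy'.2, hπ _ _ hyy']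
  have h2 : blockSum P π i x = blockSum P π i x * blockSum P π i x' := by
    have : blockSum P π i x * p = blockSum P π i x := by
      rw [blockSum, Finset.sum_mul]
      exact Finset.sum_congr rfl fun y _ => h.magic.mul_unit _ _
    rw [← this, ← h.magic.sum_blockSum π x', Finset.mul_sum, Finset.sum_eq_single i, mul_assoc,
      h.magic.blockSum_mul_blockSum, if_pos rfl]
    · exact fun j _ hj => h1 x x' hx i j hj.symm
    · simp
  have h3 : blockSum P π i x' = blockSum P π i x * blockSum P π i x' := by
    have : p * blockSum P π i x' = blockSum P π i x' := by
      rw [blockSum, Finset.mul_sum]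
      exact Finset.sum_congr rfl fun y _ => h.magic.unit_mul _ _
    rw [← this, ← h.magic.sum_blockSum π x, Finset.sum_mul, Finset.sum_eq_single i, ← mul_assoc,
      h.magic.blockSum_mul_blockSum, if_pos rfl]
    · exact fun j _ hj => h1 x x' hx j i hj
    · simp
  rw [h2, ← h3]

theorem blockSum_reachable [Fintype ι] (h : IsIntertwiner p G H P) {π : G.V → ι}
    (hπ : ∀ y y', G.graph.Adj y y' → π y = π y') {x x' : H.V} (hx : H.graph.Reachable x x') (i : ι) :
    blockSum P π i x = blockSum P π i x' := by
  rw [SimpleGraph.reachable_iff_reflTransGen] at hx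
  induction hx with
  | refl => rfl
  | tail _ hadj ih => rw [ih, h.blockSum_adj hπ hadj]

/-- The labels are those of the connected components. -/
def _root_.QGraph.IsLabelling (G : FinGraph) (π : G.V → ι) : Prop :=
  ∀ y y', π y = π y' ↔ G.graph.Reachable y y'

/-- Inside a block between two components the row sums are constant, and so are the column sums.
Adding all entries in both orders makes positive multiples of these two idempotents equal, hence the
idempotents themselves. -/
theorem blockSum_eq [Fintype ι] [Fintype κ] (h : IsIntertwiner p G H P) {π : G.V → ι}
    (hπ : IsLabelling G π) {ρ : H.V → κ} (hρ : IsLabelling H ρ) (x : H.V) (y : G.V) :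
    blockSum P π (π y) x = blockSum Pᵀ ρ (ρ x) y := by
  have h1 : ∀ x', ρ x' = ρ x → blockSum P π (π y) x' = blockSum P π (π y) x := fun x' hx' =>
    h.blockSum_reachable (fun y y' hy => (hπ y y').2 hy.reachable) ((hρ _ _).1 hx') _
  have h2 : ∀ y', π y' = π y → blockSum Pᵀ ρ (ρ x) y' = blockSum Pᵀ ρ (ρ x) y := fun y' hy' =>
    h.transpose.blockSum_reachable (fun x x' hx => (hρ x x').2 hx.reachable) ((hπ _ _).1 hy') _
  have h3 : ∑ x' with ρ x' = ρ x, blockSum P π (π y) x'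
      = ∑ y' with π y' = π y, blockSum Pᵀ ρ (ρ x) y' := Finset.sum_comm
  rw [Finset.sum_congr rfl fun x' hx' => h1 x' (by simpa using hx'),
    Finset.sum_congr rfl fun y' hy' => h2 y' (by simpa using hy'), Finset.sum_const,
    Finset.sum_const] at h3
  refine idem_eq_of_smul_eq ?_ ?_ ?_ ?_ h3
  · rw [h.magic.blockSum_mul_blockSum, if_pos rfl]
  · rw [h.transpose.magic.blockSum_mul_blockSum, if_pos rfl]
  · exact (Finset.card_pos.2 ⟨y, by simp⟩).ne'
  · exact (Finset.card_pos.2 ⟨x, by simp⟩).ne'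

theorem orth (h : IsIntertwiner p G H P) {x x' : H.V} {y y' : G.V}
    (hne : ¬ (H.graph.Adj x x' ↔ G.graph.Adj y y')) : P x y * P x' y' = 0 := by
  by_cases hx : H.graph.Adj x x'
  · exact h.mul_eq_zero hx fun hy => hne (iff_of_true hx hy)
  · by_cases hy : G.graph.Adj y y'
    · exact h.transpose.mul_eq_zero hy hx
    · exact absurd (iff_of_false hx hy) hne

/-- The converse of `orth`: both sides of the commutation relation expand into the sum of `P x y * P
x' y'` over `x' ~ x` and `y ~ y'`. In this form the condition passes easily to complements, blocks
and reindexings. -/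
theorem of_orth (hP : IsMagicOn p P)
    (h : ∀ x x' y y', ¬ (H.graph.Adj x x' ↔ G.graph.Adj y y') → P x y * P x' y' = 0) :
    IsIntertwiner p G H P where
  magic := hP
  comm := by
    classical
    refine Matrix.ext fun x y' => ?_
    simp only [Matrix.mul_apply, adj_apply, mul_ite, mul_one, mul_zero, ite_mul, one_mul, zero_mul,
      ← Finset.sum_filter]
    have h1 : ∀ y, G.graph.Adj y y' → P x y = ∑ x' with H.graph.Adj x x', P x y * P x' y' := by
      intro y hy
      rw [Finset.sum_filter_of_ne, ← Finset.mul_sum, hP.col_sum, hP.mul_unit]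
      intro x' _ hne
      by_contra hx
      exact hne (h _ _ _ _ fun e => hx (e.2 hy))
    have h2 : ∀ x', H.graph.Adj x x' → P x' y' = ∑ y with G.graph.Adj y y', P x y * P x' y' := by
      intro x' hx
      rw [Finset.sum_filter_of_ne, ← Finset.sum_mul, hP.row_sum, hP.unit_mul]
      intro y _ hne
      by_contra hy
      exact hne (h _ _ _ _ fun e => hy (e.1 hx))
    rw [Finset.sum_congr rfl fun y hy => h1 y (Finset.mem_filter.1 hy).2,
      Finset.sum_congr rfl fun x' hx' => h2 x' (Finset.mem_filter.1 hx').2]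
    exact Finset.sum_comm

theorem compl (h : IsIntertwiner p G H P) : IsIntertwiner p G.compl H.compl P := by
  refine of_orth h.magic fun x x' y y' hne => ?_
  replace hne : ¬ ((x ≠ x' ∧ ¬ H.graph.Adj x x') ↔ (y ≠ y' ∧ ¬ G.graph.Adj y y')) := hne
  by_cases hx : x = x'
  · subst hx
    by_cases hy : y = y'
    · exact absurd (by simp [hy]) hne
    · exact h.magic.row_orth _ _ _ hy
  · by_cases hy : y = y'
    · subst hy
      exact h.magic.col_orth _ _ _ hx
    · exact h.orth fun e => hne (by simp [hx, hy, e])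

theorem _root_.QGraph.isLabelling_connectedComponentMk (G : FinGraph) :
    IsLabelling G G.graph.connectedComponentMk := fun _ _ => SimpleGraph.ConnectedComponent.eq

theorem _root_.QGraph.blockSum_component {J : Type} (P : Matrix J G.V A)
    [DecidableEq G.graph.ConnectedComponent] (c : G.graph.ConnectedComponent) (x : J) :
    blockSum P G.graph.connectedComponentMk c x = ∑ y : (G.component c).V, P x y.1 := by
  rw [blockSum]
  exact Finset.sum_subtype _ (fun y => Finset.mem_filter.trans (and_iff_right (Finset.mem_univ y))) _

/-- The common row sum of the block, which is also its common column sum by `blockSum_eq`, becomes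
the new unit. It may be zero, in which case the block carries no information. -/
theorem component (h : IsIntertwiner p G H P) (c : G.graph.ConnectedComponent)
    (d : H.graph.ConnectedComponent) {x₀ : H.V} (hx₀ : x₀ ∈ d) :
    IsIntertwiner (∑ y : (G.component c).V, P x₀ y.1) (G.component c) (H.component d)
      (P.submatrix (Subtype.val : (H.component d).V → H.V) (Subtype.val : (G.component c).V → G.V)) := by
  classical
  let _ : Fintype G.graph.ConnectedComponent := Fintype.ofFinite _
  let _ : Fintype H.graph.ConnectedComponent := Fintype.ofFinite _
  have hrow : ∀ x : H.V, x ∈ d → ∑ y : (G.component c).V, P x y.1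
      = ∑ y : (G.component c).V, P x₀ y.1 := by
    intro x hx
    rw [← blockSum_component, ← blockSum_component]
    exact h.blockSum_reachable (fun y y' hy => SimpleGraph.ConnectedComponent.eq.2 hy.reachable)
      (SimpleGraph.ConnectedComponent.eq.1 (hx.trans hx₀.symm)) c
  refine of_orth ⟨fun x y => h.magic.star_eq _ _, fun x y => h.magic.idem _ _,
    fun x => hrow x.1 x.2, fun y => ?_,
    fun x y y' hne => h.magic.row_orth _ _ _ fun e => hne (Subtype.ext e),
    fun x x' y hne => h.magic.col_orth _ _ _ fun e => hne (Subtype.ext e)⟩ ?_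
  · have h1 := h.blockSum_eq (isLabelling_connectedComponentMk G)
      (isLabelling_connectedComponentMk H) x₀ y.1
    have hy : G.graph.connectedComponentMk y.1 = c := y.2
    have hx : H.graph.connectedComponentMk x₀ = d := hx₀
    rw [hy, hx, blockSum_component, blockSum_component] at h1
    exact h1.symm
  · exact fun x x' y y' hne => h.orth hne

theorem sum_component {J : Type} [Fintype J] [Fintype G.graph.ConnectedComponent] {P : Matrix J G.V A}
    (h : IsMagicOn p P) (x : J) :
    ∑ c : G.graph.ConnectedComponent, ∑ y : (G.component c).V, P x y.1 = p := by
  classical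
  rw [← h.sum_blockSum G.graph.connectedComponentMk x]
  exact Finset.sum_congr rfl fun c _ => (blockSum_component P c x).symm

/-- This is where a purely algebraic intertwiner becomes usable in (QI). The equality of the numbers
of vertices comes from counting with trivial labels. -/
theorem quantumIso (hp : p ≠ 0) (h : IsIntertwiner p G H P) : FinGraph.QuantumIso G H := by
  classical
  refine ⟨?_, ?_⟩
  · obtain ⟨σ, -⟩ := exists_equiv_of_sum hp P h.magic.row_sum h.magic.col_sum (fun _ => ())
      (fun _ => ()) (fun _ _ _ => rfl)
    exact Fintype.card_congr σ
  · have hc := h.comm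
    rw [adj_eq_scalarMat G, adj_eq_scalarMat H] at hc
    obtain ⟨B, i, j, Q, hQ, hQc⟩ := exists_cstarAlgebra hp h.magic _ _ hc
    refine ⟨B, i, j, Q, hQ, ?_⟩
    rwa [adj_eq_scalarMat G, adj_eq_scalarMat H]

/-- The components of `G` and `H` which are related by `P` correspond to each other. -/
theorem exists_equiv_component (hp : p ≠ 0) (h : IsIntertwiner p G H P) {Z : Type*}
    (f : G.graph.ConnectedComponent → Z) (g : H.graph.ConnectedComponent → Z)
    (hfg : ∀ c d (q : A) (Q : Matrix (H.component d).V (G.component c).V A), q ≠ 0 →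
      IsIntertwiner q (G.component c) (H.component d) Q → f c = g d) :
    ∃ σ : G.graph.ConnectedComponent ≃ H.graph.ConnectedComponent, ∀ c, g (σ c) = f c := by
  classical
  let _ : Fintype G.graph.ConnectedComponent := Fintype.ofFinite _
  let _ : Fintype H.graph.ConnectedComponent := Fintype.ofFinite _
  have hd : ∀ d : H.graph.ConnectedComponent, d.out ∈ d := fun d => d.out_eq
  have hc : ∀ c : G.graph.ConnectedComponent, c.out ∈ c := fun c => c.out_eq
  -- The units of the blocks form a matrix whose rows and columns sum to `p`; a nonzero entry is
  -- exactly a block to which `hfg` applies. The representative `d.out` is immaterial, as row sums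
  -- are constant on the block.
  refine exists_equiv_of_sum hp (fun d c => ∑ y : (G.component c).V, P d.out y.1)
    (fun d => sum_component h.magic _) (fun c => ?_) f g
    fun d c hne => hfg c d _ _ hne (h.component c d (hd d))
  rw [← sum_component h.transpose.magic c.out]
  refine Finset.sum_congr rfl fun d _ => ?_
  have h1 := h.blockSum_eq (isLabelling_connectedComponentMk G)
      (isLabelling_connectedComponentMk H) d.out c.out
  rw [hc c, hd d, blockSum_component, blockSum_component] at h1
  exact h1

end IsIntertwiner

end Intertwiners

/-! ### Complements, disjoint unions and connected components of finite graphs. -/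

namespace FinGraph

/-- The complements of isomorphic graphs are isomorphic. -/
def complIso {V W : Type} {G : SimpleGraph V} {H : SimpleGraph W} (e : G ≃g H) : Gᶜ ≃g Hᶜ where
  toEquiv := e.toEquiv
  map_rel_iff' {x y} := by
    have h : H.Adj (e x) (e y) ↔ G.Adj x y := e.map_rel_iff
    change (e x ≠ e y ∧ ¬ H.Adj (e x) (e y)) ↔ (x ≠ y ∧ ¬ G.Adj x y)
    rw [h, e.injective.ne_iff]

theorem compl_compl (G : FinGraph) : G.compl.compl = G := by
  obtain ⟨V, Γ⟩ := G
  change FinGraph.mk V Γᶜᶜ = FinGraph.mk V Γ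
  rw [_root_.compl_compl]

theorem nonempty_iso_of_compl {G H : FinGraph} (h : Nonempty (G.compl.graph ≃g H.compl.graph)) :
    Nonempty (G.graph ≃g H.graph) := by
  obtain ⟨e⟩ := h
  have := complIso e
  change (G.compl.compl).graph ≃g (H.compl.compl).graph at this
  rw [compl_compl, compl_compl] at this
  exact ⟨this⟩

/-- The disjoint union of a family of graphs. -/
def sigma {ι : Type} [Fintype ι] [Nonempty ι] (K : ι → FinGraph) : FinGraph where
  V := Σ i, (K i).V
  nonempty := ⟨⟨Classical.arbitrary ι, Classical.arbitrary _⟩⟩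
  graph :=
    { Adj := fun a b => ∃ i x y, (K i).graph.Adj x y ∧ a = ⟨i, x⟩ ∧ b = ⟨i, y⟩
      symm := ⟨fun a b ⟨i, x, y, h, ha, hb⟩ => ⟨i, y, x, h.symm, hb, ha⟩⟩
      loopless := ⟨by
        rintro a ⟨i, x, y, h, rfl, hb⟩
        simp only [Sigma.mk.injEq, heq_eq_eq, true_and] at hb
        exact h.ne hb⟩ }

section Sigma

variable {ι κ : Type} [Fintype ι] [Nonempty ι] [Fintype κ] [Nonempty κ] {K : ι → FinGraph}
  {L : κ → FinGraph}

@[simp] theorem sigma_adj {i : ι} {x y : (K i).V} :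
    (sigma K).graph.Adj ⟨i, x⟩ ⟨i, y⟩ ↔ (K i).graph.Adj x y := by
  refine ⟨?_, fun h => ⟨i, x, y, h, rfl, rfl⟩⟩
  rintro ⟨j, x', y', h, h1, h2⟩
  obtain ⟨rfl, h1⟩ := Sigma.mk.inj_iff.1 h1
  obtain ⟨-, h2⟩ := Sigma.mk.inj_iff.1 h2
  rwa [eq_of_heq h1, eq_of_heq h2]

theorem fst_eq_of_sigma_adj {a b : (sigma K).V} (h : (sigma K).graph.Adj a b) : a.1 = b.1 := by
  obtain ⟨i, x, y, -, rfl, rfl⟩ := h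
  rfl

/-- Disjoint unions of isomorphic graphs are isomorphic. -/
def sigmaCongr (σ : ι ≃ κ) (e : ∀ i, (K i).graph ≃g (L (σ i)).graph) :
    (sigma K).graph ≃g (sigma L).graph where
  toEquiv := Equiv.sigmaCongr σ fun i => (e i).toEquiv
  map_rel_iff' := by
    rintro ⟨i, x⟩ ⟨j, y⟩
    change (sigma L).graph.Adj ⟨σ i, e i x⟩ ⟨σ j, e j y⟩ ↔ _
    by_cases h : i = j
    · subst h
      rw [sigma_adj, sigma_adj, (e i).map_adj_iff]
    · exact iff_of_false (fun h' => h (σ.injective (fst_eq_of_sigma_adj h')))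
        (fun h' => h (fst_eq_of_sigma_adj h'))

/-- A disjoint union indexed by a sum of types. -/
def sigmaSum (M : ι ⊕ κ → FinGraph) : (sigma M).graph ≃g
    ((sigma fun i => M (Sum.inl i)).sum (sigma fun k => M (Sum.inr k))).graph where
  toEquiv := Equiv.sumSigmaDistrib fun s => (M s).V
  map_rel_iff' := by
    rintro ⟨i | i, x⟩ ⟨j | j, y⟩
    · change (sigma fun i => M (Sum.inl i)).graph.Adj ⟨i, x⟩ ⟨j, y⟩ ↔ _
      by_cases h : i = j
      · subst h
        exact sigma_adj.trans (sigma_adj (K := M)).symm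
      · exact iff_of_false (fun h' => h (fst_eq_of_sigma_adj h'))
          (fun h' => h (Sum.inl_injective (fst_eq_of_sigma_adj h')))
    · exact iff_of_false (by rintro ⟨⟩) (fun h' => by cases fst_eq_of_sigma_adj h')
    · exact iff_of_false (by rintro ⟨⟩) (fun h' => by cases fst_eq_of_sigma_adj h')
    · change (sigma fun i => M (Sum.inr i)).graph.Adj ⟨i, x⟩ ⟨j, y⟩ ↔ _
      by_cases h : i = j
      · subst h
        exact sigma_adj.trans (sigma_adj (K := M)).symm
      · exact iff_of_false (fun h' => h (fst_eq_of_sigma_adj h'))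
          (fun h' => h (Sum.inr_injective (fst_eq_of_sigma_adj h')))

/-- A disjoint union of a single graph. -/
def sigmaUnique [Unique ι] (K : ι → FinGraph) : (sigma K).graph ≃g (K default).graph where
  toEquiv := Equiv.uniqueSigma fun i => (K i).V
  map_rel_iff' := by
    rintro ⟨i, x⟩ ⟨j, y⟩
    obtain rfl := Subsingleton.elim i default
    obtain rfl := Subsingleton.elim j default
    exact sigma_adj.symm

end Sigma

/-- The type of connected components of a finite graph is finite. -/
instance (G : FinGraph) : Fintype G.graph.ConnectedComponent := Fintype.ofFinite _

/-- A graph is the disjoint union of its connected components. -/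
def sigmaComponent (G : FinGraph) : (sigma G.component).graph ≃g G.graph where
  toFun a := a.2.1
  invFun x := ⟨G.graph.connectedComponentMk x, x, rfl⟩
  left_inv := by
    rintro ⟨c, x, hx⟩
    change G.graph.connectedComponentMk x = c at hx
    subst hx
    rfl
  right_inv _ := rfl
  map_rel_iff' := by
    rintro ⟨c, x, hx⟩ ⟨d, y, hy⟩
    change G.graph.connectedComponentMk x = c at hx
    change G.graph.connectedComponentMk y = d at hy
    by_cases h : c = d
    · subst h
      exact (sigma_adj (K := G.component) (i := c) (x := ⟨x, hx⟩) (y := ⟨y, hy⟩)).symm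
    · refine iff_of_false (fun h' => h ?_) (fun h' => h (fst_eq_of_sigma_adj h'))
      rw [← hx, ← hy]
      exact SimpleGraph.ConnectedComponent.eq.2 h'.reachable

theorem nonempty_iso_of_component {G H : FinGraph}
    (σ : G.graph.ConnectedComponent ≃ H.graph.ConnectedComponent)
    (h : ∀ c, Nonempty ((G.component c).graph ≃g (H.component (σ c)).graph)) :
    Nonempty (G.graph ≃g H.graph) :=
  ⟨(sigmaComponent G).symm.trans ((sigmaCongr σ fun c => (h c).some).trans (sigmaComponent H))⟩

/-- An embedding onto a union of components induces isomorphisms of components. -/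
theorem nonempty_component_iso {G H : FinGraph} (f : G.graph ↪g H.graph)
    (hf : ∀ x y, H.graph.Adj (f x) y → ∃ z, f z = y) (x : G.V) :
    Nonempty ((G.component (G.graph.connectedComponentMk x)).graph ≃g
      (H.component (H.graph.connectedComponentMk (f x))).graph) := by
  have key : ∀ y, H.graph.Reachable (f x) y → ∃ z, f z = y ∧ G.graph.Reachable x z := by
    intro y hy
    rw [SimpleGraph.reachable_iff_reflTransGen] at hy
    induction hy with
    | refl => exact ⟨x, rfl, SimpleGraph.Reachable.refl _⟩
    | tail _ hadj ih =>
      obtain ⟨z, rfl, hz⟩ := ih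
      obtain ⟨w, rfl⟩ := hf _ _ hadj
      exact ⟨w, rfl, hz.trans (f.map_adj_iff.1 hadj).reachable⟩
  let g : (G.component (G.graph.connectedComponentMk x)).V →
      (H.component (H.graph.connectedComponentMk (f x))).V := fun z =>
    ⟨f z.1, SimpleGraph.ConnectedComponent.eq.2
      ((SimpleGraph.ConnectedComponent.eq.1 z.2).map f.toHom)⟩
  have hg : Function.Bijective g := by
    refine ⟨fun z w h => Subtype.ext (f.injective (congrArg Subtype.val h)), fun y => ?_⟩
    obtain ⟨z, hz, hxz⟩ := key y.1 (SimpleGraph.ConnectedComponent.eq.1 y.2).symm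
    exact ⟨⟨z, SimpleGraph.ConnectedComponent.eq.2 hxz.symm⟩, Subtype.ext hz⟩
  exact ⟨⟨Equiv.ofBijective g hg, f.map_adj_iff⟩⟩

theorem component_sum_inl (G H : FinGraph) (x : G.V) :
    Nonempty ((G.component (G.graph.connectedComponentMk x)).graph ≃g
      ((G.sum H).component ((G.sum H).graph.connectedComponentMk (Sum.inl x))).graph) := by
  refine nonempty_component_iso (H := G.sum H) SimpleGraph.Embedding.sumInl ?_ x
  rintro y (z | z) hz
  · exact ⟨z, rfl⟩
  · cases hz

theorem component_sum_inr (G H : FinGraph) (x : H.V) :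
    Nonempty ((H.component (H.graph.connectedComponentMk x)).graph ≃g
      ((G.sum H).component ((G.sum H).graph.connectedComponentMk (Sum.inr x))).graph) := by
  refine nonempty_component_iso (H := G.sum H) SimpleGraph.Embedding.sumInr ?_ x
  rintro y (z | z) hz
  · cases hz
  · exact ⟨z, rfl⟩

theorem nonempty_component_iso_self {G : FinGraph} (hG : G.graph.Connected)
    (c : G.graph.ConnectedComponent) : Nonempty ((G.component c).graph ≃g G.graph) := by
  have hc : ∀ x, x ∈ c := fun x => by
    obtain ⟨y, rfl⟩ := c.exists_rep
    exact SimpleGraph.ConnectedComponent.eq.2 (hG.preconnected x y)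
  exact ⟨⟨Equiv.subtypeUnivEquiv hc, Iff.rfl⟩⟩

theorem component_connected (G : FinGraph) (c : G.graph.ConnectedComponent) :
    (G.component c).graph.Connected := c.connected_toSimpleGraph

theorem card_component_lt {G : FinGraph} (hG : ¬ G.graph.Connected)
    (c : G.graph.ConnectedComponent) : Fintype.card (G.component c).V < Fintype.card G.V := by
  obtain ⟨x, hx⟩ : ∃ x, x ∉ c := by
    by_contra! h
    refine hG ⟨fun x y => ?_⟩
    exact SimpleGraph.ConnectedComponent.eq.1
      ((show G.graph.connectedComponentMk x = c from h x).trans (h y).symm)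
  exact Fintype.card_lt_of_injective_of_notMem (Subtype.val : (G.component c).V → G.V)
    Subtype.val_injective (b := x) (by rintro ⟨y, rfl⟩; exact hx y.2)

end FinGraph

/-! ### The structure of `F`-cographs, and their rigidity. -/

namespace GraphClass

open FinGraph

variable {F : GraphClass}

theorem mem_of_iso {F : GraphClass} {G H : FinGraph} (e : Nonempty (G.graph ≃g H.graph))
    (h : ⟦G⟧ ∈ F) : ⟦H⟧ ∈ F := by
  rwa [← Quotient.sound (s := FinGraph.setoid) e]

theorem subset_co : F ⊆ F.co := Set.subset_sInter fun _ hS => hS.1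

theorem co_closedSum : F.co.ClosedSum := fun G H hG hH S hS =>
  hS.2.1 G H (hG S hS) (hH S hS)

theorem co_closedCompl : F.co.ClosedCompl := fun G hG S hS => hS.2.2 G (hG S hS)

theorem ClosedSum.sigma (hF : F.ClosedSum) {ι : Type} [Fintype ι] [Nonempty ι] (K : ι → FinGraph)
    (h : ∀ i, ⟦K i⟧ ∈ F) : ⟦FinGraph.sigma K⟧ ∈ F := by
  have key : ∀ (n : ℕ) (K : Fin (n + 1) → FinGraph), (∀ i, ⟦K i⟧ ∈ F) → ⟦FinGraph.sigma K⟧ ∈ F := by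
    intro n
    induction n with
    | zero => 
      let _ : Unique (Fin (0 + 1)) := inferInstanceAs (Unique (Fin 1))
      exact fun K h => mem_of_iso ⟨(sigmaUnique K).symm⟩ (h _)
    | succ n ih =>
      intro K h
      let e : Fin (n + 1) ⊕ Fin 1 ≃ Fin (n + 1 + 1) := finSumFinEquiv
      refine mem_of_iso ⟨(sigmaSum fun s => K (e s)).symm.trans
        (sigmaCongr e fun _ => SimpleGraph.Iso.refl)⟩ (hF _ _ (ih _ fun i => h _) ?_)
      exact mem_of_iso ⟨(sigmaUnique _).symm⟩ (h _)
  obtain ⟨n, hn⟩ := Nat.exists_eq_succ_of_ne_zero (Fintype.card_ne_zero (α := ι))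
  let e : Fin (n + 1) ≃ ι := (Fintype.equivFinOfCardEq hn).symm
  exact mem_of_iso ⟨sigmaCongr e fun _ => SimpleGraph.Iso.refl⟩ (key n (fun i => K (e i)) fun i => h _)

/-- The decomposition of the graphs in `co F`. -/
structure IsCograph (F : GraphClass) (G : FinGraph) : Prop where
  mem : ⟦G⟧ ∈ F.co
  component_mem : ∀ x, ⟦G.component (G.graph.connectedComponentMk x)⟧ ∈ F.co
  compl_component_mem : ∀ x, ⟦G.compl.component (G.compl.graph.connectedComponentMk x)⟧ ∈ F.co
  base : G.graph.Connected → G.compl.graph.Connected → ⟦G⟧ ∈ F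

theorem component_mem_of_iso {S : GraphClass} {G H : FinGraph} (e : G.graph ≃g H.graph)
    (h : ∀ x, ⟦G.component (G.graph.connectedComponentMk x)⟧ ∈ S) (x : H.V) :
    ⟦H.component (H.graph.connectedComponentMk x)⟧ ∈ S := by
  obtain ⟨y, rfl⟩ := e.surjective x
  exact mem_of_iso (nonempty_component_iso e.toEmbedding (fun _ z _ => e.surjective z) y) (h y)

theorem IsCograph.of_iso {G H : FinGraph} (e : G.graph ≃g H.graph) (h : IsCograph F G) :
    IsCograph F H where
  mem := mem_of_iso ⟨e⟩ h.mem
  component_mem := component_mem_of_iso e h.component_mem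
  compl_component_mem := component_mem_of_iso (G := G.compl) (H := H.compl) (complIso e)
    h.compl_component_mem
  base h1 h2 := mem_of_iso ⟨e⟩ (h.base (e.connected_iff.2 h1) ((complIso e).connected_iff.2 h2))

/-- By minimality of `co F`, it suffices that these conditions hold on `F` and survive sums and
complements. They are symmetric under complements; a sum is disconnected, so `base` is vacuous for
it, and its complement is connected, hence its own only component. -/
theorem isCograph (hcompl : F.ClosedCompl) (hcomponent : F.ClosedComponent) {G : FinGraph}
    (hG : ⟦G⟧ ∈ F.co) : IsCograph F G := by
  have h := hG {x | ∃ G : FinGraph, ⟦G⟧ = x ∧ IsCograph F G} ⟨?_, ?_, ?_⟩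
  · obtain ⟨G', hG', h⟩ := h
    exact h.of_iso (Quotient.exact hG').some
  · intro x hx
    obtain ⟨G, rfl⟩ := Quotient.exists_rep x
    exact ⟨G, rfl, subset_co hx, fun x => subset_co (hcomponent G hx _),
      fun x => subset_co (hcomponent _ (hcompl G hx) _), fun _ _ => hx⟩
  · rintro G H ⟨G', hG', h⟩ ⟨H', hH', h'⟩
    replace h := h.of_iso (Quotient.exact hG').some
    replace h' := h'.of_iso (Quotient.exact hH').some
    have hmem := co_closedSum G H h.mem h'.mem
    have hnot : ¬ (G.sum H).graph.Connected := SimpleGraph.not_connected_sum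
    refine ⟨G.sum H, rfl, hmem, ?_, fun x => ?_, fun hc => absurd hc hnot⟩
    · rintro (x | x)
      · exact mem_of_iso (component_sum_inl G H x) (h.component_mem x)
      · exact mem_of_iso (component_sum_inr G H x) (h'.component_mem x)
    · have hconn := (SimpleGraph.connected_or_connected_compl (G := (G.sum H).graph)).resolve_left hnot
      obtain ⟨e⟩ := nonempty_component_iso_self (G := (G.sum H).compl) hconn
        ((G.sum H).compl.graph.connectedComponentMk x)
      exact mem_of_iso ⟨e.symm⟩ (co_closedCompl _ hmem)
  · rintro G ⟨G', hG', h⟩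
    replace h := h.of_iso (Quotient.exact hG').some
    refine ⟨G.compl, rfl, co_closedCompl _ h.mem, h.compl_component_mem, ?_, fun h1 h2 => ?_⟩
    · rw [compl_compl]
      exact h.component_mem
    · rw [compl_compl] at h2
      exact hcompl G (h.base h2 h1)

theorem co_closedComponent (hcompl : F.ClosedCompl) (hcomponent : F.ClosedComponent) :
    F.co.ClosedComponent := by
  intro G hG c
  obtain ⟨x, rfl⟩ := c.exists_rep
  exact (isCograph hcompl hcomponent hG).component_mem x

section Rigidity

variable {A : Type} [Ring A] [StarRing A] [Algebra ℂ A] [StarModule ℂ A]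

/-- Two `F`-cographs related by a nonzero magic intertwiner are isomorphic. -/
theorem nonempty_iso_of_isIntertwiner (hQI : F.QI) (hcompl : F.ClosedCompl)
    (hcomponent : F.ClosedComponent) {G H : FinGraph} (hG : ⟦G⟧ ∈ F.co) (hH : ⟦H⟧ ∈ F.co) {p : A}
    (hp : p ≠ 0) {P : Matrix H.V G.V A} (h : IsIntertwiner p G H P) :
    Nonempty (G.graph ≃g H.graph) := by
  induction hn : Fintype.card G.V using Nat.strong_induction_on generalizing G H p with
  | _ n ih =>
  subst hn
  -- The disconnected case, for any graph of the size of `G` so that it also covers `G.compl`.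
  -- Components are labelled by isomorphism class: by induction, nonzero blocks join only equal
  -- labels.
  have step : ∀ {G' H' : FinGraph} {P' : Matrix H'.V G'.V A}, ⟦G'⟧ ∈ F.co → ⟦H'⟧ ∈ F.co →
      Fintype.card G'.V = Fintype.card G.V → IsIntertwiner p G' H' P' → ¬ G'.graph.Connected →
      Nonempty (G'.graph ≃g H'.graph) := by
    intro G' H' P' hG' hH' hcard h' hconn
    obtain ⟨σ, hσ⟩ := h'.exists_equiv_component hp
      (fun c => (⟦G'.component c⟧ : Quotient FinGraph.setoid)) (fun d => ⟦H'.component d⟧)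
      fun c d q Q hq hQ => Quotient.sound (ih _ (hcard ▸ card_component_lt hconn c)
        (co_closedComponent hcompl hcomponent _ hG' c)
        (co_closedComponent hcompl hcomponent _ hH' d) hq hQ rfl)
    exact nonempty_iso_of_component σ fun c => Quotient.exact (hσ c).symm
  -- With trivial labels, the matching of components says that both graphs have the same number of
  -- them.
  have conn : ∀ {G' H' : FinGraph} {P' : Matrix H'.V G'.V A}, IsIntertwiner p G' H' P' →
      G'.graph.Connected → H'.graph.Connected := by
    intro G' H' P' h' hconn
    obtain ⟨σ, -⟩ := h'.exists_equiv_component hp (fun _ => ()) (fun _ => ()) fun _ _ _ _ _ _ => rfl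
    have := hconn.preconnected.subsingleton_connectedComponent
    have := σ.symm.subsingleton
    exact ⟨fun x y => SimpleGraph.ConnectedComponent.eq.1 (Subsingleton.elim _ _)⟩
  by_cases hc : G.graph.Connected
  · by_cases hc' : G.compl.graph.Connected
    · refine (hQI G H ((isCograph hcompl hcomponent hG).base hc hc')
        ((isCograph hcompl hcomponent hH).base (conn h hc) (conn h.compl hc'))).1 (h.quantumIso hp)
    · exact nonempty_iso_of_compl (step (co_closedCompl _ hG) (co_closedCompl _ hH) rfl h.compl hc')
  · exact step hG hH rfl h hc

end Rigidity

end GraphClass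

/-! ### Universal properties, and the behaviour of `Qu` under complements and sums. -/

theorem isMagicOn_one_iff {I J A : Type} [Fintype I] [Fintype J] [Ring A] [StarRing A]
    [Algebra ℂ A] [StarModule ℂ A] {u : Matrix I J A} : IsMagicOn 1 u ↔ IsMagic u :=
  ⟨fun h => ⟨h.star_eq, h.idem, h.row_sum, h.col_sum, h.row_orth, h.col_orth⟩,
    fun h => ⟨h.star_eq, h.idem, h.row_sum, h.col_sum, h.row_orth, h.col_orth⟩⟩

namespace QuantumPermGroup

section

variable {B : Type} [Ring B] [StarRing B] [Algebra ℂ B] [StarModule ℂ B]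

theorem hom_ext {Γ : QuantumPermGroup} {f g : Γ.alg →⋆ₐ[ℂ] B}
    (h : ∀ i j, f (Γ.u i j) = g (Γ.u i j)) : f = g :=
  StarAlgHom.ext fun a => mem_of_generates Γ.generates (StarAlgHom.id ℂ Γ.alg)
    (StarAlgHom.equalizer f g) (fun i j => h i j) a

/-- Selfadjointness of `b` makes its commutant a `*`-subalgebra, so generators suffice. -/
theorem commute_of_generators {Γ : QuantumPermGroup} (f : Γ.alg →⋆ₐ[ℂ] B) {b : B} (hb : star b = b)
    (h : ∀ i j, Commute (f (Γ.u i j)) b) (a : Γ.alg) : Commute (f a) b := by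
  have := mem_of_generates Γ.generates f (StarSubalgebra.centralizer ℂ {b}) (fun i j => by
    rw [StarSubalgebra.mem_centralizer_iff]
    rintro _ rfl
    rw [hb]
    exact ⟨(h i j).eq.symm, (h i j).eq.symm⟩) a
  rw [StarSubalgebra.mem_centralizer_iff] at this
  exact (this b rfl).1.symm

end

theorem isomorphic_of_hom {Γ Λ : QuantumPermGroup} (f : Γ.alg →⋆ₐ[ℂ] Λ.alg) (g : Λ.alg →⋆ₐ[ℂ] Γ.alg)
    (hgf : ∀ i j, g (f (Γ.u i j)) = Γ.u i j) (hfg : ∀ i j, f (g (Λ.u i j)) = Λ.u i j)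
    (hf : ∀ i j, Λ.comul (f (Γ.u i j)) = ∑ k, f (Γ.u i k) ⊗ₜ[ℂ] f (Γ.u k j)) : Isomorphic Γ Λ := by
  have h1 : g.comp f = StarAlgHom.id ℂ _ := hom_ext hgf
  have h2 : f.comp g = StarAlgHom.id ℂ _ := hom_ext hfg
  have h3 : Λ.comul.comp f = (tensorMap f f).comp Γ.comul := hom_ext fun i j => by
    simp only [StarAlgHom.comp_apply, hf, Γ.comul_u, map_sum, tensorMap_tmul]
  refine ⟨StarAlgEquiv.ofStarAlgHom f g h1 h2, fun a => ?_⟩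
  exact DFunLike.congr_fun h3 a

theorem isomorphic_of_equiv {Γ Λ : QuantumPermGroup} (e : Γ.I ≃ Λ.I) (f : Γ.alg →⋆ₐ[ℂ] Λ.alg)
    (g : Λ.alg →⋆ₐ[ℂ] Γ.alg) (hf : ∀ i j, f (Γ.u i j) = Λ.u (e i) (e j))
    (hg : ∀ i j, g (Λ.u (e i) (e j)) = Γ.u i j) : Isomorphic Γ Λ := by
  refine isomorphic_of_hom f g (fun i j => by rw [hf, hg]) (fun i j => ?_) fun i j => ?_
  · obtain ⟨i, rfl⟩ := e.surjective i
    obtain ⟨j, rfl⟩ := e.surjective j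
    rw [hg, hf]
  · simp only [hf, Λ.comul_u]
    exact (Equiv.sum_comp e fun k => Λ.u (e i) k ⊗ₜ[ℂ] Λ.u k (e j)).symm

variable {B : Type} [Ring B] [StarRing B] [Algebra ℂ B] [StarModule ℂ B]

/-- The universal property of `S_n^+`. -/
def splusLift {n : ℕ} [NeZero n] (v : Matrix (Fin n) (Fin n) B) (hv : IsMagic v) :
    (Splus n).alg →⋆ₐ[ℂ] B :=
  Universal.lift (r := fun a b => MagicRel (Fin n) a b ∨ False) (fun x : Fin n × Fin n => v x.1 x.2)
    (by
      rintro a b (h | h)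
      · exact eval_magicRel hv h
      · exact h.elim)

@[simp] theorem splusLift_u {n : ℕ} [NeZero n] (v : Matrix (Fin n) (Fin n) B) (hv : IsMagic v)
    (i j : Fin n) : splusLift v hv (splusU n i j) = v i j :=
  Universal.lift_gen (r := fun a b => MagicRel (Fin n) a b ∨ False) _ _ (i, j)

end QuantumPermGroup

namespace FinGraph

open QuantumPermGroup

variable {B : Type} [Ring B] [StarRing B] [Algebra ℂ B] [StarModule ℂ B]

/-- The generating matrix of `Qu(G)`, indexed by the vertices. -/
def quU (G : FinGraph) : Matrix G.V G.V G.Qu.alg := G.Qu.u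

theorem quU_intertwiner (G : FinGraph) : IsIntertwiner 1 G G G.quU where
  magic := isMagicOn_one_iff.2 G.Qu.magic
  comm := by
    have h : ∀ a, StarPoly.eval (fun x : G.V × G.V => G.quU x.1 x.2) a
        = Universal.mk (fun a b => MagicRel G.V a b ∨ AdjRel G a b) a := by
      intro a
      have : (StarPoly.eval (fun x : G.V × G.V => G.quU x.1 x.2)).toAlgHom
          = (Universal.mk (fun a b => MagicRel G.V a b ∨ AdjRel G a b)).toAlgHom := by
        refine StarPoly.algHom_ext fun z => ?_
        change StarPoly.eval (fun x : G.V × G.V => G.quU x.1 x.2) _ = Universal.mk _ _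
        cases z with
        | inl x => exact StarPoly.eval_var _ x
        | inr x =>
          have hx : StarPoly.letter (Sum.inr x) = star (StarPoly.var x) := by
            rw [StarPoly.var, StarPoly.star_letter]; rfl
          rw [hx, map_star, map_star, StarPoly.eval_var]; rfl
      exact congrArg (fun f => f a) this
    refine Matrix.ext fun x y => ?_
    rw [← eval_mul_adj, ← eval_adj_mul, h, h]
    exact (Universal.mk_rel (Or.inr (AdjRel.comm x y))).symm

/-- The universal property of `Qu(G)`. -/
def quLift {G : FinGraph} (v : Matrix G.V G.V B) (hv : IsIntertwiner 1 G G v) : G.Qu.alg →⋆ₐ[ℂ] B :=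
  Universal.lift (r := fun a b => MagicRel G.V a b ∨ AdjRel G a b) (fun x : G.V × G.V => v x.1 x.2)
    (by
      rintro a b (h | h)
      · exact eval_magicRel (isMagicOn_one_iff.1 hv.magic) h
      · cases h with
        | comm x y => rw [eval_adj_mul, eval_mul_adj, hv.comm])

@[simp] theorem quLift_u {G : FinGraph} (v : Matrix G.V G.V B) (hv : IsIntertwiner 1 G G v)
    (x y : G.V) : quLift v hv (G.quU x y) = v x y :=
  Universal.lift_gen (r := fun a b => MagicRel G.V a b ∨ AdjRel G a b) _ _ (x, y)

end FinGraph

namespace IsIntertwiner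

variable {B : Type} [Ring B] [StarRing B] [Algebra ℂ B] [StarModule ℂ B] {p : B} {G H : FinGraph}

theorem of_compl {P : Matrix H.V G.V B} (h : IsIntertwiner p G.compl H.compl P) :
    IsIntertwiner p G H P := by
  refine of_orth h.magic fun x x' y y' hne => ?_
  by_cases hx : x = x'
  · subst hx
    by_cases hy : y = y'
    · exact absurd (by simp [hy]) hne
    · exact h.magic.row_orth _ _ _ hy
  · by_cases hy : y = y'
    · subst hy
      exact h.magic.col_orth _ _ _ hx
    · refine h.orth fun e => hne ?_
      replace e : (x ≠ x' ∧ ¬ H.graph.Adj x x') ↔ (y ≠ y' ∧ ¬ G.graph.Adj y y') := e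
      simpa [hx, hy, not_iff_not] using e

theorem reindex {u : Matrix H.V H.V B} (h : IsIntertwiner p H H u) (e : G.graph ≃g H.graph) :
    IsIntertwiner p G G (u.submatrix e e) := by
  refine of_orth ⟨fun x y => h.magic.star_eq _ _, fun x y => h.magic.idem _ _, fun x => ?_,
    fun y => ?_, fun x y y' hne => h.magic.row_orth _ _ _ (e.injective.ne hne),
    fun x x' y hne => h.magic.col_orth _ _ _ (e.injective.ne hne)⟩ fun x x' y y' hne => ?_
  · rw [← h.magic.row_sum (e x)]
    exact Equiv.sum_comp e.toEquiv fun y => u (e x) y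
  · rw [← h.magic.col_sum (e y)]
    exact Equiv.sum_comp e.toEquiv fun x => u x (e y)
  · refine h.orth fun e' => hne ?_
    rwa [e.map_adj_iff, e.map_adj_iff] at e'

end IsIntertwiner

namespace FinGraph

open QuantumPermGroup

theorem qu_isomorphic {G H : FinGraph} (e : G.graph ≃g H.graph) : Isomorphic G.Qu H.Qu :=
  isomorphic_of_equiv (Γ := G.Qu) (Λ := H.Qu) e.toEquiv (quLift _ (H.quU_intertwiner.reindex e))
    (quLift _ (G.quU_intertwiner.reindex e.symm)) (fun x y => quLift_u _ _ x y)
    (fun x y => (quLift_u _ _ (e x) (e y)).trans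
      (congrArg₂ G.quU (e.symm_apply_apply x) (e.symm_apply_apply y)))

/-- A magic matrix with unit `1` commutes with the adjacency matrix of `G` if and only if it does so
with that of the complement, so the two universal problems coincide. -/
theorem qu_compl (G : FinGraph) : Isomorphic G.compl.Qu G.Qu :=
  isomorphic_of_equiv (Γ := G.compl.Qu) (Λ := G.Qu) (Equiv.refl _)
    (quLift _ G.quU_intertwiner.compl) (quLift _ G.compl.quU_intertwiner.of_compl)
    (fun x y => quLift_u _ _ x y) (fun x y => quLift_u (G := G) _ _ x y)

/-- If no vertex of `G` is related to a vertex of `H`, then `Qu(G + H)` is a free product. -/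
theorem qu_sum (G H : FinGraph) (h1 : ∀ x y, (G.sum H).quU (Sum.inl x) (Sum.inr y) = 0)
    (h2 : ∀ x y, (G.sum H).quU (Sum.inr x) (Sum.inl y) = 0) :
    Isomorphic (G.sum H).Qu (freeProd G.Qu H.Qu) := by
  have hu := (G.sum H).quU_intertwiner
  have hf : IsIntertwiner 1 (G.sum H) (G.sum H) (freeProd G.Qu H.Qu).u := by
    refine IsIntertwiner.of_orth (isMagicOn_one_iff.2 (freeProd G.Qu H.Qu).magic) ?_
    have hl : ∀ x x' y y', ¬ (G.graph.Adj x x' ↔ G.graph.Adj y y') →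
        FreeProd.inl G.Qu.alg H.Qu.alg (G.quU x y) * FreeProd.inl G.Qu.alg H.Qu.alg (G.quU x' y') = 0 := by
      intro x x' y y' hne
      rw [← map_mul, G.quU_intertwiner.orth hne, map_zero]
    have hr : ∀ x x' y y', ¬ (H.graph.Adj x x' ↔ H.graph.Adj y y') →
        FreeProd.inr G.Qu.alg H.Qu.alg (H.quU x y) * FreeProd.inr G.Qu.alg H.Qu.alg (H.quU x' y') = 0 := by
      intro x x' y y' hne
      rw [← map_mul, H.quU_intertwiner.orth hne, map_zero]
    have hn1 : ∀ x y, ¬ (G.sum H).graph.Adj (Sum.inl x) (Sum.inr y) := fun _ _ => by rintro ⟨⟩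
    have hn2 : ∀ x y, ¬ (G.sum H).graph.Adj (Sum.inr x) (Sum.inl y) := fun _ _ => by rintro ⟨⟩
    have z1 : ∀ x y, (freeProd G.Qu H.Qu).u (Sum.inl x) (Sum.inr y) = 0 := fun _ _ => rfl
    have z2 : ∀ x y, (freeProd G.Qu H.Qu).u (Sum.inr x) (Sum.inl y) = 0 := fun _ _ => rfl
    -- Either some factor lies in an off-diagonal block and vanishes, or both entries lie in one
    -- diagonal block, or they lie in different ones; in the last case neither pair is an edge and
    -- `hne` fails.
    rintro (x | x) (x' | x') (y | y) (y' | y') hne <;>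
      first
      | exact hl _ _ _ _ hne
      | exact hr _ _ _ _ hne
      | exact absurd (iff_of_false (hn1 _ _) (hn1 _ _)) hne
      | exact absurd (iff_of_false (hn2 _ _) (hn2 _ _)) hne
      | exact (congrArg (· * _) (z1 _ _)).trans (zero_mul _)
      | exact (congrArg (· * _) (z2 _ _)).trans (zero_mul _)
      | exact (congrArg (_ * ·) (z1 _ _)).trans (mul_zero _)
      | exact (congrArg (_ * ·) (z2 _ _)).trans (mul_zero _)
  -- The vanishing of the off-diagonal blocks is what makes the rows and columns of the diagonal
  -- blocks sum to `1`.
  have hg1 : IsIntertwiner 1 G G ((G.sum H).quU.submatrix Sum.inl Sum.inl) := by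
    refine IsIntertwiner.of_orth ⟨fun x y => hu.magic.star_eq _ _, fun x y => hu.magic.idem _ _,
      fun x => ?_, fun y => ?_, fun x y y' hne => hu.magic.row_orth _ _ _ (Sum.inl_injective.ne hne),
      fun x x' y hne => hu.magic.col_orth _ _ _ (Sum.inl_injective.ne hne)⟩
      fun x x' y y' hne => hu.orth hne
    · rw [← hu.magic.row_sum (Sum.inl x)]
      refine Eq.trans ?_ (Fintype.sum_sum_type _).symm
      rw [Finset.sum_eq_zero (s := (Finset.univ : Finset H.V)) fun y _ => h1 x y, add_zero]
      rfl
    · rw [← hu.magic.col_sum (Sum.inl y)]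
      refine Eq.trans ?_ (Fintype.sum_sum_type _).symm
      rw [Finset.sum_eq_zero (s := (Finset.univ : Finset H.V)) fun x _ => h2 x y, add_zero]
      rfl
  have hg2 : IsIntertwiner 1 H H ((G.sum H).quU.submatrix Sum.inr Sum.inr) := by
    refine IsIntertwiner.of_orth ⟨fun x y => hu.magic.star_eq _ _, fun x y => hu.magic.idem _ _,
      fun x => ?_, fun y => ?_, fun x y y' hne => hu.magic.row_orth _ _ _ (Sum.inr_injective.ne hne),
      fun x x' y hne => hu.magic.col_orth _ _ _ (Sum.inr_injective.ne hne)⟩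
      fun x x' y y' hne => hu.orth hne
    · rw [← hu.magic.row_sum (Sum.inr x)]
      refine Eq.trans ?_ (Fintype.sum_sum_type _).symm
      rw [Finset.sum_eq_zero (s := (Finset.univ : Finset G.V)) fun y _ => h2 x y, zero_add]
      rfl
    · rw [← hu.magic.col_sum (Sum.inr y)]
      refine Eq.trans ?_ (Fintype.sum_sum_type _).symm
      rw [Finset.sum_eq_zero (s := (Finset.univ : Finset G.V)) fun x _ => h1 x y, zero_add]
      rfl
  refine isomorphic_of_equiv (Γ := (G.sum H).Qu) (Λ := freeProd G.Qu H.Qu) (Equiv.refl _)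
    (quLift _ hf) (FreeProd.lift (quLift _ hg1) (quLift _ hg2)) (fun x y => quLift_u _ _ x y) ?_
  rintro (x | x) (y | y)
  · exact (FreeProd.lift_inl _ _ _).trans (quLift_u _ _ x y)
  · exact (map_zero _).trans (h1 x y).symm
  · exact (map_zero _).trans (h2 x y).symm
  · exact (FreeProd.lift_inr _ _ _).trans (quLift_u _ _ x y)

end FinGraph

/-! ### Free and wreath products respect isomorphism. -/

theorem Universal.hom_ext {X B : Type} {r : StarPoly X → StarPoly X → Prop} [Ring B] [StarRing B]
    [Algebra ℂ B] [StarModule ℂ B] {f g : Universal r →⋆ₐ[ℂ] B}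
    (h : ∀ x, f (Universal.gen r x) = g (Universal.gen r x)) : f = g := by
  have : StarAlgebra.adjoin ℂ (Set.range (Universal.gen r)) ≤ StarAlgHom.equalizer f g := by
    rw [StarAlgebra.adjoin_le_iff]
    rintro _ ⟨x, rfl⟩
    exact h x
  rw [Universal.adjoin_gen] at this
  exact StarAlgHom.ext fun a => this (Set.mem_univ a)

section

variable {A B C : Type} [Ring A] [StarRing A] [Algebra ℂ A] [StarModule ℂ A]
  [Ring B] [StarRing B] [Algebra ℂ B] [StarModule ℂ B]
  [Ring C] [StarRing C] [Algebra ℂ C] [StarModule ℂ C]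

theorem tensorMap_tensorMap (f g : B →⋆ₐ[ℂ] C) (h k : A →⋆ₐ[ℂ] B) (x : A ⊗[ℂ] A) :
    tensorMap f g (tensorMap h k x) = tensorMap (f.comp h) (g.comp k) x := by
  induction x with
  | zero => simp
  | tmul a b => rfl
  | add x y hx hy => simp only [map_add, hx, hy]

theorem QuantumPermGroup.FreeProd.hom_ext {f g : FreeProd A B →⋆ₐ[ℂ] C}
    (h1 : ∀ a, f (FreeProd.inl A B a) = g (FreeProd.inl A B a))
    (h2 : ∀ b, f (FreeProd.inr A B b) = g (FreeProd.inr A B b)) : f = g := by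
  refine Universal.hom_ext ?_
  rintro (a | b)
  · exact h1 a
  · exact h2 b

theorem QuantumPermGroup.WreathAlg.hom_ext {Γ : QuantumPermGroup} {n : ℕ} [NeZero n]
    {f g : WreathAlg Γ n →⋆ₐ[ℂ] C}
    (h1 : ∀ i a, f (WreathAlg.nu Γ n i a) = g (WreathAlg.nu Γ n i a))
    (h2 : ∀ s, f (WreathAlg.sig Γ n s) = g (WreathAlg.sig Γ n s)) : f = g := by
  refine Universal.hom_ext ?_
  rintro (⟨i, a⟩ | s)
  · exact h1 i a
  · exact h2 s

end

namespace QuantumPermGroup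

theorem isomorphic_of_comul {Γ Λ : QuantumPermGroup} (f : Γ.alg →⋆ₐ[ℂ] Λ.alg)
    (g : Λ.alg →⋆ₐ[ℂ] Γ.alg) (hgf : g.comp f = StarAlgHom.id ℂ _) (hfg : f.comp g = StarAlgHom.id ℂ _)
    (hf : ∀ a, Λ.comul (f a) = tensorMap f f (Γ.comul a)) : Isomorphic Γ Λ :=
  ⟨StarAlgEquiv.ofStarAlgHom f g hgf hfg, hf⟩

/-- The comultiplication of a free product. -/
def comulFreeProd (Γ Λ : QuantumPermGroup) :
    FreeProd Γ.alg Λ.alg →⋆ₐ[ℂ] FreeProd Γ.alg Λ.alg ⊗[ℂ] FreeProd Γ.alg Λ.alg :=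
  FreeProd.lift
    ((tensorMap (FreeProd.inl Γ.alg Λ.alg) (FreeProd.inl Γ.alg Λ.alg)).comp Γ.comul)
    ((tensorMap (FreeProd.inr Γ.alg Λ.alg) (FreeProd.inr Γ.alg Λ.alg)).comp Λ.comul)

/-- Isomorphisms need not match the generating matrices, so the comultiplications are compared on
the whole embedded algebras rather than on matrix entries. The same applies to `wreath_congr`. -/
theorem freeProd_congr {Γ Γ' Λ Λ' : QuantumPermGroup} (h : Isomorphic Γ Γ') (h' : Isomorphic Λ Λ') :
    Isomorphic (freeProd Γ Λ) (freeProd Γ' Λ') := by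
  obtain ⟨e, he⟩ := h
  obtain ⟨e', he'⟩ := h'
  let f : FreeProd Γ.alg Λ.alg →⋆ₐ[ℂ] FreeProd Γ'.alg Λ'.alg :=
    FreeProd.lift ((FreeProd.inl Γ'.alg Λ'.alg).comp (e : Γ.alg →⋆ₐ[ℂ] Γ'.alg))
      ((FreeProd.inr Γ'.alg Λ'.alg).comp (e' : Λ.alg →⋆ₐ[ℂ] Λ'.alg))
  let g : FreeProd Γ'.alg Λ'.alg →⋆ₐ[ℂ] FreeProd Γ.alg Λ.alg :=
    FreeProd.lift ((FreeProd.inl Γ.alg Λ.alg).comp (e.symm : Γ'.alg →⋆ₐ[ℂ] Γ.alg))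
      ((FreeProd.inr Γ.alg Λ.alg).comp (e'.symm : Λ'.alg →⋆ₐ[ℂ] Λ.alg))
  have fl : ∀ a, f (FreeProd.inl Γ.alg Λ.alg a) = FreeProd.inl Γ'.alg Λ'.alg (e a) :=
    fun a => FreeProd.lift_inl _ _ a
  have fr : ∀ a, f (FreeProd.inr Γ.alg Λ.alg a) = FreeProd.inr Γ'.alg Λ'.alg (e' a) :=
    fun a => FreeProd.lift_inr _ _ a
  have gl : ∀ a, g (FreeProd.inl Γ'.alg Λ'.alg a) = FreeProd.inl Γ.alg Λ.alg (e.symm a) :=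
    fun a => FreeProd.lift_inl _ _ a
  have gr : ∀ a, g (FreeProd.inr Γ'.alg Λ'.alg a) = FreeProd.inr Γ.alg Λ.alg (e'.symm a) :=
    fun a => FreeProd.lift_inr _ _ a
  have hgf : g.comp f = StarAlgHom.id ℂ _ := FreeProd.hom_ext
    (fun a => by simp [fl, gl]) (fun a => by simp [fr, gr])
  have hfg : f.comp g = StarAlgHom.id ℂ _ := FreeProd.hom_ext
    (fun a => by simp [fl, gl]) (fun a => by simp [fr, gr])
  have hl : f.comp (FreeProd.inl Γ.alg Λ.alg)
      = (FreeProd.inl Γ'.alg Λ'.alg).comp (e : Γ.alg →⋆ₐ[ℂ] Γ'.alg) := StarAlgHom.ext fl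
  have hr : f.comp (FreeProd.inr Γ.alg Λ.alg)
      = (FreeProd.inr Γ'.alg Λ'.alg).comp (e' : Λ.alg →⋆ₐ[ℂ] Λ'.alg) := StarAlgHom.ext fr
  have hf : (comulFreeProd Γ' Λ').comp f = (tensorMap f f).comp (comulFreeProd Γ Λ) := by
    refine FreeProd.hom_ext (fun a => ?_) (fun b => ?_)
    · rw [StarAlgHom.comp_apply, StarAlgHom.comp_apply, fl, comulFreeProd, comulFreeProd,
        FreeProd.lift_inl, FreeProd.lift_inl, StarAlgHom.comp_apply, StarAlgHom.comp_apply, he,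
        tensorMap_tensorMap, tensorMap_tensorMap, hl]
    · rw [StarAlgHom.comp_apply, StarAlgHom.comp_apply, fr, comulFreeProd, comulFreeProd,
        FreeProd.lift_inr, FreeProd.lift_inr, StarAlgHom.comp_apply, StarAlgHom.comp_apply, he',
        tensorMap_tensorMap, tensorMap_tensorMap, hr]
  exact isomorphic_of_comul (Γ := freeProd Γ Λ) (Λ := freeProd Γ' Λ') f g hgf hfg
    fun a => DFunLike.congr_fun hf a

theorem wreath_congr {Γ Γ' : QuantumPermGroup} (n : ℕ) [NeZero n] (h : Isomorphic Γ Γ') :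
    Isomorphic (wreath Γ n) (wreath Γ' n) := by
  obtain ⟨e, he⟩ := h
  let f : WreathAlg Γ n →⋆ₐ[ℂ] WreathAlg Γ' n :=
    WreathAlg.lift (fun i => (WreathAlg.nu Γ' n i).comp (e : Γ.alg →⋆ₐ[ℂ] Γ'.alg))
      (WreathAlg.sig Γ' n) fun i j a => WreathAlg.comm Γ' n i j (e a)
  let g : WreathAlg Γ' n →⋆ₐ[ℂ] WreathAlg Γ n :=
    WreathAlg.lift (fun i => (WreathAlg.nu Γ n i).comp (e.symm : Γ'.alg →⋆ₐ[ℂ] Γ.alg))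
      (WreathAlg.sig Γ n) fun i j a => WreathAlg.comm Γ n i j (e.symm a)
  have fl : ∀ i a, f (WreathAlg.nu Γ n i a) = WreathAlg.nu Γ' n i (e a) :=
    fun i a => WreathAlg.lift_nu _ _ _ i a
  have fr : ∀ a, f (WreathAlg.sig Γ n a) = WreathAlg.sig Γ' n a :=
    fun a => WreathAlg.lift_sig _ _ _ a
  have gl : ∀ i a, g (WreathAlg.nu Γ' n i a) = WreathAlg.nu Γ n i (e.symm a) :=
    fun i a => WreathAlg.lift_nu _ _ _ i a
  have gr : ∀ a, g (WreathAlg.sig Γ' n a) = WreathAlg.sig Γ n a :=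
    fun a => WreathAlg.lift_sig _ _ _ a
  have hgf : g.comp f = StarAlgHom.id ℂ _ := WreathAlg.hom_ext
    (fun i a => by simp [fl, gl]) (fun a => by simp [fr, gr])
  have hfg : f.comp g = StarAlgHom.id ℂ _ := WreathAlg.hom_ext
    (fun i a => by simp [fl, gl]) (fun a => by simp [fr, gr])
  have hl : ∀ i, f.comp (WreathAlg.nu Γ n i)
      = (WreathAlg.nu Γ' n i).comp (e : Γ.alg →⋆ₐ[ℂ] Γ'.alg) := fun i => StarAlgHom.ext (fl i)
  have hr : f.comp (WreathAlg.sig Γ n) = WreathAlg.sig Γ' n := StarAlgHom.ext fr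
  have hf : (WreathAlg.comul Γ' n).comp f = (tensorMap f f).comp (WreathAlg.comul Γ n) := by
    refine WreathAlg.hom_ext (fun i a => ?_) (fun b => ?_)
    · rw [StarAlgHom.comp_apply, StarAlgHom.comp_apply, fl, WreathAlg.comul, WreathAlg.comul,
        WreathAlg.lift_nu, WreathAlg.lift_nu, WreathAlg.comulNu_apply, WreathAlg.comulNu_apply, he,
        map_sum]
      refine Finset.sum_congr rfl fun t _ => ?_
      rw [map_mul, tensorMap_tensorMap, tensorMap_tensorMap, hl, hl, tensorMap_tmul, map_one]
      exact congrArg (fun z => _ * z ⊗ₜ[ℂ] 1) (fr _).symm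
    · rw [StarAlgHom.comp_apply, StarAlgHom.comp_apply, fr, WreathAlg.comul, WreathAlg.comul,
        WreathAlg.lift_sig, WreathAlg.lift_sig, WreathAlg.comulSig, WreathAlg.comulSig,
        StarAlgHom.comp_apply, StarAlgHom.comp_apply, tensorMap_tensorMap, hr]
  exact isomorphic_of_comul (Γ := wreath Γ n) (Λ := wreath Γ' n) f g hgf hfg
    fun a => DFunLike.congr_fun hf a

end QuantumPermGroup

/-! ### One-vertex graphs are neutral for free products. -/

namespace FinGraph

open QuantumPermGroup

theorem quU_eq_one (G : FinGraph) [Subsingleton G.V] (x y : G.V) : G.quU x y = 1 := by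
  let _ : Unique G.V := ⟨⟨y⟩, fun z => Subsingleton.elim z y⟩
  rw [← G.quU_intertwiner.magic.row_sum x]
  exact (Fintype.sum_unique fun z => G.quU x z).symm

theorem isIntertwiner_one (G : FinGraph) [Subsingleton G.V] {B : Type} [Ring B] [StarRing B]
    [Algebra ℂ B] [StarModule ℂ B] : IsIntertwiner (1 : B) G G fun _ _ => 1 := by
  let _ : Unique G.V := ⟨⟨Classical.arbitrary _⟩, fun z => Subsingleton.elim z _⟩
  refine IsIntertwiner.of_orth ⟨fun _ _ => star_one _, fun _ _ => one_mul _,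
    fun _ => Fintype.sum_unique _, fun _ => Fintype.sum_unique _,
    fun _ y y' h => absurd (Subsingleton.elim y y') h,
    fun x x' _ h => absurd (Subsingleton.elim x x') h⟩ fun x x' y y' hne => ?_
  rw [Subsingleton.elim x' x, Subsingleton.elim y' y] at hne
  exact absurd (by simp) hne

/-- The quantum automorphism group of a graph with one vertex is trivial. -/
theorem freeProd_qu_subsingleton (Γ : QuantumPermGroup) (G : FinGraph) [Subsingleton G.V] :
    Isomorphic Γ (freeProd Γ G.Qu) := by
  have hf : ∀ a, comulFreeProd Γ G.Qu (FreeProd.inl Γ.alg G.Qu.alg a)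
      = tensorMap (FreeProd.inl Γ.alg G.Qu.alg) (FreeProd.inl Γ.alg G.Qu.alg) (Γ.comul a) :=
    fun a => FreeProd.lift_inl _ _ a
  have h1 : (FreeProd.lift (StarAlgHom.id ℂ Γ.alg) (quLift _ G.isIntertwiner_one)).comp
      (FreeProd.inl Γ.alg G.Qu.alg) = StarAlgHom.id ℂ _ :=
    StarAlgHom.ext fun a => FreeProd.lift_inl _ _ a
  refine isomorphic_of_comul (Γ := Γ) (Λ := freeProd Γ G.Qu) (FreeProd.inl Γ.alg G.Qu.alg)
    (FreeProd.lift (StarAlgHom.id ℂ _) (quLift _ G.isIntertwiner_one)) h1 ?_ hf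
  refine FreeProd.hom_ext (fun a => congrArg (FreeProd.inl Γ.alg G.Qu.alg) (DFunLike.congr_fun h1 a)) fun b => ?_
  have h2 : ((FreeProd.inl Γ.alg G.Qu.alg).comp
      (FreeProd.lift (StarAlgHom.id ℂ _) (quLift _ G.isIntertwiner_one))).comp
      (FreeProd.inr Γ.alg G.Qu.alg) = FreeProd.inr Γ.alg G.Qu.alg := by
    refine hom_ext fun i j => ?_
    rw [show G.Qu.u i j = 1 from G.quU_eq_one i j, map_one, map_one]
  exact DFunLike.congr_fun h2 b

end FinGraph

/-! ### Copies of a connected graph and wreath products. -/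

namespace FinGraph

open QuantumPermGroup

/-- The disjoint union of `n` copies of a graph. -/
abbrev copies (n : ℕ) [NeZero n] (G : FinGraph) : FinGraph := sigma fun _ : Fin n => G

section Copies

variable {n : ℕ} [NeZero n] {G : FinGraph}

theorem isLabelling_fst (hG : G.graph.Connected) :
    IsLabelling (copies n G) fun a : Σ _ : Fin n, G.V => a.1 := by
  have key : ∀ a b : (copies n G).V, (copies n G).graph.Reachable a b → a.1 = b.1 := by
    intro a b h
    rw [SimpleGraph.reachable_iff_reflTransGen] at h
    induction h with
    | refl => rfl
    | tail _ hadj ih => exact ih.trans (fst_eq_of_sigma_adj hadj)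
  rintro ⟨i, x⟩ ⟨j, y⟩
  refine ⟨?_, key _ _⟩
  · rintro (rfl : i = j)
    let f : G.graph →g (copies n G).graph := ⟨fun z => ⟨i, z⟩, fun h => ⟨i, _, _, h, rfl, rfl⟩⟩
    exact (hG.preconnected x y).map f

variable {B : Type} [Ring B] [StarRing B] [Algebra ℂ B] [StarModule ℂ B]
  {U : Matrix (copies n G).V (copies n G).V B}

/-- The matrix of the action on the set of copies of `G`. -/
def copiesPerm (U : Matrix (copies n G).V (copies n G).V B) : Matrix (Fin n) (Fin n) B := fun i j =>
  blockSum U (fun a : Σ _ : Fin n, G.V => a.1) j ⟨i, Classical.arbitrary G.V⟩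

/-- The matrix of the action on the `i`-th copy of `G`. -/
def copiesNu (U : Matrix (copies n G).V (copies n G).V B) (i : Fin n) : Matrix G.V G.V B := fun x y =>
  ∑ j, U ⟨i, x⟩ ⟨j, y⟩

variable (hU : IsIntertwiner 1 (copies n G) (copies n G) U) (hG : G.graph.Connected)
include hU hG

/-- The arbitrary vertex in the definition of `copiesPerm` is harmless because `G` is connected. -/
theorem blockSum_fst (i j : Fin n) (x : G.V) :
    blockSum U (fun a : Σ _ : Fin n, G.V => a.1) j ⟨i, x⟩ = copiesPerm U i j :=
  hU.blockSum_reachable (fun _ _ h => fst_eq_of_sigma_adj h) 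
    ((isLabelling_fst hG ⟨i, x⟩ ⟨i, Classical.arbitrary G.V⟩).1 rfl) j

theorem blockSum_transpose_fst (i j : Fin n) (y : G.V) :
    blockSum U.transpose (fun a : Σ _ : Fin n, G.V => a.1) i ⟨j, y⟩ = copiesPerm U i j :=
  (hU.blockSum_eq (isLabelling_fst hG) (isLabelling_fst hG) ⟨i, Classical.arbitrary G.V⟩ ⟨j, y⟩).symm

theorem mul_copiesPerm (i j j' : Fin n) (x y : G.V) :
    U ⟨i, x⟩ ⟨j, y⟩ * copiesPerm U i j' = if j = j' then U ⟨i, x⟩ ⟨j, y⟩ else 0 := by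
  rw [← blockSum_fst hU hG i j' x]
  exact hU.magic.mul_blockSum _ _ _ _

theorem copiesPerm_mul (i j j' : Fin n) (x y : G.V) :
    copiesPerm U i j' * U ⟨i, x⟩ ⟨j, y⟩ = if j = j' then U ⟨i, x⟩ ⟨j, y⟩ else 0 := by
  rw [← blockSum_fst hU hG i j' x]
  exact hU.magic.blockSum_mul _ _ _ _

theorem copiesPerm_magic : IsMagic (copiesPerm U) where
  star_eq i j := hU.magic.star_blockSum _ _ _
  idem i j := (hU.magic.blockSum_mul_blockSum _ _ _ _).trans (if_pos rfl)
  row_sum i := hU.magic.sum_blockSum _ _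
  col_sum j := by
    simp only [← blockSum_transpose_fst hU hG _ j (Classical.arbitrary G.V)]
    exact hU.transpose.magic.sum_blockSum _ _
  row_orth i j k h := (hU.magic.blockSum_mul_blockSum _ _ _ _).trans (if_neg h)
  col_orth i k j h := by
    simp only [← blockSum_transpose_fst hU hG _ j (Classical.arbitrary G.V)]
    exact (hU.transpose.magic.blockSum_mul_blockSum _ _ _ _).trans (if_neg h)

/-- Inverts the wreath formula `w = ν(u) p`: the entries of `U` factor through the action inside a
copy and the action on the set of copies. -/
theorem copiesNu_mul_copiesPerm (i j : Fin n) (x y : G.V) :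
    copiesNu U i x y * copiesPerm U i j = U ⟨i, x⟩ ⟨j, y⟩ := by
  simp only [copiesNu, Finset.sum_mul, mul_copiesPerm hU hG, Finset.sum_ite_eq', Finset.mem_univ,
    if_true]

theorem copiesPerm_mul_copiesNu (i j : Fin n) (x y : G.V) :
    copiesPerm U i j * copiesNu U i x y = U ⟨i, x⟩ ⟨j, y⟩ := by
  simp only [copiesNu, Finset.mul_sum, copiesPerm_mul hU hG, Finset.sum_ite_eq', Finset.mem_univ,
    if_true]

/-- Terms from different target copies cancel, because entries of `copiesPerm` in a row are
orthogonal. The relations for `copiesNu` can then be checked copy by copy on `U`. -/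
theorem copiesNu_mul_copiesNu (i : Fin n) (x x' y y' : G.V) :
    copiesNu U i x y * copiesNu U i x' y' = ∑ j, U ⟨i, x⟩ ⟨j, y⟩ * U ⟨i, x'⟩ ⟨j, y'⟩ := by
  conv_lhs => rw [copiesNu, Finset.sum_mul]
  refine Finset.sum_congr rfl fun j _ => ?_
  have h : U ⟨i, x⟩ ⟨j, y⟩ = U ⟨i, x⟩ ⟨j, y⟩ * copiesPerm U i j := by
    rw [mul_copiesPerm hU hG, if_pos rfl]
  conv_lhs => rw [h, mul_assoc, copiesPerm_mul_copiesNu hU hG]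

theorem copiesNu_intertwiner (i : Fin n) : IsIntertwiner 1 G G (copiesNu U i) := by
  refine IsIntertwiner.of_orth ⟨fun x y => ?_, fun x y => ?_, fun x => ?_, fun y => ?_,
    fun x y y' h => ?_, fun x x' y h => ?_⟩ fun x x' y y' h => ?_
  · rw [copiesNu, star_sum]
    exact Finset.sum_congr rfl fun j _ => hU.magic.star_eq _ _
  · rw [copiesNu_mul_copiesNu hU hG]
    exact Finset.sum_congr rfl fun j _ => hU.magic.idem _ _
  · rw [← hU.magic.row_sum ⟨i, x⟩]
    refine Eq.trans ?_ (Fintype.sum_sigma _).symm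
    exact Finset.sum_comm
  · rw [← (copiesPerm_magic hU hG).row_sum i]
    refine Finset.sum_comm.trans (Finset.sum_congr rfl fun j _ => ?_)
    rw [← blockSum_transpose_fst hU hG i j y]
    change _ = ∑ a : (Σ _ : Fin n, G.V) with a.1 = i, U a ⟨j, y⟩
    refine Finset.sum_nbij' (fun x => ⟨i, x⟩) (fun a => a.2) (fun x _ => by simp) (fun a _ => by simp)
      (fun x _ => rfl) ?_ (fun x _ => rfl)
    rintro ⟨i', x⟩ ha
    obtain rfl : i' = i := (Finset.mem_filter.1 ha).2
    rfl
  · rw [copiesNu_mul_copiesNu hU hG]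
    refine Finset.sum_eq_zero fun j _ => hU.magic.row_orth _ _ _ fun e => h ?_
    exact eq_of_heq (Sigma.mk.inj_iff.1 e).2
  · rw [copiesNu_mul_copiesNu hU hG]
    refine Finset.sum_eq_zero fun j _ => hU.magic.col_orth _ _ _ fun e => h ?_
    exact eq_of_heq (Sigma.mk.inj_iff.1 e).2
  · rw [copiesNu_mul_copiesNu hU hG]
    refine Finset.sum_eq_zero fun j _ => hU.orth ?_
    rwa [sigma_adj, sigma_adj]

end Copies

/-- The quantum automorphism group of `n` copies of a connected graph is a wreath product. -/
theorem qu_copies {G : FinGraph} (hG : G.graph.Connected) (n : ℕ) [NeZero n] :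
    Isomorphic (copies n G).Qu (wreath G.Qu n) := by
  have hU := (copies n G).quU_intertwiner
  let e : (Σ _ : Fin n, G.V) ≃ Fin n × G.V := Equiv.sigmaEquivProd _ _
  let v : Matrix (copies n G).V (copies n G).V (WreathAlg G.Qu n) := fun a b =>
    WreathAlg.nu G.Qu n a.1 (G.quU a.2 b.2) * WreathAlg.p G.Qu n a.1 b.1
  have hw : IsMagic (wreath G.Qu n).u := (wreath G.Qu n).magic
  have hv : IsIntertwiner 1 (copies n G) (copies n G) v := by
    refine IsIntertwiner.of_orth ⟨fun a b => hw.star_eq (e a) (e b), fun a b => hw.idem (e a) (e b),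
      fun a => ?_, fun b => ?_, fun a b b' h => hw.row_orth (e a) _ _ (e.injective.ne h),
      fun a a' b h => hw.col_orth _ _ (e b) (e.injective.ne h)⟩ ?_
    · exact (Equiv.sum_comp e fun z => (wreath G.Qu n).u (e a) z).trans (hw.row_sum (e a))
    · exact (Equiv.sum_comp e fun z => (wreath G.Qu n).u z (e b)).trans (hw.col_sum (e b))
    · rintro ⟨i, x⟩ ⟨i', x'⟩ ⟨j, y⟩ ⟨j', y'⟩ hne
      change (WreathAlg.nu G.Qu n i (G.quU x y) * WreathAlg.p G.Qu n i j)
        * (WreathAlg.nu G.Qu n i' (G.quU x' y') * WreathAlg.p G.Qu n i' j') = 0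
      have hp := WreathAlg.p_magic G.Qu n
      rw [(WreathAlg.comm G.Qu n i' j' _).eq, mul_assoc, ← mul_assoc (WreathAlg.p G.Qu n i j)]
      -- Within one source copy and one target copy the relation is that of `Qu(G)`; if only one of
      -- them agrees, `p` provides the orthogonality; if both differ, there are no edges on either
      -- side.
      by_cases hi : i = i'
      · subst hi
        by_cases hj : j = j'
        · subst hj
          rw [sigma_adj, sigma_adj] at hne
          rw [hp.idem, ← (WreathAlg.comm G.Qu n i j _).eq, ← mul_assoc, ← map_mul,
            G.quU_intertwiner.orth hne, map_zero, zero_mul]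
        · rw [hp.row_orth _ _ _ hj, zero_mul, mul_zero]
      · by_cases hj : j = j'
        · subst hj
          rw [hp.col_orth _ _ _ hi, zero_mul, mul_zero]
        · exact absurd (iff_of_false (fun h => hi (fst_eq_of_sigma_adj h))
            (fun h => hj (fst_eq_of_sigma_adj h))) hne
  -- The wreath relation needs checking on generators only, where both products equal the same entry
  -- of `U`.
  have hcomm : ∀ i j a, Commute (quLift _ (copiesNu_intertwiner hU hG i) a)
      (splusLift _ (copiesPerm_magic hU hG) (splusU n i j)) := by
    intro i j a
    rw [splusLift_u]
    refine commute_of_generators _ ((copiesPerm_magic hU hG).star_eq i j) (fun x y => ?_) a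
    rw [show quLift _ (copiesNu_intertwiner hU hG i) (G.Qu.u x y) = _ from quLift_u _ _ x y]
    exact (copiesNu_mul_copiesPerm hU hG i j x y).trans (copiesPerm_mul_copiesNu hU hG i j x y).symm
  refine isomorphic_of_equiv (Γ := (copies n G).Qu) (Λ := wreath G.Qu n) e (quLift v hv)
    (WreathAlg.lift (fun i => quLift _ (copiesNu_intertwiner hU hG i))
      (splusLift _ (copiesPerm_magic hU hG)) hcomm) (fun a b => quLift_u _ _ a b) ?_
  rintro ⟨i, x⟩ ⟨j, y⟩
  change WreathAlg.lift _ _ hcomm (WreathAlg.nu G.Qu n i (G.quU x y) *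
    WreathAlg.sig G.Qu n (splusU n i j)) = _
  rw [map_mul, WreathAlg.lift_nu, WreathAlg.lift_sig, quLift_u, splusLift_u]
  exact copiesNu_mul_copiesPerm hU hG i j x y

end FinGraph

/-! ### Quantum automorphism groups of `F`-cographs and Jordan closures. -/

namespace FinGraph

theorem component_sigma {ι : Type} [Fintype ι] [Nonempty ι] {K : ι → FinGraph}
    (hK : ∀ i, (K i).graph.Connected) (a : Σ i, (K i).V) :
    Nonempty ((K a.1).graph ≃g
      ((sigma K).component ((sigma K).graph.connectedComponentMk a)).graph) := by
  obtain ⟨i, x⟩ := a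
  let f : (K i).graph ↪g (sigma K).graph :=
    { toFun := fun z => ⟨i, z⟩
      inj' := fun z w h => eq_of_heq (Sigma.mk.inj_iff.1 h).2
      map_rel_iff' := sigma_adj }
  obtain ⟨e⟩ := nonempty_component_iso f (fun z => by
    rintro ⟨j, w⟩ h
    obtain rfl : i = j := fst_eq_of_sigma_adj h
    exact ⟨w, rfl⟩) x
  exact ⟨(nonempty_component_iso_self (hK i) _).some.symm.trans e⟩

end FinGraph

namespace GraphClass

open FinGraph QuantumPermGroup

variable {F : GraphClass}

theorem mk_qu_mem {F : GraphClass} {G : FinGraph} {Γ : QuantumPermGroup} (hG : ⟦G⟧ ∈ F)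
    (h : Isomorphic Γ G.Qu) : (⟦Γ⟧ : Quotient QuantumPermGroup.setoid) ∈ F.Qu :=
  ⟨G, hG, Quotient.sound h⟩

section Sums

variable (hQI : F.QI) (hcompl : F.ClosedCompl) (hcomponent : F.ClosedComponent)
include hQI hcompl hcomponent

/-- Multiplying the entry by the unit of its block gives the entry back. A nonzero entry therefore
forces a nonzero unit, and rigidity makes the two components isomorphic. -/
theorem quU_eq_zero {G : FinGraph} (hG : ⟦G⟧ ∈ F.co) {x y : G.V}
    (h : ¬ Nonempty ((G.component (G.graph.connectedComponentMk y)).graph ≃g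
      (G.component (G.graph.connectedComponentMk x)).graph)) : G.quU x y = 0 := by
  classical
  by_contra hne
  have hU := G.quU_intertwiner
  have hc := co_closedComponent hcompl hcomponent
  refine h (nonempty_iso_of_isIntertwiner hQI hcompl hcomponent (hc G hG _) (hc G hG _) ?_
    (hU.component (G.graph.connectedComponentMk y) (G.graph.connectedComponentMk x) (x₀ := x) rfl))
  intro h0
  refine hne ?_
  have h1 := hU.magic.mul_blockSum G.graph.connectedComponentMk (G.graph.connectedComponentMk y) x y
  rw [blockSum_component, h0, mul_zero, if_pos rfl] at h1
  exact h1.symm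

theorem qu_sum_isomorphic {G H : FinGraph} (hG : ⟦G⟧ ∈ F.co) (hH : ⟦H⟧ ∈ F.co)
    (h : ∀ x y, ¬ Nonempty ((G.component (G.graph.connectedComponentMk x)).graph ≃g
      (H.component (H.graph.connectedComponentMk y)).graph)) :
    Isomorphic (G.sum H).Qu (freeProd G.Qu H.Qu) := by
  refine qu_sum G H (fun x y => ?_) (fun x y => ?_)
  · refine quU_eq_zero hQI hcompl hcomponent (co_closedSum G H hG hH) ?_
    rintro ⟨e⟩
    exact h x y ⟨(component_sum_inl G H x).some.trans
      (e.symm.trans (component_sum_inr G H y).some.symm)⟩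
  · refine quU_eq_zero hQI hcompl hcomponent (co_closedSum G H hG hH) ?_
    rintro ⟨e⟩
    exact h y x ⟨(component_sum_inl G H y).some.trans
      (e.trans (component_sum_inr G H x).some.symm)⟩

theorem qu_sum_isomorphic_of_connected {G H : FinGraph} (hG : ⟦G⟧ ∈ F.co) (hH : ⟦H⟧ ∈ F.co)
    (hG' : G.graph.Connected) (hH' : H.graph.Connected) (h : ¬ Nonempty (G.graph ≃g H.graph)) :
    Isomorphic (G.sum H).Qu (freeProd G.Qu H.Qu) := by
  refine qu_sum_isomorphic hQI hcompl hcomponent hG hH fun x y => ?_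
  rintro ⟨e⟩
  exact h ⟨(nonempty_component_iso_self hG' _).some.symm.trans
    (e.trans (nonempty_component_iso_self hH' _).some)⟩

omit hQI hcompl hcomponent in
theorem exists_connected {G : FinGraph} (hG : ⟦G⟧ ∈ F.co) :
    ∃ G' : FinGraph, ⟦G'⟧ ∈ F.co ∧ G'.graph.Connected ∧ Isomorphic G.Qu G'.Qu := by
  rcases SimpleGraph.connected_or_connected_compl (G := G.graph) with h | h
  · exact ⟨G, hG, h, Isomorphic.refl _⟩
  · exact ⟨G.compl, co_closedCompl G hG, h, (qu_compl G).symm⟩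

variable (hK1 : ⟦K1⟧ ∈ F)
include hK1

/-- Nonisomorphic connected cographs turn sums into free products. Isomorphic ones are separated by
adding a vertex and taking the complement, which alters the second graph but not its quantum group.
-/
theorem freeProd_mem {G H : FinGraph} (hG : ⟦G⟧ ∈ F.co) (hH : ⟦H⟧ ∈ F.co) :
    (⟦freeProd G.Qu H.Qu⟧ : Quotient QuantumPermGroup.setoid) ∈ F.co.Qu := by
  obtain ⟨G', hG', hGc, eG⟩ := exists_connected hG
  obtain ⟨H', hH', hHc, eH⟩ := exists_connected hH
  have e := freeProd_congr eG eH
  by_cases hiso : Nonempty (G'.graph ≃g H'.graph)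
  -- One vertex is exceptional: `K1 + K1` would give `S_2^+`. But then the second factor is trivial
  -- and may be dropped.
  · rcases subsingleton_or_nontrivial H'.V with hs | hs
    · exact mk_qu_mem hG' (e.trans (freeProd_qu_subsingleton G'.Qu H').symm)
    · have hK : ⟦K1⟧ ∈ F.co := subset_co hK1
      have hKc : K1.graph.Connected := SimpleGraph.Connected.of_subsingleton (V := Unit)
      have hHK : ⟦(H'.sum K1).compl⟧ ∈ F.co := co_closedCompl _ (co_closedSum _ _ hH' hK)
      have hHKc : (H'.sum K1).compl.graph.Connected :=
        (SimpleGraph.connected_or_connected_compl (G := (H'.sum K1).graph)).resolve_left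
          SimpleGraph.not_connected_sum
      have : Subsingleton K1.V := inferInstanceAs (Subsingleton Unit)
      have e1 : Isomorphic (H'.sum K1).Qu (freeProd H'.Qu K1.Qu) :=
        qu_sum_isomorphic_of_connected hQI hcompl hcomponent hH' hK hHc hKc fun ⟨f⟩ =>
          not_subsingleton H'.V f.toEquiv.subsingleton
      have e2 : Isomorphic H'.Qu (H'.sum K1).compl.Qu :=
        (freeProd_qu_subsingleton H'.Qu K1).trans (e1.symm.trans (qu_compl _).symm)
      refine mk_qu_mem (co_closedSum _ _ hG' hHK) (e.trans ((freeProd_congr (Isomorphic.refl _)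
        e2).trans (qu_sum_isomorphic_of_connected hQI hcompl hcomponent hG' hHK hGc hHKc ?_).symm))
      rintro ⟨f⟩
      -- The modified graph has one vertex more, hence cannot be isomorphic to `G'`.
      have h1 := Fintype.card_congr (hiso.some.symm.trans f).toEquiv
      have h2 : Fintype.card (H'.sum K1).compl.V = Fintype.card H'.V + 1 :=
        (Fintype.card_sum (α := H'.V) (β := Unit)).trans (by simp)
      omega
  · exact mk_qu_mem (co_closedSum G' H' hG' hH') (e.trans
      (qu_sum_isomorphic_of_connected hQI hcompl hcomponent hG' hH' hGc hHc hiso).symm)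

omit hQI hcompl hcomponent hK1 in
theorem wreath_mem {G : FinGraph} (hG : ⟦G⟧ ∈ F.co) (n : ℕ) [NeZero n] :
    (⟦wreath G.Qu n⟧ : Quotient QuantumPermGroup.setoid) ∈ F.co.Qu := by
  obtain ⟨G', hG', hGc, eG⟩ := exists_connected hG
  exact mk_qu_mem (co_closedSum.sigma _ fun _ => hG') ((wreath_congr n eG).trans (qu_copies hGc n).symm)

theorem jordanClosure_subset {Q : Set (Quotient QuantumPermGroup.setoid)} (hQ : Q ⊆ F.co.Qu) :
    jordanClosure Q ⊆ F.co.Qu := by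
  refine Set.sInter_subset_of_mem ⟨hQ, ?_, ?_⟩
  · rintro Γ Λ ⟨G, hG, h⟩ ⟨H, hH, h'⟩
    have : (⟦freeProd Γ Λ⟧ : Quotient QuantumPermGroup.setoid) = ⟦freeProd G.Qu H.Qu⟧ :=
      Quotient.sound (freeProd_congr (Quotient.exact h) (Quotient.exact h'))
    rw [this]
    exact freeProd_mem hQI hcompl hcomponent hK1 hG hH
  · rintro Γ n _ ⟨G, hG, h⟩
    have : (⟦wreath Γ n⟧ : Quotient QuantumPermGroup.setoid) = ⟦wreath G.Qu n⟧ :=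
      Quotient.sound (wreath_congr n (Quotient.exact h))
    rw [this]
    exact wreath_mem hG n

end Sums

theorem subset_jordanClosure {Q : Set (Quotient QuantumPermGroup.setoid)} : Q ⊆ jordanClosure Q :=
  Set.subset_sInter fun _ hS => hS.1

theorem freeProd_mem_jordanClosure {Q : Set (Quotient QuantumPermGroup.setoid)}
    {Γ Λ : QuantumPermGroup} (h : ⟦Γ⟧ ∈ jordanClosure Q) (h' : ⟦Λ⟧ ∈ jordanClosure Q) :
    ⟦freeProd Γ Λ⟧ ∈ jordanClosure Q := fun S hS => hS.2.1 Γ Λ (h S hS) (h' S hS)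

theorem wreath_mem_jordanClosure {Q : Set (Quotient QuantumPermGroup.setoid)}
    {Γ : QuantumPermGroup} (n : ℕ) [NeZero n] (h : ⟦Γ⟧ ∈ jordanClosure Q) :
    ⟦wreath Γ n⟧ ∈ jordanClosure Q := fun S hS => hS.2.2 Γ n (h S hS)

theorem mem_of_isomorphic {S : Set (Quotient QuantumPermGroup.setoid)} {Γ Λ : QuantumPermGroup}
    (e : Isomorphic Γ Λ) (h : ⟦Λ⟧ ∈ S) : ⟦Γ⟧ ∈ S := by
  rwa [show (⟦Γ⟧ : Quotient QuantumPermGroup.setoid) = ⟦Λ⟧ from Quotient.sound e]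

/-- A graph consists of copies of a component, and possibly of another graph. -/
theorem exists_copies {G : FinGraph} (c : G.graph.ConnectedComponent) :
    ∃ (n : ℕ) (_ : NeZero n), Nonempty (G.graph ≃g (copies n (G.component c)).graph) ∨
      ∃ (ι : Type) (_ : Fintype ι) (_ : Nonempty ι) (d : ι → G.graph.ConnectedComponent),
        (∀ i, ¬ Nonempty ((G.component c).graph ≃g (G.component (d i)).graph)) ∧
        Nonempty (G.graph ≃g ((copies n (G.component c)).sum (sigma fun i => G.component (d i))).graph) := by
  classical
  let p : G.graph.ConnectedComponent → Prop := fun d =>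
    Nonempty ((G.component c).graph ≃g (G.component d).graph)
  have hc : p c := ⟨SimpleGraph.Iso.refl⟩
  let n := Fintype.card {d // p d}
  have hn : NeZero n := ⟨(Fintype.card_pos_iff.2 ⟨⟨c, hc⟩⟩).ne'⟩
  let e : Fin n ≃ {d // p d} := (Fintype.equivFin _).symm
  refine ⟨n, hn, ?_⟩
  by_cases h : ∀ d, p d
  · let σ : Fin n ≃ G.graph.ConnectedComponent := e.trans (Equiv.subtypeUnivEquiv h)
    exact Or.inl ⟨(sigmaComponent G).symm.trans
      (sigmaCongr (K := fun _ => G.component c) σ fun i => (h (σ i)).some).symm⟩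
  · push Not at h
    obtain ⟨d₀, hd₀⟩ := h
    let σ : Fin n ⊕ {d // ¬ p d} ≃ G.graph.ConnectedComponent :=
      (Equiv.sumCongr e (Equiv.refl _)).trans (Equiv.sumCompl p)
    have : Nonempty {d // ¬ p d} := ⟨⟨d₀, hd₀⟩⟩
    refine Or.inr ⟨{d // ¬ p d}, inferInstance, this, Subtype.val, fun i => i.2, ?_⟩
    let M : Fin n ⊕ {d // ¬ p d} → FinGraph :=
      Sum.elim (fun _ => G.component c) fun d => G.component d.1
    have hM : ∀ s, Nonempty ((M s).graph ≃g (G.component (σ s)).graph) := by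
      rintro (i | d)
      · exact (e i).2
      · exact ⟨SimpleGraph.Iso.refl⟩
    exact ⟨(sigmaComponent G).symm.trans
      ((sigmaCongr (K := M) σ fun s => (hM s).some).symm.trans (sigmaSum M))⟩

section Jordan

variable (hQI : F.QI) (hcompl : F.ClosedCompl) (hcomponent : F.ClosedComponent)
include hQI hcompl hcomponent

/-- Induction on the number of vertices. Up to complements either `G` is disconnected, or `G` and
its complement are both connected, and then `G` lies in `F`. -/
theorem qu_mem_jordanClosure {G : FinGraph} (hG : ⟦G⟧ ∈ F.co) :
    (⟦G.Qu⟧ : Quotient QuantumPermGroup.setoid) ∈ jordanClosure F.conn.Qu := by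
  induction hn : Fintype.card G.V using Nat.strong_induction_on generalizing G with
  | _ m ih =>
  subst hn
  have step : ∀ G' : FinGraph, ⟦G'⟧ ∈ F.co → Fintype.card G'.V = Fintype.card G.V →
      ¬ G'.graph.Connected → ⟦G'.Qu⟧ ∈ jordanClosure F.conn.Qu := by
    intro G' hG' hcard hconn
    let c := G'.graph.connectedComponentMk (Classical.arbitrary G'.V)
    have hcomp := co_closedComponent hcompl hcomponent G' hG'
    obtain ⟨n, _, ⟨⟨e⟩⟩ | ⟨ι, _, _, d, hd, ⟨e⟩⟩⟩ := exists_copies c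
    · refine mem_of_isomorphic ((qu_isomorphic e).trans (qu_copies (component_connected G' c) n)) ?_
      exact wreath_mem_jordanClosure n (ih _ (hcard ▸ card_component_lt hconn c) (hcomp c) rfl)
    · have hC : ⟦copies n (G'.component c)⟧ ∈ F.co := co_closedSum.sigma _ fun _ => hcomp c
      have hD : ⟦sigma fun i => G'.component (d i)⟧ ∈ F.co := co_closedSum.sigma _ fun i => hcomp _
      -- All copies of the chosen component are grouped on one side, so the two summands share no
      -- component and the quantum group splits as a free product.
      have e1 := qu_sum_isomorphic hQI hcompl hcomponent hC hD fun a b => by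
        rintro ⟨f⟩
        exact hd b.1 ⟨(component_sigma (K := fun _ : Fin n => G'.component c)
          (fun _ => component_connected G' c) a).some.trans
          (f.trans (component_sigma (fun i => component_connected G' (d i)) b).some.symm)⟩
      refine mem_of_isomorphic ((qu_isomorphic e).trans (e1.trans (freeProd_congr
        (qu_copies (component_connected G' c) n) (Isomorphic.refl _)))) ?_
      refine freeProd_mem_jordanClosure (wreath_mem_jordanClosure n
        (ih _ (hcard ▸ card_component_lt hconn c) (hcomp c) rfl)) (ih _ ?_ hD rfl)
      -- The remaining graph is smaller because at least one copy of the chosen component was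
      -- removed.
      rw [← hcard, Fintype.card_congr e.toEquiv]
      exact (Nat.lt_add_of_pos_left Fintype.card_pos).trans_eq
        (Fintype.card_sum (α := (copies n (G'.component c)).V)).symm
  by_cases hc : G.graph.Connected
  · by_cases hc' : G.compl.graph.Connected
    · have hF := (isCograph hcompl hcomponent hG).base hc hc'
      exact subset_jordanClosure ⟨G, ⟨G, rfl, hF, hc⟩, rfl⟩
    · exact mem_of_isomorphic (qu_compl G).symm (step _ (co_closedCompl G hG) rfl hc')
  · exact step G hG rfl hc

end Jordan

end GraphClass

end QGraph

end

theorem mainTheorem8 (F : QGraph.GraphClass)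
    (hK1 : (⟦QGraph.FinGraph.K1⟧ : Quotient QGraph.FinGraph.setoid) ∈ F)
    (hQI : F.QI)
    (hcompl : F.ClosedCompl)
    (hcomponent : F.ClosedComponent) :
    QGraph.GraphClass.Qu F.co = QGraph.QuantumPermGroup.jordanClosure (QGraph.GraphClass.Qu F.conn) ∧
      QGraph.GraphClass.Qu F.co =
        QGraph.QuantumPermGroup.jordanClosure (QGraph.GraphClass.Qu F.co) := by
  have h1 : QGraph.QuantumPermGroup.jordanClosure F.co.Qu = F.co.Qu := Set.Subset.antisymm
    (QGraph.GraphClass.jordanClosure_subset hQI hcompl hcomponent hK1 subset_rfl) QGraph.GraphClass.subset_jordanClosure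
  refine ⟨Set.Subset.antisymm ?_ ?_, h1.symm⟩
  · rintro _ ⟨G, hG, rfl⟩
    exact QGraph.GraphClass.qu_mem_jordanClosure hQI hcompl hcomponent hG
  · refine QGraph.GraphClass.jordanClosure_subset hQI hcompl hcomponent hK1 ?_
    rintro _ ⟨G, ⟨G', hG', hF, -⟩, rfl⟩
    exact ⟨G, QGraph.GraphClass.subset_co hF, rfl⟩
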